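/- Let $0<q<1$ and let $A$ be the symmetric operator in $\ell^2(\mathbb{Z})$ with domain $\operatorname{span}\{e_n : n\in\mathbb{Z}\}$ and $Ae_n=q^{-n+1}e_{n-1}+q^{-n}e_{n+1}$. For a sequence $\psi$ put $(\mathcal{A}\psi)_n=q^{-n+1}\psi_{n-1}+q^{-n}\psi_{n+1}$, and let $D=\{\psi\in\ell^2(\mathbb{Z}) : \mathcal{A}\psi\in\ell^2(\mathbb{Z})\}$. For $t\in\mathbb{R}\cup\{\infty\}$ let $A_t$ act as $\mathcal{A}$ on \[ \operatorname{Dom}A_t=\Big\{\psi\in D : \lim_{n\to\infty}q^{-n}(\psi_{2n+1}+t\psi_{2n})=0 \text{ and } \lim_{n\to\infty}q^{-n}(q\psi_{2n-1}-t\psi_{2n})=0\Big\}\quad (t\in\mathbb{R}), \] \[ \operatorname{Dom}A_\infty=\Big\{\psi\in D : \lim_{n\to\infty}q^{-n}\psi_{2n}=0\Big\}. \] Write $(a;q)_\infty=\prod_{n\ge0}(1-aq^n)$ and $\theta_q(x)=(x;q)_\infty(qx^{-1};q)_\infty$, and let $\vartheta_1(z\mid q)=\mathrm{i}q^{1/4}e^{-\mathrm{i}z}(q^2;q^2)_\infty\theta_{q^2}(e^{2\mathrm{i}z})$,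 $\vartheta_2(z\mid q)=q^{1/4}e^{-\mathrm{i}z}(q^2;q^2)_\infty\theta_{q^2}(-e^{2\mathrm{i}z})$, $\vartheta_3(z\mid q)=(q^2;q^2)_\infty\theta_{q^2}(-qe^{2\mathrm{i}z})$, $\vartheta_4(z\mid q)=(q^2;q^2)_\infty\theta_{q^2}(qe^{2\mathrm{i}z})$ be the Jacobi theta functions. Write $\vartheta_j=\vartheta_j(0\mid q^2)$ for $j=2,3,4$ and \[ \Phi(s)=\mathrm{i}q^{1/2}\,\frac{\vartheta_4(\mathrm{i}s\mid q^2)}{\vartheta_1(\mathrm{i}s\mid q^2)},\qquad \Phi(0)=\infty . \] Then the following hold. 1. The operators $A_t$, $t\in\mathbb{R}\cup\{\infty\}$, are precisely the self-adjoint extensions of $A$. 2. $\Phi$ is real-valued and strictly decreasing on $(0,-2\ln q)$, and maps $[0,-2\ln q)$ bijectively onto $\mathbb{R}\cup\{\infty\}$. On $(0,-2\ln q)$ one has $\Phi(s)=q^{1/2}\frac{\vartheta_3}{\vartheta_2}\operatorname{cs}(s\vartheta_3^2,k')$ with modulus $k'=\vartheta_4^2/\vartheta_3^2$, where $\operatorname{cs}=\operatorname{cn}/\operatorname{sn}$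 is the Jacobian elliptic function. The inverse of $\Phi:[0,-2\ln q)\to\mathbb{R}\cup\{\infty\}$ is given by the convergent elliptic integral \[ \Phi^{-1}(t)=\frac{q^{1/2}}{\vartheta_2\vartheta_3}\int_t^\infty\left[\left(\frac{q\,\vartheta_3^2}{\vartheta_2^2}+x^2\right)\left(\frac{q\,\vartheta_2^2}{\vartheta_3^2}+x^2\right)\right]^{-1/2}dx , \] read as $0$ for $t=\infty$. 3. For every $t\in\mathbb{R}\cup\{\infty\}$, with $s=\Phi^{-1}(t)$, the point spectrum (the set of eigenvalues) of $A_t$ is \[ \operatorname{spec}_p(A_t)=\{-e^{-s}q^{2m} : m\in\mathbb{Z}\}\cup\{e^{s}q^{2n} : n\in\mathbb{Z}\}. \] -/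

import Mathlib

open Filter Topology Set

noncomputable section

/-- The Hilbert space `ℓ²(ℤ)` of square summable complex sequences. -/
abbrev EllTwo : Type := lp (fun _ : ℤ => ℂ) 2

/-- The standard basis vector `e_n` of `ℓ²(ℤ)`. -/
def basisVec (n : ℤ) : EllTwo := lp.single 2 n (1 : ℂ)

/-- The doubly infinite Jacobi matrix applied to a sequence:
`(𝒜 ψ)_n = q^{-n+1} ψ_{n-1} + q^{-n} ψ_{n+1}`. -/
def jacobiExpr (q : ℝ) (ψ : ℤ → ℂ) (n : ℤ) : ℂ :=
  (q : ℂ) ^ (-n + 1) * ψ (n - 1) + (q : ℂ) ^ (-n) * ψ (n + 1)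

theorem jacobiExpr_add (q : ℝ) (ψ χ : ℤ → ℂ) :
    jacobiExpr q (ψ + χ) = jacobiExpr q ψ + jacobiExpr q χ := by
  funext n
  simp only [jacobiExpr, Pi.add_apply]
  ring

theorem jacobiExpr_smul (q : ℝ) (c : ℂ) (ψ : ℤ → ℂ) :
    jacobiExpr q (c • ψ) = c • jacobiExpr q ψ := by
  funext n
  simp only [jacobiExpr, Pi.smul_apply, smul_eq_mul]
  ring

theorem jacobiExpr_zero (q : ℝ) : jacobiExpr q 0 = 0 := by
  funext n
  simp [jacobiExpr]

/-- The maximal domain `D = {ψ ∈ ℓ²(ℤ) ∣ 𝒜 ψ ∈ ℓ²(ℤ)}`. -/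
def maxDomain (q : ℝ) : Submodule ℂ EllTwo where
  carrier := {ψ | Memℓp (jacobiExpr q ψ) 2}
  add_mem' := by
    intro a b ha hb
    simp only [mem_ofPred_eq, lp.coeFn_add, jacobiExpr_add] at *
    exact ha.add hb
  zero_mem' := by
    simp only [mem_ofPred_eq, lp.coeFn_zero, jacobiExpr_zero]
    exact zero_memℓp
  smul_mem' := by
    intro c a ha
    simp only [mem_ofPred_eq, lp.coeFn_smul, jacobiExpr_smul] at *
    exact ha.const_smul c

/-- The maximal operator `A_max`: the Jacobi matrix acting on the domain `D`. -/
def Amax (q : ℝ) : EllTwo →ₗ.[ℂ] EllTwo where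
  domain := maxDomain q
  toFun :=
    { toFun := fun ψ => ⟨jacobiExpr q (ψ : EllTwo), ψ.2⟩
      map_add' := by
        intro a b
        apply lp.ext
        simp only [Submodule.coe_add, lp.coeFn_add, jacobiExpr_add]
      map_smul' := by
        intro c a
        apply lp.ext
        simp only [Submodule.coe_smul, lp.coeFn_smul, jacobiExpr_smul, RingHom.id_apply] }

/-- The operator `A` with domain `span {e_n ∣ n ∈ ℤ}` (see `Amin_domain` and `Amin_basisVec`). -/
def Amin (q : ℝ) : EllTwo →ₗ.[ℂ] EllTwo :=
  (Amax q).domRestrict (Submodule.span ℂ (range basisVec))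

theorem jacobiExpr_basisVec (q : ℝ) (n : ℤ) :
    jacobiExpr q (basisVec n) =
      ⇑((q : ℂ) ^ (-n + 1) • basisVec (n - 1) + (q : ℂ) ^ (-n) • basisVec (n + 1)) := by
  funext k
  simp only [jacobiExpr, basisVec, lp.coeFn_add, lp.coeFn_smul, Pi.add_apply, Pi.smul_apply,
    lp.coeFn_single, smul_eq_mul, Pi.single_apply]
  by_cases h1 : k = n + 1
  · subst h1
    have h2 : ¬ (n + 1 + 1 = n) := by omega
    have h3 : ¬ (n + 1 = n - 1) := by omega
    simp [h2, h3]
  · by_cases h2 : k = n - 1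
    · subst h2
      have h3 : ¬ (n - 1 - 1 = n) := by omega
      have h4 : ¬ (n - 1 = n + 1) := by omega
      have h5 : -(n - 1) = -n + 1 := by ring
      simp [h3, h4, h5]
    · have h3 : ¬ (k - 1 = n) := by omega
      have h4 : ¬ (k + 1 = n) := by omega
      simp [h1, h2, h3, h4]

theorem basisVec_mem_maxDomain (q : ℝ) (n : ℤ) : basisVec n ∈ maxDomain q := by
  change Memℓp (jacobiExpr q (basisVec n)) 2
  rw [jacobiExpr_basisVec]
  exact lp.memℓp _

theorem Amin_domain (q : ℝ) : (Amin q).domain = Submodule.span ℂ (range basisVec) := by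
  refine inf_eq_left.mpr (Submodule.span_le.mpr ?_)
  rintro _ ⟨n, rfl⟩
  exact basisVec_mem_maxDomain q n

/-- `A e_n = q^{-n+1} e_{n-1} + q^{-n} e_{n+1}`. -/
theorem Amin_basisVec (q : ℝ) (n : ℤ) (h : basisVec n ∈ (Amin q).domain) :
    Amin q ⟨basisVec n, h⟩ =
      (q : ℂ) ^ (-n + 1) • basisVec (n - 1) + (q : ℂ) ^ (-n) • basisVec (n + 1) :=
  lp.ext (jacobiExpr_basisVec q n)

/-- The boundary condition at `+∞` labelled by `t ∈ ℝ ∪ {∞}`. -/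
def BoundaryCond (q : ℝ) (ψ : ℤ → ℂ) : OnePoint ℝ → Prop
  | OnePoint.some t =>
      Tendsto (fun n : ℤ => (q : ℂ) ^ (-n) * (ψ (2 * n + 1) + (t : ℂ) * ψ (2 * n)))
          atTop (𝓝 0) ∧
        Tendsto (fun n : ℤ => (q : ℂ) ^ (-n) * ((q : ℂ) * ψ (2 * n - 1) - (t : ℂ) * ψ (2 * n)))
          atTop (𝓝 0)
  | OnePoint.infty => Tendsto (fun n : ℤ => (q : ℂ) ^ (-n) * ψ (2 * n)) atTop (𝓝 0)

theorem BoundaryCond.add {q : ℝ} {ψ χ : ℤ → ℂ} {t : OnePoint ℝ}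
    (h₁ : BoundaryCond q ψ t) (h₂ : BoundaryCond q χ t) : BoundaryCond q (ψ + χ) t := by
  induction t using OnePoint.rec with
  | infty =>
    have h := Tendsto.add (f := fun n : ℤ => (q : ℂ) ^ (-n) * ψ (2 * n)) h₁ h₂
    rw [add_zero] at h
    exact h.congr fun n => by simp only [Pi.add_apply]; ring
  | coe t =>
    have ha := Tendsto.add h₁.1 h₂.1
    have hb := Tendsto.add h₁.2 h₂.2
    rw [add_zero] at ha hb
    exact ⟨ha.congr fun n => by simp only [Pi.add_apply]; ring,
      hb.congr fun n => by simp only [Pi.add_apply]; ring⟩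

theorem BoundaryCond.smul {q : ℝ} {ψ : ℤ → ℂ} {t : OnePoint ℝ} (c : ℂ)
    (h : BoundaryCond q ψ t) : BoundaryCond q (c • ψ) t := by
  induction t using OnePoint.rec with
  | infty =>
    have h' := Tendsto.const_mul (f := fun n : ℤ => (q : ℂ) ^ (-n) * ψ (2 * n)) c h
    rw [mul_zero] at h'
    exact h'.congr fun n => by simp only [Pi.smul_apply, smul_eq_mul]; ring
  | coe t =>
    have ha := Tendsto.const_mul c h.1
    have hb := Tendsto.const_mul c h.2
    rw [mul_zero] at ha hb
    exact ⟨ha.congr fun n => by simp only [Pi.smul_apply, smul_eq_mul]; ring,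
      hb.congr fun n => by simp only [Pi.smul_apply, smul_eq_mul]; ring⟩

theorem BoundaryCond.zero (q : ℝ) (t : OnePoint ℝ) : BoundaryCond q 0 t := by
  induction t using OnePoint.rec with
  | infty => simp [BoundaryCond]
  | coe t => simp [BoundaryCond]

/-- The sequences in `ℓ²(ℤ)` satisfying the boundary condition labelled by `t`. -/
def boundarySubmodule (q : ℝ) (t : OnePoint ℝ) : Submodule ℂ EllTwo where
  carrier := {ψ | BoundaryCond q ψ t}
  add_mem' := fun ha hb => BoundaryCond.add ha hb
  zero_mem' := BoundaryCond.zero q t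
  smul_mem' := fun c _ ha => BoundaryCond.smul c ha

/-- The operator `A_t ⊂ A_max` whose domain consists of all `ψ ∈ D` satisfying the boundary
condition labelled by `t`. -/
def At (q : ℝ) (t : OnePoint ℝ) : EllTwo →ₗ.[ℂ] EllTwo :=
  (Amax q).domRestrict (boundarySubmodule q t)

/-- The point spectrum (set of eigenvalues) of an unbounded operator on `ℓ²(ℤ)`. -/
def pointSpectrum (T : EllTwo →ₗ.[ℂ] EllTwo) : Set ℂ :=
  {x | ∃ ψ : T.domain, (ψ : EllTwo) ≠ 0 ∧ T ψ = x • (ψ : EllTwo)}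

/-- The infinite `q`-Pochhammer symbol `(a; q)_∞ = ∏_{n ≥ 0} (1 - a qⁿ)`. -/
def qPochInf (a : ℂ) (q : ℝ) : ℂ := ∏' n : ℕ, (1 - a * (q : ℂ) ^ n)

/-- `θ_q(x) = (x, q x⁻¹; q)_∞`. -/
def thetaQ (q : ℝ) (x : ℂ) : ℂ := qPochInf x q * qPochInf (q * x⁻¹) q

/-- The Jacobi theta function `ϑ₁(z ∣ q)`, with nome `q`. -/
def thetaOne (z : ℂ) (q : ℝ) : ℂ :=
  Complex.I * ((q ^ (1 / 4 : ℝ) : ℝ) : ℂ) * Complex.exp (-Complex.I * z) *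
    qPochInf ((q : ℂ) ^ 2) (q ^ 2) * thetaQ (q ^ 2) (Complex.exp (2 * Complex.I * z))

/-- The Jacobi theta function `ϑ₂(z ∣ q)`, with nome `q`. -/
def thetaTwo (z : ℂ) (q : ℝ) : ℂ :=
  ((q ^ (1 / 4 : ℝ) : ℝ) : ℂ) * Complex.exp (-Complex.I * z) *
    qPochInf ((q : ℂ) ^ 2) (q ^ 2) * thetaQ (q ^ 2) (-Complex.exp (2 * Complex.I * z))

/-- The Jacobi theta function `ϑ₃(z ∣ q)`, with nome `q`. -/
def thetaThree (z : ℂ) (q : ℝ) : ℂ :=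
  qPochInf ((q : ℂ) ^ 2) (q ^ 2) * thetaQ (q ^ 2) (-q * Complex.exp (2 * Complex.I * z))

/-- The Jacobi theta function `ϑ₄(z ∣ q)`, with nome `q`. -/
def thetaFour (z : ℂ) (q : ℝ) : ℂ :=
  qPochInf ((q : ℂ) ^ 2) (q ^ 2) * thetaQ (q ^ 2) (q * Complex.exp (2 * Complex.I * z))

/-- The theta constant `ϑ₂(0 ∣ q)`, which is real for `0 < q < 1`, as a real number. -/
def thetaTwoConst (q : ℝ) : ℝ := (thetaTwo 0 q).re

/-- The theta constant `ϑ₃(0 ∣ q)`, which is real for `0 < q < 1`, as a real number. -/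
def thetaThreeConst (q : ℝ) : ℝ := (thetaThree 0 q).re

/-- The theta constant `ϑ₄(0 ∣ q)`, which is real for `0 < q < 1`, as a real number. -/
def thetaFourConst (q : ℝ) : ℝ := (thetaFour 0 q).re

/-- `Φ(s) = i q^{1/2} ϑ₄(i s ∣ q²) / ϑ₁(i s ∣ q²)`, as a complex number. -/
def Phi (q : ℝ) (s : ℝ) : ℂ :=
  Complex.I * ((q ^ (1 / 2 : ℝ) : ℝ) : ℂ) *
    (thetaFour (Complex.I * s) (q ^ 2) / thetaOne (Complex.I * s) (q ^ 2))

/-- `Φ` as a map into `ℝ ∪ {∞}`, with the convention `Φ(0) = ∞`. -/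
def PhiExt (q : ℝ) (s : ℝ) : OnePoint ℝ :=
  if s = 0 then OnePoint.infty else OnePoint.some (Phi q s).re

/-- The integrand of the elliptic integral for `Φ⁻¹`; the theta constants have nome `q²`. -/
def ellipticIntegrand (q : ℝ) (x : ℝ) : ℝ :=
  ((q * thetaThreeConst (q ^ 2) ^ 2 / thetaTwoConst (q ^ 2) ^ 2 + x ^ 2) *
    (q * thetaTwoConst (q ^ 2) ^ 2 / thetaThreeConst (q ^ 2) ^ 2 + x ^ 2)) ^ (-1 / 2 : ℝ)

/-- The elliptic integral formula for `Φ⁻¹(t)`; it is read as `0` for `t = ∞`. -/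
def PhiInv (q : ℝ) : OnePoint ℝ → ℝ
  | OnePoint.some t =>
      q ^ (1 / 2 : ℝ) / (thetaTwoConst (q ^ 2) * thetaThreeConst (q ^ 2)) *
        ∫ x in Ioi t, ellipticIntegrand q x
  | OnePoint.infty => 0

/-- The incomplete elliptic integral of the first kind `F(φ, k)`, with modulus `k`. -/
def ellipticF (k φ : ℝ) : ℝ := ∫ θ in (0 : ℝ)..φ, 1 / √(1 - k ^ 2 * Real.sin θ ^ 2)

/-- Jacobi's amplitude `am(u, k)` for a modulus `0 ≤ k < 1`: the inverse of `φ ↦ F(φ, k)`, which is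
an increasing bijection of the real line. -/
def jacobiAm (u k : ℝ) : ℝ := Function.invFun (ellipticF k) u

/-- The Jacobian elliptic function `cs(u, k) = cn(u, k) / sn(u, k)`, where `cn = cos am` and
`sn = sin am`. -/
def jacobiCs (u k : ℝ) : ℝ := Real.cos (jacobiAm u k) / Real.sin (jacobiAm u k)

end

/-! Operator side. Multiplying the Jacobi expression at index `n + 1` by `q ^ (n + 1)` gives `ψ (n +
2) + q ψ n`. If the expression is bounded, then `(-q) ^ (-n) ψ (2n)` and `(-q) ^ (-n) ψ (2n + 1)`
change by `O(q ^ n)` at each step and converge to boundary values `a`, `b`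
(`exists_hasBoundaryValues`). At `-∞` the off-diagonal weights vanish, so Green's formula
`inner_sub_inner_eq` only sees `+∞`, through the form `star b * c - star a * d`. All pairs `(a, b)`
occur (`exists_mem_maxDomain_hasBoundaryValues`). Self-adjoint extensions therefore correspond to
the lines in `ℂ²` on which this form vanishes, namely `b = -t a` with `t` real, or `a = 0`.

Spectral side. For real `x ≠ 0` an explicit solution `eigenSeq`, built from partial theta sums, lies
in `ℓ²`. A weighted Wronskian shows that every `ℓ²` solution is a multiple of it, so `x` is an
eigenvalue exactly when `eigenSeq` satisfies the boundary condition. Its boundary values are theta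
series, and at `x = -e^{-s}` as well as at `x = e^s` the condition becomes `ϑ₄ = t ϑ₁` at `is`, i.e.
`Φ(s) = t`. Both theta functions acquire the same factor under `s ↦ s - 2 ln q`, so the solutions
`s` form one class modulo `-2 ln q` (`eigenCond_iff`).

Theta side. The triple product turns the product definitions into series, and sorting a double
series by parity (`thetaSeries_mul_thetaSeries`) gives every theta identity needed. One is the
Wronskian `ϑ₁'ϑ₄ - ϑ₁ϑ₄' = ϑ₄(0)² ϑ₂ϑ₃`, which makes `Φ` decreasing and excludes common zeros of
`ϑ₁` and `ϑ₄`. The others are linear relations between squares, which express `Φ'` algebraically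
through `Φ`. Integrating that equation from `s = 0` gives the elliptic integral and the `cs`
formula, and the integral as a left inverse gives injectivity. -/

/-! ### Real `q`-Pochhammer symbols and their reciprocals -/

/-- The infinite `q`-Pochhammer symbol for real arguments. -/
noncomputable def qPochReal (a p : ℝ) : ℝ := ∏' n : ℕ, (1 - a * p ^ n)

/-- The reciprocal `1 / (p; p)_n` of the finite `q`-Pochhammer symbol, extended by `0` to `n < 0`. -/
noncomputable def invPoch (p : ℝ) (n : ℤ) : ℝ :=
  if n < 0 then 0 else (∏ k ∈ Finset.range n.toNat, (1 - p ^ (k + 1)))⁻¹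

/-- The theta series `∑ r^{n²} wⁿ` over the integers. -/
noncomputable def thetaSeries (r w : ℝ) : ℝ := ∑' n : ℤ, r ^ (n ^ 2) * w ^ n

theorem summable_mul_geometric {p : ℝ} (hp0 : 0 ≤ p) (hp1 : p < 1) (a : ℝ) :
    Summable fun n : ℕ => ‖-(a * p ^ n)‖ := by
  simp only [norm_neg, norm_mul, norm_pow, Real.norm_of_nonneg hp0]
  exact (summable_geometric_of_lt_one hp0 hp1).mul_left _

theorem multipliable_qPochReal {p : ℝ} (hp0 : 0 ≤ p) (hp1 : p < 1) (a : ℝ) :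
    Multipliable fun n : ℕ => (1 - a * p ^ n) := by
  simpa only [sub_eq_add_neg] using
    multipliable_one_add_of_summable (summable_mul_geometric hp0 hp1 a)

theorem tendsto_qPochReal {p : ℝ} (hp0 : 0 ≤ p) (hp1 : p < 1) (a : ℝ) :
    Tendsto (fun n : ℕ => ∏ k ∈ Finset.range n, (1 - a * p ^ k)) atTop (𝓝 (qPochReal a p)) :=
  (multipliable_qPochReal hp0 hp1 a).hasProd.tendsto_prod_nat

theorem qPochInf_ofReal {p : ℝ} (hp0 : 0 ≤ p) (hp1 : p < 1) (a : ℝ) :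
    qPochInf (a : ℂ) p = (qPochReal a p : ℂ) := by
  have h := (multipliable_qPochReal hp0 hp1 a).hasProd.map Complex.ofRealHom
    Complex.continuous_ofReal
  simp only [Function.comp_def, Complex.ofRealHom_eq_coe, Complex.ofReal_sub, Complex.ofReal_one,
    Complex.ofReal_mul, Complex.ofReal_pow] at h
  exact h.tprod_eq

/-- As a limit of positive products the value is nonnegative; it is nonzero because an absolutely
convergent product of nonzero factors does not vanish. -/
theorem qPochReal_pos {p : ℝ} (hp0 : 0 ≤ p) (hp1 : p < 1) {a : ℝ} (ha : a < 1) :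
    0 < qPochReal a p := by
  have hf : ∀ n : ℕ, 0 < 1 - a * p ^ n := by
    intro n
    have h1 : p ^ n ≤ 1 := pow_le_one₀ hp0 hp1.le
    have h2 : 0 ≤ p ^ n := pow_nonneg hp0 n
    rcases le_or_gt a 0 with h | h
    · nlinarith
    · nlinarith
  have h0 : 0 ≤ qPochReal a p :=
    ge_of_tendsto' (tendsto_qPochReal hp0 hp1 a) fun n => Finset.prod_nonneg fun k _ => (hf k).le
  refine lt_of_le_of_ne h0 (Ne.symm ?_)
  have := tprod_one_add_ne_zero_of_summable (f := fun n : ℕ => -(a * p ^ n))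
    (fun n => by rw [← sub_eq_add_neg]; exact (hf n).ne') (summable_mul_geometric hp0 hp1 a)
  simpa only [qPochReal, sub_eq_add_neg] using this

theorem qPochReal_eq_one_sub_mul {p : ℝ} (hp0 : 0 ≤ p) (hp1 : p < 1) (a : ℝ) :
    qPochReal a p = (1 - a) * qPochReal (a * p) p := by
  have h1 := (tendsto_qPochReal hp0 hp1 a).comp (tendsto_add_atTop_nat 1)
  have h2 := (tendsto_qPochReal hp0 hp1 (a * p)).const_mul (1 - a)
  refine tendsto_nhds_unique h1 (h2.congr fun n => ?_)
  simp only [Function.comp_apply, Finset.prod_range_succ']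
  rw [mul_comm]
  congr 1
  · exact Finset.prod_congr rfl fun k _ => by ring
  · simp

/-- Dominated convergence for infinite products. This continuity is what evaluates the derivative of
`ϑ₁` at its zero. -/
theorem tendsto_qPochReal_left {p : ℝ} (hp0 : 0 ≤ p) (hp1 : p < 1) (a : ℝ) :
    Tendsto (fun x => qPochReal x p) (𝓝 a) (𝓝 (qPochReal a p)) := by
  have := tendsto_tprod_one_add_of_dominated_convergence (𝓕 := 𝓝 a)
    (f := fun (x : ℝ) (n : ℕ) => -(x * p ^ n)) (g := fun n => -(a * p ^ n))
    (bound := fun n => (|a| + 1) * p ^ n)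
    ((summable_geometric_of_lt_one hp0 hp1).mul_left _)
    (fun n => (tendsto_id.mul_const _).neg) ?_
  · simpa only [qPochReal, sub_eq_add_neg] using this
  · filter_upwards [Metric.ball_mem_nhds a one_pos] with x hx k
    rw [norm_neg, norm_mul, norm_pow, Real.norm_of_nonneg hp0]
    refine mul_le_mul_of_nonneg_right ?_ (pow_nonneg hp0 k)
    rw [Metric.mem_ball, Real.dist_eq] at hx
    have := abs_sub_abs_le_abs_sub x a
    rw [Real.norm_eq_abs]
    linarith

theorem qPochReal_mul_neg {p : ℝ} (hp0 : 0 ≤ p) (hp1 : p < 1) (a : ℝ) :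
    qPochReal a p * qPochReal (-a) p = qPochReal (a ^ 2) (p ^ 2) := by
  have hp2 : p ^ 2 < 1 := by nlinarith
  rw [qPochReal, qPochReal, qPochReal,
    ← (multipliable_qPochReal hp0 hp1 a).tprod_mul (multipliable_qPochReal hp0 hp1 (-a))]
  exact tprod_congr fun n => by ring

theorem qPochReal_even_mul_odd {p : ℝ} (hp0 : 0 ≤ p) (hp1 : p < 1) (a : ℝ) :
    qPochReal a (p ^ 2) * qPochReal (a * p) (p ^ 2) = qPochReal a p := by
  have hp2 : p ^ 2 < 1 := by nlinarith
  have h1 := multipliable_qPochReal (pow_nonneg hp0 2) hp2 a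
  have h2 := multipliable_qPochReal (pow_nonneg hp0 2) hp2 (a * p)
  have := tprod_even_mul_odd (f := fun n : ℕ => 1 - a * p ^ n)
    (h1.congr fun n => by rw [pow_mul]) (h2.congr fun n => by ring)
  rw [qPochReal, qPochReal, qPochReal, ← this]
  congr 1
  · exact tprod_congr fun n => by rw [pow_mul]
  · exact tprod_congr fun n => by ring

theorem invPoch_of_neg {p : ℝ} {n : ℤ} (hn : n < 0) : invPoch p n = 0 := if_pos hn

theorem invPoch_natCast (p : ℝ) (n : ℕ) :
    invPoch p n = (∏ k ∈ Finset.range n, (1 - p ^ (k + 1)))⁻¹ := by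
  simp [invPoch]

/-- The extension by zero is chosen so that this recursion has no exceptional index: at `n = 0` the
factor `1 - p ^ 0` vanishes. -/
theorem invPoch_sub_one {p : ℝ} (hp0 : 0 < p) (hp1 : p < 1) (n : ℤ) :
    invPoch p (n - 1) = (1 - p ^ n) * invPoch p n := by
  rcases lt_or_ge n 0 with h | h
  · rw [invPoch_of_neg h, invPoch_of_neg (by omega), mul_zero]
  · obtain ⟨m, rfl⟩ := Int.eq_ofNat_of_zero_le h
    cases m with
    | zero => rw [invPoch_of_neg (by simp)]; simp
    | succ m =>
      have : ((m + 1 : ℕ) : ℤ) - 1 = (m : ℕ) := by push_cast; ring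
      rw [this, invPoch_natCast, invPoch_natCast, Finset.prod_range_succ, zpow_natCast]
      have h1 : p ^ (m + 1) < 1 := pow_lt_one₀ hp0.le hp1 (by omega)
      have h2 : 1 - p ^ (m + 1) ≠ 0 := by linarith
      rw [mul_inv]
      field_simp

theorem invPoch_nonneg {p : ℝ} (hp0 : 0 < p) (hp1 : p < 1) (n : ℤ) : 0 ≤ invPoch p n := by
  rw [invPoch]
  split_ifs
  · exact le_rfl
  · exact inv_nonneg.mpr (Finset.prod_nonneg fun k _ =>
      sub_nonneg.mpr (pow_le_one₀ hp0.le hp1.le))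

theorem tendsto_int_atTop_iff {α : Type*} {l : Filter α} {f : ℤ → α} :
    Tendsto f atTop l ↔ Tendsto (fun n : ℕ => f n) atTop l := by
  rw [← Nat.map_cast_int_atTop, tendsto_map'_iff]
  rfl

theorem tendsto_prod_one_sub_pow {p : ℝ} (hp0 : 0 < p) (hp1 : p < 1) :
    Tendsto (fun n : ℕ => ∏ k ∈ Finset.range n, (1 - p ^ (k + 1))) atTop
      (𝓝 (qPochReal p p)) :=
  (tendsto_qPochReal hp0.le hp1 p).congr fun n =>
    Finset.prod_congr rfl fun k _ => by rw [pow_succ']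

theorem tendsto_invPoch {p : ℝ} (hp0 : 0 < p) (hp1 : p < 1) :
    Tendsto (invPoch p) atTop (𝓝 (qPochReal p p)⁻¹) := by
  rw [tendsto_int_atTop_iff]
  simp only [invPoch_natCast]
  exact (tendsto_prod_one_sub_pow hp0 hp1).inv₀ (qPochReal_pos hp0.le hp1 hp1).ne'

theorem exists_invPoch_le {p : ℝ} (hp0 : 0 < p) (hp1 : p < 1) : ∃ K, ∀ n, invPoch p n ≤ K := by
  obtain ⟨K, hK⟩ := ((tendsto_int_atTop_iff.mp (tendsto_invPoch hp0 hp1))).bddAbove_range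
  refine ⟨K, fun n => ?_⟩
  have h0 : invPoch p (0 : ℕ) ≤ K := hK ⟨0, rfl⟩
  rcases lt_or_ge n 0 with h | h
  · rw [invPoch_of_neg h]
    exact (invPoch_nonneg hp0 hp1 _).trans h0
  · obtain ⟨m, rfl⟩ := Int.eq_ofNat_of_zero_le h
    exact hK ⟨m, rfl⟩

/-! ### Theta series, the triple product and the addition formula -/

theorem summable_nat_pow_sq_mul {r : ℝ} (hr0 : 0 < r) (hr1 : r < 1) {c : ℝ} (hc : 0 < c) :
    Summable fun n : ℕ => r ^ (n ^ 2) * c ^ n := by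
  refine summable_of_ratio_test_tendsto_lt_one (l := 0) one_pos
    (Eventually.of_forall fun n => by positivity) ?_
  have h1 : Tendsto (fun n : ℕ => (r * c) * (r ^ 2) ^ n) atTop (𝓝 ((r * c) * 0)) :=
    (tendsto_pow_atTop_nhds_zero_of_lt_one (by positivity) (by nlinarith)).const_mul _
  rw [mul_zero] at h1
  refine h1.congr fun n => ?_
  rw [Real.norm_of_nonneg (by positivity), Real.norm_of_nonneg (by positivity),
    eq_div_iff (by positivity)]
  ring

theorem summable_thetaSeries {r : ℝ} (hr0 : 0 < r) (hr1 : r < 1) {w : ℝ} (hw : w ≠ 0) :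
    Summable fun n : ℤ => r ^ (n ^ 2) * w ^ n := by
  refine Summable.of_norm ?_
  simp only [norm_mul, norm_zpow, Real.norm_of_nonneg hr0.le]
  have hw' : 0 < ‖w‖ := norm_pos_iff.mpr hw
  refine Summable.of_nat_of_neg ?_ ?_
  · exact (summable_nat_pow_sq_mul hr0 hr1 hw').congr fun n => by
      rw [← zpow_natCast, ← zpow_natCast]; push_cast; rfl
  · exact (summable_nat_pow_sq_mul hr0 hr1 (inv_pos.mpr hw')).congr fun n => by
      rw [← zpow_natCast, ← zpow_natCast, inv_zpow']; push_cast; rw [neg_sq]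

theorem hasSum_thetaSeries {r : ℝ} (hr0 : 0 < r) (hr1 : r < 1) {w : ℝ} (hw : w ≠ 0) :
    HasSum (fun n : ℤ => r ^ (n ^ 2) * w ^ n) (thetaSeries r w) :=
  (summable_thetaSeries hr0 hr1 hw).hasSum

/-- The finite form of the Jacobi triple product identity. -/
theorem hasSum_finite_triple_product {r : ℝ} (hr0 : 0 < r) (hr1 : r < 1) {x : ℝ} (hx : x ≠ 0)
    (n : ℕ) :
    HasSum (fun j : ℤ => (∏ k ∈ Finset.range (2 * n), (1 - (r ^ 2) ^ (k + 1))) *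
        (invPoch (r ^ 2) (n + j) * invPoch (r ^ 2) (n - j)) * (r ^ (j ^ 2) * (-x / r) ^ j))
      (∏ k ∈ Finset.range n, ((1 - x * (r ^ 2) ^ k) * (1 - (r ^ 2 / x) * (r ^ 2) ^ k))) := by
  have hp0 : 0 < r ^ 2 := by positivity
  have hp1 : r ^ 2 < 1 := by nlinarith
  have hy : -x / r ≠ 0 := div_ne_zero (neg_ne_zero.mpr hx) hr0.ne'
  induction n with
  | zero =>
    have h := hasSum_ite_eq (0 : ℤ) (1 : ℝ)
    simp only [Finset.range_zero, Finset.prod_empty]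
    refine h.congr_fun fun j => ?_
    split_ifs with hj
    · subst hj; simp [invPoch]
    · rcases lt_or_gt_of_ne hj with h | h
      · simp [invPoch_of_neg h]
      · rw [invPoch_of_neg (n := (0 : ℕ) - j) (by simpa using h)]; simp
  | succ n ih =>
    set P := ∏ k ∈ Finset.range (2 * n), (1 - (r ^ 2) ^ (k + 1)) with hP
    set t : ℤ → ℝ := fun j => P * (invPoch (r ^ 2) (n + j) * invPoch (r ^ 2) (n - j)) *
      (r ^ (j ^ 2) * (-x / r) ^ j) with ht
    -- With `p = r²`, the new factor expands as `1 + p ^ (2n+1) - x p ^ n - (p / x) p ^ n`, so the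
    -- new Laurent series combines the old one with its two shifts by one.
    have h1 := (Equiv.subRight (1 : ℤ)).hasSum_iff.mpr ih
    have h2 := (Equiv.addRight (1 : ℤ)).hasSum_iff.mpr ih
    have h3 := ((ih.mul_left (1 + (r ^ 2) ^ (2 * n + 1))).sub (h1.mul_left (x * (r ^ 2) ^ n))).sub
      (h2.mul_left (r ^ 2 / x * (r ^ 2) ^ n))
    rw [Finset.prod_range_succ]
    have hval : ∀ R : ℝ, R * ((1 - x * (r ^ 2) ^ n) * (1 - r ^ 2 / x * (r ^ 2) ^ n)) =
        (1 + (r ^ 2) ^ (2 * n + 1)) * R - x * (r ^ 2) ^ n * R - r ^ 2 / x * (r ^ 2) ^ n * R := by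
      intro R
      rw [pow_succ ((r ^ 2) : ℝ) (2 * n), pow_mul' (r ^ 2) 2 n]
      field_simp
      ring
    rw [hval]
    refine h3.congr_fun fun j => ?_
    have e1 : 2 * (n + 1) = 2 * n + 1 + 1 := by ring
    rw [e1, Finset.prod_range_succ, Finset.prod_range_succ, ← hP]
    simp only [Function.comp_apply, Equiv.subRight_apply, Equiv.coe_addRight, ht]
    -- All reciprocal symbols are expressed through the two at `n + 1 + j` and `n + 1 - j`.
    have i1 := invPoch_sub_one hp0 hp1 (n + 1 + j)
    have i2 := invPoch_sub_one hp0 hp1 (n + 1 - j)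
    have i3 := invPoch_sub_one hp0 hp1 (n + j)
    have i4 := invPoch_sub_one hp0 hp1 (n - j)
    rw [show (n + 1 + j - 1 : ℤ) = n + j by ring] at i1
    rw [show (n + 1 - j - 1 : ℤ) = n - j by ring] at i2
    rw [show (n + j - 1 : ℤ) = n + (j - 1) by ring] at i3
    rw [show (n - j - 1 : ℤ) = n - (j + 1) by ring] at i4
    rw [show (n - (j - 1) : ℤ) = n + 1 - j by ring, show (n + (j + 1) : ℤ) = n + 1 + j by ring,
      i3, i4, i1, i2, show (((n + 1 : ℕ) : ℤ) + j) = n + 1 + j by push_cast; ring,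
      show (((n + 1 : ℕ) : ℤ) - j) = n + 1 - j by push_cast; ring]
    have z1 : r ^ ((j - 1) ^ 2) = r ^ (j ^ 2) * (r ^ j)⁻¹ ^ 2 * r := by
      rw [show (j - 1) ^ 2 = j ^ 2 + (-j) * 2 + 1 by ring, zpow_add₀ hr0.ne', zpow_add₀ hr0.ne',
        zpow_mul, zpow_neg, zpow_one]
      rfl
    have z2 : r ^ ((j + 1) ^ 2) = r ^ (j ^ 2) * (r ^ j) ^ 2 * r := by
      rw [show (j + 1) ^ 2 = j ^ 2 + j * 2 + 1 by ring, zpow_add₀ hr0.ne', zpow_add₀ hr0.ne',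
        zpow_mul, zpow_one]
      rfl
    have hrj : r ^ j ≠ 0 := zpow_ne_zero _ hr0.ne'
    have w1 : (r ^ 2 : ℝ) ^ (n + 1 + j : ℤ) = (r ^ 2) ^ n * r ^ 2 * (r ^ j) ^ 2 := by
      rw [zpow_add₀ hp0.ne', zpow_add₀ hp0.ne', zpow_natCast, zpow_one, ← zpow_natCast r 2,
        zpow_comm, zpow_natCast]
      rfl
    have w2 : (r ^ 2 : ℝ) ^ (n + 1 - j : ℤ) = (r ^ 2) ^ n * r ^ 2 / (r ^ j) ^ 2 := by
      rw [zpow_sub₀ hp0.ne', zpow_add₀ hp0.ne', zpow_natCast, zpow_one, ← zpow_natCast r 2,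
        zpow_comm, zpow_natCast]
      rfl
    have w3 : (r ^ 2 : ℝ) ^ (n + j : ℤ) = (r ^ 2) ^ n * (r ^ j) ^ 2 := by
      rw [zpow_add₀ hp0.ne', zpow_natCast, ← zpow_natCast r 2,
        zpow_comm, zpow_natCast]
      rfl
    have w4 : (r ^ 2 : ℝ) ^ (n - j : ℤ) = (r ^ 2) ^ n / (r ^ j) ^ 2 := by
      rw [zpow_sub₀ hp0.ne', zpow_natCast, ← zpow_natCast r 2,
        zpow_comm, zpow_natCast]
      rfl
    rw [z1, z2, w1, w2, w3, w4, zpow_sub_one₀ hy, zpow_add_one₀ hy]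
    -- Once every power is written through `A = p ^ n` and `B = r ^ j`, the coefficient recursion is
    -- an identity of rational functions.
    generalize (-x / r) ^ j = y
    generalize r ^ (j ^ 2) = e
    generalize invPoch (r ^ 2) (n + 1 + j) = u
    generalize invPoch (r ^ 2) (n + 1 - j) = v
    rw [pow_succ ((r ^ 2) : ℝ) (2 * n + 1), pow_succ ((r ^ 2) : ℝ) (2 * n), pow_mul' (r ^ 2) 2 n]
    generalize ((r ^ 2 : ℝ) ^ n) = A
    generalize r ^ j = B at hrj ⊢
    field_simp
    ring

/-- The Jacobi triple product identity. -/
theorem thetaSeries_eq_triple_product {r : ℝ} (hr0 : 0 < r) (hr1 : r < 1) {x : ℝ} (hx : x ≠ 0) :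
    thetaSeries r (-x / r) =
      qPochReal (r ^ 2) (r ^ 2) * (qPochReal x (r ^ 2) * qPochReal (r ^ 2 / x) (r ^ 2)) := by
  have hp0 : 0 < r ^ 2 := by positivity
  have hp1 : r ^ 2 < 1 := by nlinarith
  have hy : -x / r ≠ 0 := div_ne_zero (neg_ne_zero.mpr hx) hr0.ne'
  have hE := qPochReal_pos hp0.le hp1 hp1
  obtain ⟨K, hK⟩ := exists_invPoch_le hp0 hp1
  have hlim := (tendsto_qPochReal hp0.le hp1 x).mul (tendsto_qPochReal hp0.le hp1 (r ^ 2 / x))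
  simp only [← Finset.prod_mul_distrib, ← (hasSum_finite_triple_product hr0 hr1 hx _).tsum_eq]
    at hlim
  set E := qPochReal (r ^ 2) (r ^ 2) with hEdef
  have hi (j : ℤ) : Tendsto (fun n : ℕ => invPoch (r ^ 2) (n + j)) atTop (𝓝 E⁻¹) :=
    (tendsto_invPoch hp0 hp1).comp
      (tendsto_atTop_add_const_right _ j tendsto_natCast_atTop_atTop)
  have h2n : Tendsto (fun n : ℕ => ∏ k ∈ Finset.range (2 * n), (1 - (r ^ 2) ^ (k + 1))) atTop
      (𝓝 E) := (tendsto_prod_one_sub_pow hp0 hp1).comp (tendsto_id.const_mul_atTop' (by norm_num))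
  -- Each coefficient tends to `E * E⁻¹ * E⁻¹` and is bounded by `K²`, so the theta series itself
  -- dominates.
  have hlim2 := tendsto_tsum_of_dominated_convergence (𝓕 := (atTop : Filter ℕ))
    (f := fun (n : ℕ) (j : ℤ) => (∏ k ∈ Finset.range (2 * n), (1 - (r ^ 2) ^ (k + 1))) *
        (invPoch (r ^ 2) (n + j) * invPoch (r ^ 2) (n - j)) * (r ^ (j ^ 2) * (-x / r) ^ j))
    (g := fun j : ℤ => E * (E⁻¹ * E⁻¹) * (r ^ (j ^ 2) * (-x / r) ^ j))
    (bound := fun j : ℤ => 1 * (K * K) * ‖r ^ (j ^ 2) * (-x / r) ^ j‖)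
    ((summable_thetaSeries hr0 hr1 hy).norm.mul_left _)
    (fun j => (h2n.mul ((hi j).mul (by simpa only [sub_eq_add_neg] using hi (-j)))).mul_const _)
    (Eventually.of_forall fun n j => by
      have hfac : ∀ k : ℕ, 0 ≤ 1 - (r ^ 2) ^ (k + 1) ∧ 1 - (r ^ 2) ^ (k + 1) ≤ 1 := fun k =>
        ⟨sub_nonneg.mpr (pow_le_one₀ hp0.le hp1.le), by
          have : 0 < (r ^ 2) ^ (k + 1) := by positivity
          linarith⟩
      have hprod0 : 0 ≤ ∏ k ∈ Finset.range (2 * n), (1 - (r ^ 2) ^ (k + 1)) :=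
        Finset.prod_nonneg fun k _ => (hfac k).1
      have hprod1 : ∏ k ∈ Finset.range (2 * n), (1 - (r ^ 2) ^ (k + 1)) ≤ 1 :=
        Finset.prod_le_one (fun k _ => (hfac k).1) fun k _ => (hfac k).2
      have n1 := invPoch_nonneg hp0 hp1 (n + j)
      have n2 := invPoch_nonneg hp0 hp1 (n - j)
      rw [norm_mul, Real.norm_of_nonneg (mul_nonneg hprod0 (mul_nonneg n1 n2))]
      refine mul_le_mul_of_nonneg_right ?_ (norm_nonneg _)
      exact mul_le_mul hprod1 (mul_le_mul (hK _) (hK _) n2 (n1.trans (hK _)))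
        (mul_nonneg n1 n2) zero_le_one)
  have h := tendsto_nhds_unique hlim2 hlim
  rw [tsum_mul_left, ← thetaSeries] at h
  rw [← h]
  field_simp

theorem thetaSeries_inv (r w : ℝ) : thetaSeries r w⁻¹ = thetaSeries r w := by
  rw [thetaSeries, thetaSeries, ← (Equiv.neg ℤ).tsum_eq]
  refine tsum_congr fun n => ?_
  rw [Equiv.neg_apply, neg_sq, inv_zpow', neg_neg]

/-- Completing the square: the term of index `n` on the left is `(r w)⁻¹` times the term of index `n
+ 1` of the series on the right. -/
theorem thetaSeries_sq_mul {r : ℝ} (hr0 : 0 < r) {w : ℝ} (hw : w ≠ 0) :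
    thetaSeries r (r ^ 2 * w) = (r * w)⁻¹ * thetaSeries r w := by
  rw [thetaSeries, thetaSeries, ← tsum_mul_left, ← (Equiv.addRight (1 : ℤ)).tsum_eq]
  conv_rhs => rw [← (Equiv.addRight (1 : ℤ)).tsum_eq, ← (Equiv.addRight (1 : ℤ)).tsum_eq]
  refine tsum_congr fun n => ?_
  simp only [Equiv.coe_addRight]
  rw [show (n + 1 + 1) ^ 2 = (n + 1) ^ 2 + (n + 1) + (n + 1) + 1 by ring, zpow_add₀ hr0.ne',
    zpow_add₀ hr0.ne', zpow_add₀ hr0.ne', zpow_add_one₀ hw (n + 1), mul_zpow, sq r, mul_zpow,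
    zpow_one]
  field_simp

theorem thetaSeries_pos {r : ℝ} (hr0 : 0 < r) (hr1 : r < 1) {w : ℝ} (hw : 0 < w) :
    0 < thetaSeries r w :=
  (summable_thetaSeries hr0 hr1 hw.ne').tsum_pos (fun n => by positivity) 0 (by positivity)

/-- The exponents agree by the parallelogram law `(a + b)² + (a - b)² = 2a² + 2b²`. -/
theorem even_term_identity {r : ℝ} (hr0 : 0 < r) {u v : ℝ} (hu : u ≠ 0) (hv : v ≠ 0) (a b : ℤ) :
    ((r ^ 2) ^ (a ^ 2) * (u * v) ^ a) * ((r ^ 2) ^ (b ^ 2) * (u / v) ^ b) =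
      (r ^ ((a + b) ^ 2) * u ^ (a + b)) * (r ^ ((a - b) ^ 2) * v ^ (a - b)) := by
  have h1 : r ^ ((a + b) ^ 2) * r ^ ((a - b) ^ 2) = (r ^ 2) ^ (a ^ 2) * (r ^ 2) ^ (b ^ 2) := by
    rw [← zpow_add₀ hr0.ne', ← zpow_natCast r 2, ← zpow_mul, ← zpow_mul, ← zpow_add₀ hr0.ne']
    congr 1
    push_cast
    ring
  have h2 : u ^ (a + b) * v ^ (a - b) = (u * v) ^ a * (u / v) ^ b := by
    rw [zpow_add₀ hu, zpow_sub₀ hv, mul_zpow, div_zpow]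
    ring
  linear_combination (-(u ^ (a + b) * v ^ (a - b))) * h1 -
    ((r ^ 2) ^ (a ^ 2) * (r ^ 2) ^ (b ^ 2)) * h2

theorem odd_term_identity {r : ℝ} (hr0 : 0 < r) {u v : ℝ} (hu : u ≠ 0) (hv : v ≠ 0) (a b : ℤ) :
    r * u * (((r ^ 2) ^ (a ^ 2) * (r ^ 2 * (u * v)) ^ a) *
        ((r ^ 2) ^ (b ^ 2) * (r ^ 2 * (u / v)) ^ b)) =
      (r ^ ((a + b + 1) ^ 2) * u ^ (a + b + 1)) * (r ^ ((a - b) ^ 2) * v ^ (a - b)) := by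
  have h1 : r ^ ((a + b + 1) ^ 2) * r ^ ((a - b) ^ 2) =
      (r ^ 2) ^ (a ^ 2) * (r ^ 2) ^ (b ^ 2) * (r ^ 2) ^ a * (r ^ 2) ^ b * r := by
    rw [← zpow_add₀ hr0.ne', ← zpow_natCast r 2, ← zpow_mul, ← zpow_mul, ← zpow_mul, ← zpow_mul,
      ← zpow_add₀ hr0.ne', ← zpow_add₀ hr0.ne', ← zpow_add₀ hr0.ne', ← zpow_add_one₀ hr0.ne']
    congr 1
    push_cast
    ring
  have h2 : u ^ (a + b + 1) * v ^ (a - b) = (u * v) ^ a * (u / v) ^ b * u := by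
    rw [zpow_add_one₀ hu, zpow_add₀ hu, zpow_sub₀ hv, mul_zpow, div_zpow]
    ring
  rw [mul_zpow (r ^ 2), mul_zpow (r ^ 2)]
  linear_combination (-(u ^ (a + b + 1) * v ^ (a - b))) * h1 -
    ((r ^ 2) ^ (a ^ 2) * (r ^ 2) ^ (b ^ 2) * (r ^ 2) ^ a * (r ^ 2) ^ b * r) * h2

/-- The two maps parametrize the pairs of integers with even and with odd sum. -/
theorem isCompl_range_add_sub :
    IsCompl (range fun x : ℤ × ℤ => (x.1 + x.2, x.1 - x.2))
      (range fun x : ℤ × ℤ => (x.1 + x.2 + 1, x.1 - x.2)) := by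
  constructor
  · rw [Set.disjoint_left]
    rintro _ ⟨⟨a, b⟩, rfl⟩ ⟨⟨c, d⟩, h⟩
    simp only [Prod.mk.injEq] at h
    omega
  · rw [codisjoint_iff_le_sup]
    rintro ⟨m, n⟩ -
    rcases Int.even_or_odd' (m + n) with ⟨k, hk | hk⟩
    · left
      exact ⟨(k, m - k), by simp only [Prod.mk.injEq]; omega⟩
    · right
      exact ⟨(k, m - k - 1), by simp only [Prod.mk.injEq]; omega⟩

theorem hasSum_of_parametrizations {f : ℤ × ℤ → ℝ} {g₀ g₁ : ℤ × ℤ → ℤ × ℤ} {a b : ℝ}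
    (h₀ : Function.Injective g₀) (h₁ : Function.Injective g₁) (h : IsCompl (range g₀) (range g₁))
    (ha : HasSum (fun x => f (g₀ x)) a) (hb : HasSum (fun x => f (g₁ x)) b) :
    HasSum f (a + b) :=
  HasSum.add_isCompl h (h₀.hasSum_range_iff.mpr ha) (h₁.hasSum_range_iff.mpr hb)

theorem hasSum_prod_mul {f g : ℤ → ℝ} {a b : ℝ} (hf : HasSum f a) (hg : HasSum g b) :
    HasSum (fun x : ℤ × ℤ => f x.1 * g x.2) (a * b) :=
  HasSum.mul hf hg (summable_mul_of_summable_norm hf.summable.norm hg.summable.norm)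

theorem hasSum_thetaSeries_mul {r : ℝ} (hr0 : 0 < r) (hr1 : r < 1) {u v : ℝ} (hu : u ≠ 0)
    (hv : v ≠ 0) :
    HasSum (fun x : ℤ × ℤ => (r ^ (x.1 ^ 2) * u ^ x.1) * (r ^ (x.2 ^ 2) * v ^ x.2))
      (thetaSeries r u * thetaSeries r v) :=
  hasSum_prod_mul (f := fun n => r ^ (n ^ 2) * u ^ n) (g := fun n => r ^ (n ^ 2) * v ^ n)
    (hasSum_thetaSeries hr0 hr1 hu) (hasSum_thetaSeries hr0 hr1 hv)

/-- The addition formula expressing a product of theta series with nome `r` through theta series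
with nome `r²`. -/
theorem thetaSeries_mul_thetaSeries {r : ℝ} (hr0 : 0 < r) (hr1 : r < 1) {u v : ℝ} (hu : u ≠ 0)
    (hv : v ≠ 0) :
    thetaSeries r u * thetaSeries r v =
      thetaSeries (r ^ 2) (u * v) * thetaSeries (r ^ 2) (u / v) +
        r * u * (thetaSeries (r ^ 2) (r ^ 2 * (u * v)) * thetaSeries (r ^ 2) (r ^ 2 * (u / v))) := by
  have hp0 : 0 < r ^ 2 := by positivity
  have hp1 : r ^ 2 < 1 := by nlinarith
  have hE := hasSum_thetaSeries_mul hp0 hp1 (mul_ne_zero hu hv) (div_ne_zero hu hv)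
  have hO := (hasSum_thetaSeries_mul hp0 hp1 (mul_ne_zero hp0.ne' (mul_ne_zero hu hv))
    (mul_ne_zero hp0.ne' (div_ne_zero hu hv))).mul_left (r * u)
  have hi₀ : Function.Injective fun x : ℤ × ℤ => (x.1 + x.2, x.1 - x.2) := by
    rintro ⟨a, b⟩ ⟨c, d⟩ h
    simp only [Prod.mk.injEq] at h ⊢
    omega
  have hi₁ : Function.Injective fun x : ℤ × ℤ => (x.1 + x.2 + 1, x.1 - x.2) := by
    rintro ⟨a, b⟩ ⟨c, d⟩ h
    simp only [Prod.mk.injEq] at h ⊢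
    omega
  refine (hasSum_thetaSeries_mul hr0 hr1 hu hv).unique
    (hasSum_of_parametrizations (f := fun x : ℤ × ℤ =>
      (r ^ (x.1 ^ 2) * u ^ x.1) * (r ^ (x.2 ^ 2) * v ^ x.2)) hi₀ hi₁ isCompl_range_add_sub ?_ ?_)
  · exact hE.congr_fun fun x => (even_term_identity hr0 hu hv x.1 x.2).symm
  · exact hO.congr_fun fun x => (odd_term_identity hr0 hu hv x.1 x.2).symm

/-- The bridge to `jacobiTheta₂`, from whose holomorphy the differentiability of the real series is
borrowed. -/
theorem ofReal_thetaSeries {r w : ℝ} {z τ : ℂ}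
    (hz : Complex.exp (2 * Real.pi * Complex.I * z) = w)
    (hτ : Complex.exp (Real.pi * Complex.I * τ) = r) :
    ((thetaSeries r w : ℝ) : ℂ) = jacobiTheta₂ z τ := by
  rw [thetaSeries, jacobiTheta₂, Complex.ofReal_tsum]
  refine tsum_congr fun n => ?_
  rw [jacobiTheta₂_term, Complex.exp_add]
  have h1 : 2 * Real.pi * Complex.I * n * z = n * (2 * Real.pi * Complex.I * z) := by ring
  have h2 : Real.pi * Complex.I * n ^ 2 * τ = ((n ^ 2 : ℤ) : ℂ) * (Real.pi * Complex.I * τ) := by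
    push_cast; ring
  rw [h1, h2, Complex.exp_int_mul, Complex.exp_int_mul, hz, hτ]
  push_cast
  ring

theorem differentiable_thetaSeries_exp {r : ℝ} (hr0 : 0 < r) (hr1 : r < 1) {c : ℝ} (hc : c ≠ 0)
    (a : ℝ) : Differentiable ℝ fun s : ℝ => thetaSeries r (c * Real.exp (a * s)) := by
  have hpi : (Real.pi : ℂ) ≠ 0 := by exact_mod_cast Real.pi_ne_zero
  set τ : ℂ := ((-(Real.log r) / Real.pi : ℝ) : ℂ) * Complex.I with hτdef
  have hτ : Complex.exp (Real.pi * Complex.I * τ) = r := by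
    rw [hτdef]
    have : (Real.pi : ℂ) * Complex.I * (((-(Real.log r) / Real.pi : ℝ) : ℂ) * Complex.I) =
        ((Real.log r : ℝ) : ℂ) := by
      push_cast
      field_simp
      rw [Complex.I_sq]
      ring
    rw [this, ← Complex.ofReal_exp, Real.exp_log hr0]
  have him : 0 < τ.im := by
    simp only [hτdef, Complex.im_ofReal_mul, Complex.I_im, mul_one]
    exact div_pos (neg_pos.mpr (Real.log_neg hr0 hr1)) Real.pi_pos
  have hc' : (c : ℂ) ≠ 0 := by exact_mod_cast hc
  -- The complex logarithm allows `c` to be negative, as `ϑ₁` and `ϑ₄` require.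
  set g : ℂ → ℂ := fun x => jacobiTheta₂ ((Complex.log c + a * x) / (2 * Real.pi * Complex.I)) τ
    with hg
  have hgd : Differentiable ℂ g := fun x =>
    DifferentiableAt.comp x (differentiableAt_jacobiTheta₂_fst _ him) (by fun_prop)
  have heq : (fun s : ℝ => thetaSeries r (c * Real.exp (a * s))) = fun s : ℝ => (g s).re := by
    funext s
    have hz : Complex.exp (2 * Real.pi * Complex.I *
        ((Complex.log c + a * s) / (2 * Real.pi * Complex.I))) =
          ((c * Real.exp (a * s) : ℝ) : ℂ) := by
      rw [mul_div_cancel₀ _ (by simp [hpi]), Complex.exp_add, Complex.exp_log hc']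
      push_cast
      rfl
    simp only [hg]
    rw [← ofReal_thetaSeries hz hτ, Complex.ofReal_re]
  rw [heq]
  exact fun s => (hgd s).hasDerivAt.real_of_complex.differentiableAt

/-! ### Theta functions on the imaginary axis and their identities -/

/-- The function `-i r^{-1/4} ϑ₁(i s ∣ r)` on the real line. -/
noncomputable def realThetaOne (r s : ℝ) : ℝ :=
  Real.exp s * thetaSeries r (-Real.exp (-2 * s) / r)

/-- The function `r^{-1/4} ϑ₂(i s ∣ r)` on the real line. -/
noncomputable def realThetaTwo (r s : ℝ) : ℝ :=
  Real.exp s * thetaSeries r (Real.exp (-2 * s) / r)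

/-- The function `ϑ₃(i s ∣ r)` on the real line. -/
noncomputable def realThetaThree (r s : ℝ) : ℝ := thetaSeries r (Real.exp (-2 * s))

/-- The function `ϑ₄(i s ∣ r)` on the real line. -/
noncomputable def realThetaFour (r s : ℝ) : ℝ := thetaSeries r (-Real.exp (-2 * s))

section RealTheta

variable {r : ℝ}

theorem realThetaTwo_pos (hr0 : 0 < r) (hr1 : r < 1) (s : ℝ) : 0 < realThetaTwo r s :=
  mul_pos (Real.exp_pos _) (thetaSeries_pos hr0 hr1 (by positivity))

theorem realThetaThree_pos (hr0 : 0 < r) (hr1 : r < 1) (s : ℝ) : 0 < realThetaThree r s :=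
  thetaSeries_pos hr0 hr1 (by positivity)

theorem differentiable_realThetaOne (hr0 : 0 < r) (hr1 : r < 1) :
    Differentiable ℝ (realThetaOne r) := by
  have h := differentiable_thetaSeries_exp hr0 hr1
    (c := -1 / r) (div_ne_zero (by norm_num) hr0.ne') (-2)
  have h2 : realThetaOne r = fun s => Real.exp s * thetaSeries r (-1 / r * Real.exp (-2 * s)) := by
    funext s
    rw [realThetaOne]
    congr 2
    ring
  rw [h2]
  exact Real.differentiable_exp.mul h

theorem differentiable_realThetaFour (hr0 : 0 < r) (hr1 : r < 1) :
    Differentiable ℝ (realThetaFour r) := by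
  have h := differentiable_thetaSeries_exp hr0 hr1 (c := -1) (by norm_num) (-2)
  convert h using 2 with s
  rw [realThetaFour]
  congr 1
  ring

/-- The multiplier is the same as the one for `realThetaFour`; this makes their quotient periodic.
-/
theorem realThetaOne_add_period (hr0 : 0 < r) (s : ℝ) :
    realThetaOne r (s - Real.log r) =
      -(r * Real.exp (-2 * s))⁻¹ * realThetaOne r s := by
  have h1 : Real.exp (s - Real.log r) = Real.exp s / r := by
    rw [Real.exp_sub, Real.exp_log hr0]
  have h2 : Real.exp (-2 * (s - Real.log r)) = r ^ 2 * Real.exp (-2 * s) := by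
    rw [show -2 * (s - Real.log r) = Real.log r + Real.log r + -2 * s by ring, Real.exp_add,
      Real.exp_add, Real.exp_log hr0]
    ring
  have hw := (Real.exp_pos (-2 * s)).ne'
  rw [realThetaOne, realThetaOne, h1, h2, show -(r ^ 2 * Real.exp (-2 * s)) / r =
    r ^ 2 * (-Real.exp (-2 * s) / r) by ring,
    thetaSeries_sq_mul hr0 (div_ne_zero (neg_ne_zero.mpr hw) hr0.ne')]
  field_simp

theorem realThetaFour_add_period (hr0 : 0 < r) (s : ℝ) :
    realThetaFour r (s - Real.log r) =
      -(r * Real.exp (-2 * s))⁻¹ * realThetaFour r s := by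
  have h2 : Real.exp (-2 * (s - Real.log r)) = r ^ 2 * Real.exp (-2 * s) := by
    rw [show -2 * (s - Real.log r) = Real.log r + Real.log r + -2 * s by ring, Real.exp_add,
      Real.exp_add, Real.exp_log hr0]
    ring
  have hw := (Real.exp_pos (-2 * s)).ne'
  rw [realThetaFour, realThetaFour, h2, show -(r ^ 2 * Real.exp (-2 * s)) =
    r ^ 2 * (-Real.exp (-2 * s)) by ring, thetaSeries_sq_mul hr0 (neg_ne_zero.mpr hw)]
  field_simp

/-- Inverting the argument of the series and then using quasi-periodicity once returns to the same
argument, with the sign of the multiplier left over. -/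
theorem realThetaOne_neg (hr0 : 0 < r) (s : ℝ) : realThetaOne r (-s) = -realThetaOne r s := by
  have hw := (Real.exp_pos (-2 * s)).ne'
  have h1 : Real.exp (-2 * -s) = (Real.exp (-2 * s))⁻¹ := by
    rw [← Real.exp_neg]; congr 1; ring
  have h2 : -(Real.exp (-2 * s))⁻¹ / r = (r ^ 2 * (-Real.exp (-2 * s) / r))⁻¹ := by
    field_simp
  have h3 : Real.exp (-2 * s) = (Real.exp s)⁻¹ * (Real.exp s)⁻¹ := by
    rw [← Real.exp_neg, ← Real.exp_add]; congr 1; ring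
  rw [realThetaOne, realThetaOne, h1, h2, thetaSeries_inv,
    thetaSeries_sq_mul hr0 (div_ne_zero (neg_ne_zero.mpr hw) hr0.ne'), Real.exp_neg]
  generalize thetaSeries r (-Real.exp (-2 * s) / r) = y
  rw [h3]
  field_simp

theorem realThetaFour_neg (s : ℝ) : realThetaFour r (-s) = realThetaFour r s := by
  have h1 : Real.exp (-2 * -s) = (Real.exp (-2 * s))⁻¹ := by
    rw [← Real.exp_neg]; congr 1; ring
  rw [realThetaFour, realThetaFour, h1, ← inv_neg, thetaSeries_inv]

theorem realThetaOne_zero (hr0 : 0 < r) : realThetaOne r 0 = 0 := by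
  have := realThetaOne_neg hr0 0
  rw [neg_zero] at this
  linarith

/-- The triple product at `x = e^{-2s}`. The three product formulas that follow take `x = r
e^{-2s}`, `-r e^{-2s}` and `-e^{-2s}`. -/
theorem realThetaOne_eq_product (hr0 : 0 < r) (hr1 : r < 1) (s : ℝ) :
    realThetaOne r s = Real.exp s * (qPochReal (r ^ 2) (r ^ 2) *
      (qPochReal (Real.exp (-2 * s)) (r ^ 2) * qPochReal (r ^ 2 / Real.exp (-2 * s)) (r ^ 2))) := by
  rw [realThetaOne, thetaSeries_eq_triple_product hr0 hr1 (Real.exp_pos _).ne']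

theorem realThetaFour_eq_product (hr0 : 0 < r) (hr1 : r < 1) (s : ℝ) :
    realThetaFour r s = qPochReal (r ^ 2) (r ^ 2) *
      (qPochReal (r * Real.exp (-2 * s)) (r ^ 2) *
        qPochReal (r ^ 2 / (r * Real.exp (-2 * s))) (r ^ 2)) := by
  rw [realThetaFour, ← thetaSeries_eq_triple_product hr0 hr1
    (mul_ne_zero hr0.ne' (Real.exp_pos _).ne')]
  congr 1
  field_simp

theorem realThetaThree_eq_product (hr0 : 0 < r) (hr1 : r < 1) (s : ℝ) :
    realThetaThree r s = qPochReal (r ^ 2) (r ^ 2) *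
      (qPochReal (-r * Real.exp (-2 * s)) (r ^ 2) *
        qPochReal (r ^ 2 / (-r * Real.exp (-2 * s))) (r ^ 2)) := by
  rw [realThetaThree, ← thetaSeries_eq_triple_product hr0 hr1
    (mul_ne_zero (neg_ne_zero.mpr hr0.ne') (Real.exp_pos _).ne')]
  congr 1
  field_simp

theorem realThetaTwo_eq_product (hr0 : 0 < r) (hr1 : r < 1) (s : ℝ) :
    realThetaTwo r s = Real.exp s * (qPochReal (r ^ 2) (r ^ 2) *
      (qPochReal (-Real.exp (-2 * s)) (r ^ 2) *
        qPochReal (r ^ 2 / -Real.exp (-2 * s)) (r ^ 2))) := by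
  rw [realThetaTwo, ← thetaSeries_eq_triple_product hr0 hr1
    (neg_ne_zero.mpr (Real.exp_pos _).ne'), neg_neg]

/-- On this interval both Pochhammer arguments, `e^{-2s}` and `r² e^{2s}`, are below one. -/
theorem realThetaOne_pos (hr0 : 0 < r) (hr1 : r < 1) {s : ℝ} (hs0 : 0 < s)
    (hs1 : s < -Real.log r) : 0 < realThetaOne r s := by
  have hp0 : 0 < r ^ 2 := by positivity
  have hp1 : r ^ 2 < 1 := by nlinarith
  rw [realThetaOne_eq_product hr0 hr1]
  refine mul_pos (Real.exp_pos _) (mul_pos (qPochReal_pos hp0.le hp1 hp1)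
    (mul_pos (qPochReal_pos hp0.le hp1 ?_) (qPochReal_pos hp0.le hp1 ?_)))
  · rw [Real.exp_lt_one_iff]; linarith
  · rw [div_lt_one (Real.exp_pos _), ← Real.exp_log hp0, Real.exp_lt_exp, Real.log_pow]
    push_cast
    linarith

theorem realThetaFour_zero_pos (hr0 : 0 < r) (hr1 : r < 1) : 0 < realThetaFour r 0 := by
  have hp0 : 0 < r ^ 2 := by positivity
  have hp1 : r ^ 2 < 1 := by nlinarith
  rw [realThetaFour_eq_product hr0 hr1]
  refine mul_pos (qPochReal_pos hp0.le hp1 hp1)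
    (mul_pos (qPochReal_pos hp0.le hp1 ?_) (qPochReal_pos hp0.le hp1 ?_))
  · simpa using hr1
  · rw [mul_zero, Real.exp_zero, mul_one, div_lt_one hr0]
    nlinarith

/-- All squares of theta functions with nome `r` are linear combinations of two functions. -/
theorem realTheta_squares (hr0 : 0 < r) (hr1 : r < 1) (s : ℝ) :
    ∃ X Y : ℝ,
      (s = 0 → X = thetaSeries (r ^ 2) 1 ∧ Y = thetaSeries (r ^ 2) (r ^ 2)) ∧
      realThetaOne r s ^ 2 = thetaSeries (r ^ 2) 1 * Y - thetaSeries (r ^ 2) (r ^ 2) * X ∧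
      realThetaTwo r s ^ 2 = thetaSeries (r ^ 2) 1 * Y + thetaSeries (r ^ 2) (r ^ 2) * X ∧
      realThetaThree r s ^ 2 = thetaSeries (r ^ 2) 1 * X + r * thetaSeries (r ^ 2) (r ^ 2) * Y ∧
      realThetaFour r s ^ 2 = thetaSeries (r ^ 2) 1 * X - r * thetaSeries (r ^ 2) (r ^ 2) * Y := by
  have hp0 : 0 < r ^ 2 := by positivity
  set w := Real.exp (-2 * s) with hwdef
  have hw0 : 0 < w := Real.exp_pos _
  have hexp : Real.exp s ^ 2 = w⁻¹ := by
    rw [sq, ← Real.exp_add, hwdef, ← Real.exp_neg]; congr 1; ring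
  have hwr : w / r ≠ 0 := div_ne_zero hw0.ne' hr0.ne'
  -- For `ϑ₁` and `ϑ₂` the addition formula yields the argument `w² / r²`; quasi-periodicity brings
  -- it back to `r² w²`.
  have hshift : thetaSeries (r ^ 2) (w / r * (w / r)) =
      w ^ 2 * thetaSeries (r ^ 2) (r ^ 2 * (w * w)) := by
    have := thetaSeries_sq_mul hp0 (w := w / r * (w / r)) (mul_ne_zero hwr hwr)
    rw [show (r ^ 2) ^ 2 * (w / r * (w / r)) = r ^ 2 * (w * w) by field_simp] at this
    rw [this]
    field_simp
  have e1 : r ^ 2 * (w / r * (w / r)) = w * w := by field_simp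
  -- In the addition formula with `u = v` the factors depending on `u / v = 1` are constants; the
  -- remaining factors are `X` and, up to a power of `w`, `Y`.
  refine ⟨thetaSeries (r ^ 2) (w * w), w * thetaSeries (r ^ 2) (r ^ 2 * (w * w)), ?_, ?_, ?_, ?_, ?_⟩
  · intro hs
    have : w = 1 := by rw [hwdef, hs]; simp
    rw [this]
    simp
  · rw [realThetaOne, mul_pow, hexp, ← hwdef, sq (thetaSeries _ _), neg_div,
      thetaSeries_mul_thetaSeries hr0 hr1 (neg_ne_zero.mpr hwr) (neg_ne_zero.mpr hwr),
      div_self (neg_ne_zero.mpr hwr), neg_mul_neg, hshift, e1, mul_one]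
    field_simp
    ring
  · rw [realThetaTwo, mul_pow, hexp, ← hwdef, sq (thetaSeries _ _),
      thetaSeries_mul_thetaSeries hr0 hr1 hwr hwr,
      div_self hwr, hshift, e1, mul_one]
    field_simp
  · rw [realThetaThree, ← hwdef, sq (thetaSeries _ _),
      thetaSeries_mul_thetaSeries hr0 hr1 hw0.ne' hw0.ne', div_self hw0.ne', mul_one]
    ring
  · rw [realThetaFour, ← hwdef, sq (thetaSeries _ _),
      thetaSeries_mul_thetaSeries hr0 hr1 (neg_ne_zero.mpr hw0.ne') (neg_ne_zero.mpr hw0.ne'),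
      div_self (neg_ne_zero.mpr hw0.ne'), neg_mul_neg, mul_one]
    ring

theorem realTheta_zero_squares (hr0 : 0 < r) (hr1 : r < 1) :
    realThetaTwo r 0 ^ 2 = 2 * thetaSeries (r ^ 2) 1 * thetaSeries (r ^ 2) (r ^ 2) ∧
      realThetaThree r 0 ^ 2 = thetaSeries (r ^ 2) 1 ^ 2 + r * thetaSeries (r ^ 2) (r ^ 2) ^ 2 ∧
      realThetaFour r 0 ^ 2 = thetaSeries (r ^ 2) 1 ^ 2 - r * thetaSeries (r ^ 2) (r ^ 2) ^ 2 := by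
  obtain ⟨X, Y, h0, -, h2, h3, h4⟩ := realTheta_squares hr0 hr1 0
  obtain ⟨rfl, rfl⟩ := h0 rfl
  exact ⟨by rw [h2]; ring, by rw [h3]; ring, by rw [h4]; ring⟩

/-- Jacobi's identity for the fourth powers of the theta constants. -/
theorem realTheta_zero_pow_four (hr0 : 0 < r) (hr1 : r < 1) :
    realThetaThree r 0 ^ 4 = r * realThetaTwo r 0 ^ 4 + realThetaFour r 0 ^ 4 := by
  obtain ⟨h2, h3, h4⟩ := realTheta_zero_squares hr0 hr1
  rw [show realThetaThree r 0 ^ 4 = (realThetaThree r 0 ^ 2) ^ 2 by ring,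
    show realThetaTwo r 0 ^ 4 = (realThetaTwo r 0 ^ 2) ^ 2 by ring,
    show realThetaFour r 0 ^ 4 = (realThetaFour r 0 ^ 2) ^ 2 by ring, h2, h3, h4]
  ring

/-- Three squares lie in the span of `X` and `Y`, so they are linearly dependent, with theta
constants as coefficients. This and the analogue for `ϑ₃` later express the derivative of `ϑ₄ / ϑ₁`
through the quotient itself. -/
theorem realThetaTwo_sq (hr0 : 0 < r) (hr1 : r < 1) (s : ℝ) :
    realThetaFour r 0 ^ 2 * realThetaTwo r s ^ 2 =
      realThetaTwo r 0 ^ 2 * realThetaFour r s ^ 2 +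
        realThetaThree r 0 ^ 2 * realThetaOne r s ^ 2 := by
  obtain ⟨h2, h3, h4⟩ := realTheta_zero_squares hr0 hr1
  obtain ⟨X, Y, -, g1, g2, g3, g4⟩ := realTheta_squares hr0 hr1 s
  rw [h2, h3, h4, g1, g2, g4]
  ring

theorem realThetaThree_sq (hr0 : 0 < r) (hr1 : r < 1) (s : ℝ) :
    realThetaFour r 0 ^ 2 * realThetaThree r s ^ 2 =
      realThetaThree r 0 ^ 2 * realThetaFour r s ^ 2 +
        r * realThetaTwo r 0 ^ 2 * realThetaOne r s ^ 2 := by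
  obtain ⟨h2, h3, h4⟩ := realTheta_zero_squares hr0 hr1
  obtain ⟨X, Y, -, g1, g2, g3, g4⟩ := realTheta_squares hr0 hr1 s
  rw [h2, h3, h4, g1, g3, g4]
  ring

/-- The auxiliary function through which `ϑ₁(x + y) ϑ₄(x - y)` factorizes. -/
noncomputable def thetaAux (r s : ℝ) : ℝ :=
  Real.exp s * thetaSeries (r ^ 2) (Real.exp (-4 * s) / r)

theorem thetaAux_neg (s : ℝ) :
    thetaAux r (-s) = Real.exp (-s) * thetaSeries (r ^ 2) (r * Real.exp (-4 * s)) := by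
  rw [thetaAux, ← thetaSeries_inv]
  congr 2
  rw [inv_div, div_eq_mul_inv, ← Real.exp_neg]
  congr 2
  ring

theorem thetaAux_zero_pos (hr0 : 0 < r) (hr1 : r < 1) : 0 < thetaAux r 0 :=
  mul_pos (Real.exp_pos _) (thetaSeries_pos (by positivity) (by nlinarith) (by positivity))

theorem differentiable_thetaAux (hr0 : 0 < r) (hr1 : r < 1) :
    Differentiable ℝ (thetaAux r) := by
  have h := differentiable_thetaSeries_exp (r := r ^ 2) (by positivity) (by nlinarith)
    (c := 1 / r) (div_ne_zero (by norm_num) hr0.ne') (-4)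
  have h2 : thetaAux r =
      fun s => Real.exp s * thetaSeries (r ^ 2) (1 / r * Real.exp (-4 * s)) := by
    funext s
    rw [thetaAux]
    congr 2
    ring
  rw [h2]
  exact Real.differentiable_exp.mul h

/-- In the addition formula `u v` depends only on `s` and `u / v` only on `y`, so the variables
separate. Differentiating in `y` at `0` will produce the Wronskian. -/
theorem realThetaOne_mul_realThetaFour (hr0 : 0 < r) (hr1 : r < 1) (s y : ℝ) :
    realThetaOne r (s + y) * realThetaFour r (s - y) =
      thetaAux r s * thetaAux r y - thetaAux r (-s) * thetaAux r (-y) := by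
  have h1 : -Real.exp (-2 * (s + y)) / r * -Real.exp (-2 * (s - y)) = Real.exp (-4 * s) / r := by
    rw [div_mul_eq_mul_div, neg_mul_neg, ← Real.exp_add]
    congr 2
    ring
  have h2 : -Real.exp (-2 * (s + y)) / r / -Real.exp (-2 * (s - y)) = Real.exp (-4 * y) / r := by
    rw [div_right_comm, neg_div_neg_eq, ← Real.exp_sub]
    congr 2
    ring
  have h3 : ∀ x : ℝ, r ^ 2 * (Real.exp x / r) = r * Real.exp x := fun x => by
    field_simp
  rw [thetaAux_neg, thetaAux_neg, realThetaOne, realThetaFour, mul_assoc,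
    thetaSeries_mul_thetaSeries hr0 hr1
      (div_ne_zero (neg_ne_zero.mpr (Real.exp_pos _).ne') hr0.ne')
      (neg_ne_zero.mpr (Real.exp_pos _).ne'), h1, h2, h3, h3, thetaAux, thetaAux,
    Real.exp_add]
  have h4 : Real.exp (-2 * (s + y)) = (Real.exp (-s) * Real.exp (-y)) ^ 2 := by
    rw [sq, ← Real.exp_add, ← Real.exp_add]; congr 1; ring
  have h5 : Real.exp s * Real.exp (-s) = 1 := by rw [← Real.exp_add]; simp
  have h6 : Real.exp y * Real.exp (-y) = 1 := by rw [← Real.exp_add]; simp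
  rw [h4]
  generalize thetaSeries (r ^ 2) (r * Real.exp (-4 * s)) = P
  generalize thetaSeries (r ^ 2) (r * Real.exp (-4 * y)) = Q
  field_simp
  linear_combination (-(Real.exp (-s) * Real.exp (-y) * P * Q)) *
    (Real.exp y * Real.exp (-y) * h5 + h6)

/-- Here `u / v = 1 / r`, and the arguments `1 / r` and `r` give equal series by inversion, so both
parity classes share the factor `thetaAux r 0`. -/
theorem realThetaTwo_mul_realThetaThree (hr0 : 0 < r) (hr1 : r < 1) (s : ℝ) :
    realThetaTwo r s * realThetaThree r s = thetaAux r 0 * (thetaAux r s + thetaAux r (-s)) := by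
  have h1 : Real.exp (-2 * s) / r * Real.exp (-2 * s) = Real.exp (-4 * s) / r := by
    rw [div_mul_eq_mul_div, ← Real.exp_add]
    congr 2
    ring
  have h2 : Real.exp (-2 * s) / r / Real.exp (-2 * s) = 1 / r := by
    field_simp
  have h3 : r ^ 2 * (Real.exp (-4 * s) / r) = r * Real.exp (-4 * s) := by
    field_simp
  have h4 : Real.exp s * Real.exp (-2 * s) = Real.exp (-s) := by
    rw [← Real.exp_add]; congr 1; ring
  have h0 : thetaAux r 0 = thetaSeries (r ^ 2) (1 / r) := by
    simp [thetaAux]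
  have h5 : thetaSeries (r ^ 2) (r ^ 2 * (1 / r)) = thetaSeries (r ^ 2) (1 / r) := by
    rw [← thetaSeries_inv]
    congr 1
    field_simp
  rw [thetaAux_neg, realThetaTwo, realThetaThree, mul_assoc,
    thetaSeries_mul_thetaSeries hr0 hr1 (div_ne_zero (Real.exp_pos _).ne' hr0.ne')
      (Real.exp_pos _).ne', h1, h2, h3, h5, h0, thetaAux, ← h4]
  field_simp

/-- Splitting `(r; r)` and `(-r; r)` by parity in `(r; r)(-r; r) = (r²; r²)` leaves a common factor
`(r²; r²)` to cancel. -/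
theorem qPochReal_euler (hr0 : 0 < r) (hr1 : r < 1) :
    qPochReal (-r ^ 2) (r ^ 2) * qPochReal (-r) (r ^ 2) * qPochReal r (r ^ 2) = 1 := by
  have hp1 : r ^ 2 < 1 := by nlinarith
  have h1 := qPochReal_even_mul_odd hr0.le hr1 (-r)
  have h2 := qPochReal_even_mul_odd hr0.le hr1 r
  have h3 := qPochReal_mul_neg hr0.le hr1 r
  have hE := (qPochReal_pos (sq_nonneg r) hp1 hp1).ne'
  rw [show -r * r = -r ^ 2 by ring] at h1
  rw [show r * r = r ^ 2 by ring] at h2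
  rw [← h1, ← h2] at h3
  refine mul_right_cancel₀ hE ?_
  linear_combination h3

/-- Jacobi's derivative formula: both sides equal `2 E³`. For the theta constants this is Euler's
identity squared; for the derivative, the factor `1 - e^{-2s}` carries the zero and the other
factors are continuous. -/
theorem hasDerivAt_realThetaOne_zero (hr0 : 0 < r) (hr1 : r < 1) :
    HasDerivAt (realThetaOne r) (realThetaTwo r 0 * realThetaThree r 0 * realThetaFour r 0) 0 := by
  have hp0 : 0 < r ^ 2 := by positivity
  have hp1 : r ^ 2 < 1 := by nlinarith
  set E := qPochReal (r ^ 2) (r ^ 2) with hE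
  have hval : realThetaTwo r 0 * realThetaThree r 0 * realThetaFour r 0 = 2 * E ^ 3 := by
    have hm1 := qPochReal_eq_one_sub_mul hp0.le hp1 (-1)
    have heu := qPochReal_euler hr0 hr1
    have d1 : r ^ 2 / -r = -r := by field_simp
    have d2 : r ^ 2 / r = r := by field_simp
    rw [realThetaTwo_eq_product hr0 hr1, realThetaThree_eq_product hr0 hr1,
      realThetaFour_eq_product hr0 hr1]
    simp only [mul_zero, Real.exp_zero, mul_one, one_mul, d1, d2, hm1, neg_mul, div_neg, div_one,
      ← hE]
    linear_combination (2 * E ^ 3) * (qPochReal (-r ^ 2) (r ^ 2) * qPochReal (-r) (r ^ 2) *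
      qPochReal r (r ^ 2) + 1) * heu
  rw [hval, hasDerivAt_iff_tendsto_slope]
  have hexp : HasDerivAt (fun s : ℝ => 1 - Real.exp (-2 * s)) 2 0 := by
    have := (((hasDerivAt_id (0 : ℝ)).const_mul (-2)).exp).const_sub 1
    simpa using this
  rw [hasDerivAt_iff_tendsto_slope] at hexp
  have hc : Tendsto (fun s : ℝ => Real.exp (-2 * s)) (𝓝[≠] 0) (𝓝 1) := by
    have : Continuous fun s : ℝ => Real.exp (-2 * s) := by fun_prop
    simpa using (this.tendsto 0).mono_left nhdsWithin_le_nhds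
  have hc' : Tendsto (fun s : ℝ => Real.exp s) (𝓝[≠] 0) (𝓝 1) := by
    simpa using (Real.continuous_exp.tendsto 0).mono_left nhdsWithin_le_nhds
  have t1 : Tendsto (fun s : ℝ => qPochReal (Real.exp (-2 * s) * r ^ 2) (r ^ 2)) (𝓝[≠] 0)
      (𝓝 E) :=
    (tendsto_qPochReal_left hp0.le hp1 (r ^ 2)).comp (by simpa using hc.mul_const (r ^ 2))
  have t2 : Tendsto (fun s : ℝ => qPochReal (r ^ 2 / Real.exp (-2 * s)) (r ^ 2)) (𝓝[≠] 0)
      (𝓝 E) :=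
    (tendsto_qPochReal_left hp0.le hp1 (r ^ 2)).comp
      (by
        have := (tendsto_const_nhds (x := r ^ 2)).div hc one_ne_zero
        rwa [div_one] at this)
  have t3 := hexp.mul (hc'.mul ((t1.mul t2).const_mul E))
  rw [show 2 * (1 * (E * (E * E))) = 2 * E ^ 3 by ring] at t3
  refine t3.congr fun s => ?_
  rw [slope_def_field, slope_def_field, realThetaOne_zero hr0, realThetaOne_eq_product hr0 hr1,
    qPochReal_eq_one_sub_mul hp0.le hp1 (Real.exp (-2 * s))]
  simp only [mul_zero, Real.exp_zero, sub_self, sub_zero]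
  ring

/-- The Wronskian of `ϑ₁` and `ϑ₄`. -/
theorem realTheta_wronskian (hr0 : 0 < r) (hr1 : r < 1) (s : ℝ) :
    deriv (realThetaOne r) s * realThetaFour r s - realThetaOne r s * deriv (realThetaFour r) s =
      realThetaFour r 0 ^ 2 * (realThetaTwo r s * realThetaThree r s) := by
  -- Differentiating the separated product in `y` at `0` identifies the Wronskian with `ϑ₂ϑ₃` up to
  -- a constant.
  have key : ∀ x : ℝ, (deriv (realThetaOne r) x * realThetaFour r x -
      realThetaOne r x * deriv (realThetaFour r) x) * thetaAux r 0 =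
      deriv (thetaAux r) 0 * (realThetaTwo r x * realThetaThree r x) := by
    intro x
    have d1 : HasDerivAt (realThetaOne r) (deriv (realThetaOne r) x) (x + 0) := by
      rw [add_zero]; exact (differentiable_realThetaOne hr0 hr1 x).hasDerivAt
    have d4 : HasDerivAt (realThetaFour r) (deriv (realThetaFour r) x) (x - 0) := by
      rw [sub_zero]; exact (differentiable_realThetaFour hr0 hr1 x).hasDerivAt
    have dN := (differentiable_thetaAux hr0 hr1 0).hasDerivAt
    have dN' : HasDerivAt (thetaAux r) (deriv (thetaAux r) 0) (-(0 : ℝ)) := by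
      rw [neg_zero]; exact dN
    have e1 := (d1.comp_const_add x 0).mul (d4.comp_const_sub x 0)
    have e2 := (dN.const_mul (thetaAux r x)).sub
      ((dN'.comp (0 : ℝ) (hasDerivAt_neg 0)).const_mul (thetaAux r (-x)))
    have e4 := e1.unique (e2.congr_of_eventuallyEq (Eventually.of_forall fun y =>
      realThetaOne_mul_realThetaFour hr0 hr1 x y))
    simp only [add_zero, sub_zero] at e4
    rw [realThetaTwo_mul_realThetaThree hr0 hr1]
    linear_combination thetaAux r 0 * e4
  -- The constant is found at the zero of `ϑ₁` from Jacobi's derivative formula.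
  have h0 := key 0
  rw [(hasDerivAt_realThetaOne_zero hr0 hr1).deriv, realThetaOne_zero hr0] at h0
  have hN := (thetaAux_zero_pos hr0 hr1).ne'
  have h23 := (mul_pos (realThetaTwo_pos hr0 hr1 0) (realThetaThree_pos hr0 hr1 0)).ne'
  have hk : deriv (thetaAux r) 0 = realThetaFour r 0 ^ 2 * thetaAux r 0 := by
    refine mul_right_cancel₀ h23 ?_
    linear_combination -h0
  have hs := key s
  rw [hk] at hs
  refine mul_right_cancel₀ hN ?_
  linear_combination hs

end RealTheta

/-! ### Monotonicity and range of the quotient of `ϑ₄` by `ϑ₁` -/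

/-- The quotient `ϑ₄ / ϑ₁` along the imaginary axis as a real function. -/
noncomputable def realPhi (r s : ℝ) : ℝ := realThetaFour r s / realThetaOne r s

section RealPhi

variable {r : ℝ}

theorem realPhi_neg (hr0 : 0 < r) (s : ℝ) : realPhi r (-s) = -realPhi r s := by
  rw [realPhi, realPhi, realThetaFour_neg, realThetaOne_neg hr0, div_neg]

theorem realPhi_sub_log (hr0 : 0 < r) (s : ℝ) : realPhi r (s - Real.log r) = realPhi r s := by
  have h : -(r * Real.exp (-2 * s))⁻¹ ≠ 0 :=
    neg_ne_zero.mpr (inv_ne_zero (mul_ne_zero hr0.ne' (Real.exp_pos _).ne'))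
  rw [realPhi, realPhi, realThetaFour_add_period hr0, realThetaOne_add_period hr0,
    mul_div_mul_left _ _ h]

theorem realPhi_reflect (hr0 : 0 < r) (s : ℝ) : realPhi r (-Real.log r - s) = -realPhi r s := by
  rw [show -Real.log r - s = -s - Real.log r by ring, realPhi_sub_log hr0, realPhi_neg hr0]

theorem hasDerivAt_realPhi (hr0 : 0 < r) (hr1 : r < 1) {s : ℝ} (hs : realThetaOne r s ≠ 0) :
    HasDerivAt (realPhi r) (-(realThetaFour r 0 ^ 2 * (realThetaTwo r s * realThetaThree r s) /
      realThetaOne r s ^ 2)) s := by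
  have h := ((differentiable_realThetaFour hr0 hr1 s).hasDerivAt).div
    ((differentiable_realThetaOne hr0 hr1 s).hasDerivAt) hs
  rw [← realTheta_wronskian hr0 hr1 s]
  refine h.congr_deriv ?_
  ring

theorem tendsto_realPhi_zero (hr0 : 0 < r) (hr1 : r < 1) :
    Tendsto (realPhi r) (𝓝[>] 0) atTop := by
  have h4 : Tendsto (realThetaFour r) (𝓝[>] 0) (𝓝 (realThetaFour r 0)) :=
    ((differentiable_realThetaFour hr0 hr1).continuous.tendsto 0).mono_left nhdsWithin_le_nhds
  have h1 : Tendsto (realThetaOne r) (𝓝[>] 0) (𝓝[>] 0) := by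
    refine tendsto_nhdsWithin_iff.mpr ⟨?_, ?_⟩
    · have := (differentiable_realThetaOne hr0 hr1).continuous.tendsto 0
      rw [realThetaOne_zero hr0] at this
      exact this.mono_left nhdsWithin_le_nhds
    · have hL : 0 < -Real.log r := neg_pos.mpr (Real.log_neg hr0 hr1)
      filter_upwards [Ioo_mem_nhdsGT hL] with s hs using realThetaOne_pos hr0 hr1 hs.1 hs.2
  exact (h4.pos_mul_atTop (realThetaFour_zero_pos hr0 hr1)
    (tendsto_inv_nhdsGT_zero.comp h1)).congr fun s => by rw [realPhi, div_eq_mul_inv]; rfl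

theorem continuousOn_realPhi (hr0 : 0 < r) (hr1 : r < 1) :
    ContinuousOn (realPhi r) (Ioo 0 (-Real.log r)) := fun _ hs =>
  (hasDerivAt_realPhi hr0 hr1 (realThetaOne_pos hr0 hr1 hs.1 hs.2).ne').continuousAt.continuousWithinAt

theorem strictAntiOn_realPhi (hr0 : 0 < r) (hr1 : r < 1) :
    StrictAntiOn (realPhi r) (Ioo 0 (-Real.log r)) := by
  refine strictAntiOn_of_deriv_neg (convex_Ioo _ _) (continuousOn_realPhi hr0 hr1) fun s hs => ?_
  rw [interior_Ioo] at hs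
  have h1 := realThetaOne_pos hr0 hr1 hs.1 hs.2
  rw [(hasDerivAt_realPhi hr0 hr1 h1.ne').deriv, neg_lt_zero]
  have h2 := realThetaTwo_pos hr0 hr1 s
  have h3 := realThetaThree_pos hr0 hr1 s
  have h4 := realThetaFour_zero_pos hr0 hr1
  positivity

/-- The quotient is arbitrarily large near `0` and, by the reflection symmetry, arbitrarily negative
near the other endpoint; the intermediate value theorem does the rest. -/
theorem exists_realPhi_eq (hr0 : 0 < r) (hr1 : r < 1) (t : ℝ) :
    ∃ s ∈ Ioo 0 (-Real.log r), realPhi r s = t := by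
  have hL : 0 < -Real.log r := neg_pos.mpr (Real.log_neg hr0 hr1)
  have hlarge : ∀ y : ℝ, ∃ s ∈ Ioo 0 (-Real.log r), y ≤ realPhi r s := fun y => by
    obtain ⟨s, hs, hy⟩ := ((Ioo_mem_nhdsGT hL : Ioo 0 (-Real.log r) ∈ 𝓝[>] 0) |> (eventually_mem_set.mpr)
      |>.and ((tendsto_realPhi_zero hr0 hr1).eventually_ge_atTop y)).exists
    exact ⟨s, hs, hy⟩
  obtain ⟨s₁, hs₁, h₁⟩ := hlarge t
  obtain ⟨s₂, hs₂, h₂⟩ := hlarge (-t)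
  have hs₂' : -Real.log r - s₂ ∈ Ioo 0 (-Real.log r) :=
    ⟨by linarith [hs₂.2], by linarith [hs₂.1]⟩
  exact isPreconnected_Ioo.intermediate_value hs₂' hs₁ (continuousOn_realPhi hr0 hr1)
    ⟨by rw [realPhi_reflect hr0]; linarith, h₁⟩

/-- The common device for the elliptic integral and the `cs` formula: the difference of the two
sides has zero derivative and vanishes at `0⁺`. -/
theorem eq_zero_of_deriv_eq_zero_of_tendsto {f : ℝ → ℝ} {L : ℝ}
    (hf : ∀ s ∈ Ioo 0 L, HasDerivAt f 0 s) (h0 : Tendsto f (𝓝[>] 0) (𝓝 0)) {s : ℝ}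
    (hs : s ∈ Ioo 0 L) : f s = 0 := by
  obtain ⟨a, ha⟩ := isOpen_Ioo.exists_is_const_of_deriv_eq_zero isPreconnected_Ioo
    (fun x hx => (hf x hx).differentiableAt.differentiableWithinAt) fun x hx => (hf x hx).deriv
  have h1 : Tendsto f (𝓝[>] 0) (𝓝 a) := by
    refine tendsto_const_nhds.congr' ?_
    filter_upwards [Ioo_mem_nhdsGT (hs.1.trans hs.2)] with x hx using (ha x hx).symm
  rw [ha s hs]
  exact tendsto_nhds_unique h1 h0

end RealPhi

/-! ### The elliptic integral and the function `cs` -/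

section EllipticIntegral

open MeasureTheory

theorem hasDerivAt_integral_Ioi {f : ℝ → ℝ} (hf : Integrable f) (hc : Continuous f) (t : ℝ) :
    HasDerivAt (fun x => ∫ y in Ioi x, f y) (-f t) t := by
  have h : (fun x => ∫ y in Ioi x, f y) = fun x => (∫ y in Ioi 0, f y) - ∫ y in (0 : ℝ)..x, f y := by
    funext x
    rw [← intervalIntegral.integral_interval_add_Ioi (a := 0) (b := x) hf.integrableOn
      hf.integrableOn]
    ring
  rw [h]
  exact (intervalIntegral.integral_hasDerivAt_right (hc.intervalIntegrable _ _)
    hc.stronglyMeasurable.stronglyMeasurableAtFilter hc.continuousAt).const_sub _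

theorem tendsto_integral_Ioi_atTop {f : ℝ → ℝ} (hf : Integrable f) :
    Tendsto (fun x => ∫ y in Ioi x, f y) atTop (𝓝 0) := by
  have h := (intervalIntegral_tendsto_integral_Ioi 0 hf.integrableOn tendsto_id).const_sub
    (∫ y in Ioi 0, f y)
  rw [sub_self] at h
  refine h.congr fun x => ?_
  rw [← intervalIntegral.integral_interval_add_Ioi (a := 0) (b := x) hf.integrableOn
      hf.integrableOn]
  simp

theorem rpow_neg_half {x y : ℝ} (hy : 0 < y) (h : x = y ^ 2) : x ^ (-1 / 2 : ℝ) = y⁻¹ := by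
  rw [h, ← Real.rpow_natCast, ← Real.rpow_mul hy.le, ← Real.rpow_neg_one]
  norm_num

theorem continuous_product_rpow {a b : ℝ} (ha : 0 < a) (hb : 0 < b) :
    Continuous fun x : ℝ => ((a + x ^ 2) * (b + x ^ 2)) ^ (-1 / 2 : ℝ) := by
  refine Continuous.rpow_const (by fun_prop) fun x => Or.inl ?_
  positivity

theorem integrable_product_rpow {a b : ℝ} (ha : 0 < a) (hb : 0 < b) :
    Integrable fun x : ℝ => ((a + x ^ 2) * (b + x ^ 2)) ^ (-1 / 2 : ℝ) := by
  -- With this `c` both quadratic factors are at least `c (1 + x²)`, so the integrand is dominated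
  -- by a multiple of `(1 + x²)⁻¹`.
  set c := min (min a b) 1 with hc
  have hc0 : 0 < c := lt_min (lt_min ha hb) one_pos
  have hca : c ≤ a := (min_le_left _ _).trans (min_le_left _ _)
  have hcb : c ≤ b := (min_le_left _ _).trans (min_le_right _ _)
  have hc1 : c ≤ 1 := min_le_right _ _
  refine (integrable_inv_one_add_sq.const_mul c⁻¹).mono'
    (continuous_product_rpow ha hb).aestronglyMeasurable (Eventually.of_forall fun x => ?_)
  have h0 : 0 < c * (1 + x ^ 2) := by positivity
  have hx := sq_nonneg x
  have h1 : (c * (1 + x ^ 2)) ^ 2 ≤ (a + x ^ 2) * (b + x ^ 2) := by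
    rw [sq]
    refine mul_le_mul ?_ ?_ h0.le (by positivity) <;> nlinarith
  rw [Real.norm_of_nonneg (by positivity), ← mul_inv, ← rpow_neg_half h0 rfl]
  exact Real.rpow_le_rpow_of_nonpos (by positivity) h1 (by norm_num)

/-- By the relations between squares, the integrand at `Φ(s)` is the reciprocal of `-Φ'(s) /
(ϑ₂ϑ₃)`, with the rescaled constants. The left side thus has derivative one in `s`, and it tends to
`0` as `s → 0⁺` because `Φ → ∞`. -/
theorem elliptic_integral_realPhi {r : ℝ} (hr0 : 0 < r) (hr1 : r < 1) {s : ℝ}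
    (hs : s ∈ Ioo 0 (-Real.log r)) :
    1 / (realThetaTwo r 0 * realThetaThree r 0) * ∫ x in Ioi (realPhi r s),
      ((realThetaThree r 0 ^ 2 / realThetaTwo r 0 ^ 2 + x ^ 2) *
        (r * realThetaTwo r 0 ^ 2 / realThetaThree r 0 ^ 2 + x ^ 2)) ^ (-1 / 2 : ℝ) = s := by
  have c2 := realThetaTwo_pos hr0 hr1 0
  have c3 := realThetaThree_pos hr0 hr1 0
  have c4 := realThetaFour_zero_pos hr0 hr1
  set f : ℝ → ℝ := fun x => ((realThetaThree r 0 ^ 2 / realThetaTwo r 0 ^ 2 + x ^ 2) *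
        (r * realThetaTwo r 0 ^ 2 / realThetaThree r 0 ^ 2 + x ^ 2)) ^ (-1 / 2 : ℝ) with hf
  have hint : Integrable f := integrable_product_rpow (by positivity) (by positivity)
  have hcont : Continuous f := continuous_product_rpow (by positivity) (by positivity)
  have hderiv : ∀ x ∈ Ioo 0 (-Real.log r), HasDerivAt (fun s =>
      1 / (realThetaTwo r 0 * realThetaThree r 0) * (∫ x in Ioi (realPhi r s), f x) - s) 0 x := by
    intro x hx
    have h1 := realThetaOne_pos hr0 hr1 hx.1 hx.2
    have h2 := realThetaTwo_pos hr0 hr1 x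
    have h3 := realThetaThree_pos hr0 hr1 x
    have hfx : f (realPhi r x) = (realThetaFour r 0 ^ 2 * (realThetaTwo r x * realThetaThree r x) /
        (realThetaTwo r 0 * realThetaThree r 0 * realThetaOne r x ^ 2))⁻¹ := by
      refine rpow_neg_half (by positivity) ?_
      have e2 := realThetaTwo_sq hr0 hr1 x
      have e3 := realThetaThree_sq hr0 hr1 x
      have g2 : realThetaThree r 0 ^ 2 / realThetaTwo r 0 ^ 2 + realPhi r x ^ 2 =
          realThetaFour r 0 ^ 2 * realThetaTwo r x ^ 2 /
            (realThetaTwo r 0 ^ 2 * realThetaOne r x ^ 2) := by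
        rw [e2, realPhi]; field_simp; ring
      have g3 : r * realThetaTwo r 0 ^ 2 / realThetaThree r 0 ^ 2 + realPhi r x ^ 2 =
          realThetaFour r 0 ^ 2 * realThetaThree r x ^ 2 /
            (realThetaThree r 0 ^ 2 * realThetaOne r x ^ 2) := by
        rw [e3, realPhi]; field_simp; ring
      rw [g2, g3]
      field_simp
    have hG := ((hasDerivAt_integral_Ioi hint hcont (realPhi r x)).comp x
      (hasDerivAt_realPhi hr0 hr1 h1.ne')).const_mul
        (1 / (realThetaTwo r 0 * realThetaThree r 0))
    refine (hG.sub (hasDerivAt_id x)).congr_deriv ?_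
    rw [hfx]
    field_simp
    ring
  have hlim : Tendsto (fun s =>
      1 / (realThetaTwo r 0 * realThetaThree r 0) * (∫ x in Ioi (realPhi r s), f x) - s)
      (𝓝[>] 0) (𝓝 0) := by
    have t1 := ((tendsto_integral_Ioi_atTop hint).comp (tendsto_realPhi_zero hr0 hr1)).const_mul
      (1 / (realThetaTwo r 0 * realThetaThree r 0))
    have t2 : Tendsto (fun s : ℝ => s) (𝓝[>] 0) (𝓝 0) := nhdsWithin_le_nhds
    have t3 := t1.sub t2
    rw [mul_zero, sub_zero] at t3
    exact t3
  exact sub_eq_zero.mp (eq_zero_of_deriv_eq_zero_of_tendsto hderiv hlim hs)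

theorem continuous_ellipticF_integrand {k : ℝ} (hk : k ^ 2 < 1) :
    Continuous fun θ : ℝ => 1 / √(1 - k ^ 2 * Real.sin θ ^ 2) := by
  refine continuous_const.div (by fun_prop) fun θ => ?_
  have := Real.sin_sq_le_one θ
  exact (Real.sqrt_pos.mpr (by nlinarith [sq_nonneg k, sq_nonneg (Real.sin θ)])).ne'

theorem hasDerivAt_ellipticF {k : ℝ} (hk : k ^ 2 < 1) (φ : ℝ) :
    HasDerivAt (ellipticF k) (1 / √(1 - k ^ 2 * Real.sin φ ^ 2)) φ :=
  intervalIntegral.integral_hasDerivAt_right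
    ((continuous_ellipticF_integrand hk).intervalIntegrable _ _)
    (continuous_ellipticF_integrand hk).stronglyMeasurable.stronglyMeasurableAtFilter
    (continuous_ellipticF_integrand hk).continuousAt

theorem strictMono_ellipticF {k : ℝ} (hk : k ^ 2 < 1) : StrictMono (ellipticF k) := by
  refine strictMono_of_deriv_pos fun φ => ?_
  rw [(hasDerivAt_ellipticF hk φ).deriv]
  have := Real.sin_sq_le_one φ
  exact one_div_pos.mpr (Real.sqrt_pos.mpr (by nlinarith [sq_nonneg k, sq_nonneg (Real.sin φ)]))

/-- Injectivity of `F` is enough, since the amplitude is only evaluated at points exhibited as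
values of `F`. -/
theorem jacobiAm_ellipticF {k : ℝ} (hk : k ^ 2 < 1) (φ : ℝ) : jacobiAm (ellipticF k φ) k = φ :=
  Function.leftInverse_invFun (strictMono_ellipticF hk).injective φ

/-- The angle with cotangent equal to the right side is shown to be the amplitude, by checking that
`F` of it has the constant derivative `ϑ₃(0)²` in `s` and vanishes at `0⁺`. -/
theorem jacobiCs_realPhi {r : ℝ} (hr0 : 0 < r) (hr1 : r < 1) {s : ℝ}
    (hs : s ∈ Ioo 0 (-Real.log r)) :
    jacobiCs (s * realThetaThree r 0 ^ 2) (realThetaFour r 0 ^ 2 / realThetaThree r 0 ^ 2) =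
      realThetaTwo r 0 / realThetaThree r 0 * realPhi r s := by
  have c2 := realThetaTwo_pos hr0 hr1 0
  have c3 := realThetaThree_pos hr0 hr1 0
  have c4 := realThetaFour_zero_pos hr0 hr1
  set k := realThetaFour r 0 ^ 2 / realThetaThree r 0 ^ 2 with hkdef
  have hJ := realTheta_zero_pow_four hr0 hr1
  have hksq : k ^ 2 = realThetaFour r 0 ^ 4 / realThetaThree r 0 ^ 4 := by
    rw [hkdef, div_pow]; ring
  -- The complementary part `r ϑ₂⁴` in Jacobi's quartic identity is strictly positive.
  have hk : k ^ 2 < 1 := by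
    rw [hksq, div_lt_one (by positivity), hJ]
    have : 0 < r * realThetaTwo r 0 ^ 4 := by positivity
    linarith
  set c : ℝ → ℝ := fun s => realThetaTwo r 0 / realThetaThree r 0 * realPhi r s with hcdef
  set ψ : ℝ → ℝ := fun s => Real.pi / 2 - Real.arctan (c s) with hψ
  have hF : ellipticF k (ψ s) - s * realThetaThree r 0 ^ 2 = 0 := by
    refine eq_zero_of_deriv_eq_zero_of_tendsto
      (f := fun s => ellipticF k (ψ s) - s * realThetaThree r 0 ^ 2) ?_ ?_ hs
    · intro x hx
      have h1 := realThetaOne_pos hr0 hr1 hx.1 hx.2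
      have h2 := realThetaTwo_pos hr0 hr1 x
      have h3 := realThetaThree_pos hr0 hr1 x
      have e2 := realThetaTwo_sq hr0 hr1 x
      have e3 := realThetaThree_sq hr0 hr1 x
      have hc1 : 1 + c x ^ 2 = realThetaFour r 0 ^ 2 * realThetaTwo r x ^ 2 /
          (realThetaThree r 0 ^ 2 * realThetaOne r x ^ 2) := by
        rw [e2]; simp only [hcdef, realPhi]; field_simp; ring
      have hsin : Real.sin (ψ x) ^ 2 = 1 / (1 + c x ^ 2) := by
        rw [hψ, Real.sin_pi_div_two_sub, Real.cos_sq_arctan]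
      -- This is `dn` as a theta quotient; it combines both relations between squares with the
      -- quartic identity, after multiplication by `ϑ₄(0)²`.
      have hsqrt : √(1 - k ^ 2 * Real.sin (ψ x) ^ 2) =
          realThetaTwo r 0 * realThetaThree r x / (realThetaThree r 0 * realThetaTwo r x) := by
        rw [Real.sqrt_eq_iff_eq_sq _ (by positivity)]
        · rw [hsin, hc1, hksq]
          field_simp
          refine mul_left_cancel₀ (pow_pos c4 2).ne' ?_
          linear_combination realThetaThree r 0 ^ 2 * e2 - realThetaTwo r 0 ^ 2 * e3 +
            realThetaOne r x ^ 2 * hJ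
        · rw [hsin]
          have : 1 / (1 + c x ^ 2) ≤ 1 := by
            rw [div_le_one (by positivity)]; nlinarith [sq_nonneg (c x)]
          have h0 : 0 ≤ 1 / (1 + c x ^ 2) := by positivity
          nlinarith [sq_nonneg k]
      have hψd := (((hasDerivAt_realPhi hr0 hr1 h1.ne').const_mul
        (realThetaTwo r 0 / realThetaThree r 0)).arctan).const_sub (Real.pi / 2)
      have hFd := (hasDerivAt_ellipticF hk (ψ x)).comp x hψd
      refine (hFd.sub ((hasDerivAt_id x).mul_const (realThetaThree r 0 ^ 2))).congr_deriv ?_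
      change _ / √(1 - k ^ 2 * Real.sin (ψ x) ^ 2) * -(1 / (1 + c x ^ 2) * _) - _ = 0
      rw [hsqrt, hc1]
      field_simp
      ring
    · have t1 : Tendsto c (𝓝[>] 0) atTop :=
        (tendsto_realPhi_zero hr0 hr1).const_mul_atTop (by positivity)
      have t2 : Tendsto ψ (𝓝[>] 0) (𝓝 0) := by
        have := ((tendsto_nhds_of_tendsto_nhdsWithin Real.tendsto_arctan_atTop).comp t1).const_sub
          (Real.pi / 2)
        rwa [sub_self] at this
      have t3 : Tendsto (ellipticF k) (𝓝 0) (𝓝 0) := by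
        have := (hasDerivAt_ellipticF hk 0).continuousAt.tendsto
        rwa [show ellipticF k 0 = 0 by simp [ellipticF]] at this
      have t4 : Tendsto (fun s : ℝ => s * realThetaThree r 0 ^ 2) (𝓝[>] 0) (𝓝 0) := by
        have : Continuous fun s : ℝ => s * realThetaThree r 0 ^ 2 := by fun_prop
        simpa using (this.tendsto 0).mono_left nhdsWithin_le_nhds
      have t5 := (t3.comp t2).sub t4
      rw [sub_zero] at t5
      exact t5
  rw [jacobiCs, ← sub_eq_zero.mp hF, jacobiAm_ellipticF hk, hψ, Real.cos_pi_div_two_sub,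
    Real.sin_pi_div_two_sub, ← Real.tan_eq_sin_div_cos, Real.tan_arctan]

end EllipticIntegral

/-! ### Identification with the complex theta functions -/

section ThetaFunctions

variable {r : ℝ}

theorem thetaQ_ofReal {p : ℝ} (hp0 : 0 ≤ p) (hp1 : p < 1) (x : ℝ) :
    thetaQ p (x : ℂ) = ((qPochReal x p * qPochReal (p / x) p : ℝ) : ℂ) := by
  rw [thetaQ, show ((p : ℂ) * (x : ℂ)⁻¹) = ((p / x : ℝ) : ℂ) by push_cast; rfl,
    qPochInf_ofReal hp0 hp1, qPochInf_ofReal hp0 hp1, Complex.ofReal_mul]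

theorem exp_two_I_mul_I_mul (s : ℝ) :
    Complex.exp (2 * Complex.I * (Complex.I * s)) = ((Real.exp (-2 * s) : ℝ) : ℂ) := by
  rw [Complex.ofReal_exp]
  congr 1
  push_cast
  linear_combination (2 * s : ℂ) * Complex.I_mul_I

theorem exp_neg_I_mul_I_mul (s : ℝ) :
    Complex.exp (-Complex.I * (Complex.I * s)) = ((Real.exp s : ℝ) : ℂ) := by
  rw [Complex.ofReal_exp]
  congr 1
  linear_combination (-s : ℂ) * Complex.I_mul_I

/-- At `z = i s` the exponential `e^{2iz}` is the real number `e^{-2s}`, so all products are real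
and the triple product applies. -/
theorem thetaFour_I_mul (hr0 : 0 < r) (hr1 : r < 1) (s : ℝ) :
    thetaFour (Complex.I * s) r = ((realThetaFour r s : ℝ) : ℂ) := by
  have hp0 : 0 < r ^ 2 := by positivity
  have hp1 : r ^ 2 < 1 := by nlinarith
  rw [thetaFour, exp_two_I_mul_I_mul, ← Complex.ofReal_mul, ← Complex.ofReal_pow,
    qPochInf_ofReal hp0.le hp1, thetaQ_ofReal hp0.le hp1, realThetaFour_eq_product hr0 hr1]
  push_cast
  rfl

theorem thetaThree_I_mul (hr0 : 0 < r) (hr1 : r < 1) (s : ℝ) :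
    thetaThree (Complex.I * s) r = ((realThetaThree r s : ℝ) : ℂ) := by
  have hp0 : 0 < r ^ 2 := by positivity
  have hp1 : r ^ 2 < 1 := by nlinarith
  rw [thetaThree, exp_two_I_mul_I_mul, ← Complex.ofReal_neg, ← Complex.ofReal_mul,
    ← Complex.ofReal_pow, qPochInf_ofReal hp0.le hp1, thetaQ_ofReal hp0.le hp1,
    realThetaThree_eq_product hr0 hr1]
  push_cast
  rfl

theorem thetaTwo_I_mul (hr0 : 0 < r) (hr1 : r < 1) (s : ℝ) :
    thetaTwo (Complex.I * s) r = ((r ^ (1 / 4 : ℝ) * realThetaTwo r s : ℝ) : ℂ) := by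
  have hp0 : 0 < r ^ 2 := by positivity
  have hp1 : r ^ 2 < 1 := by nlinarith
  rw [thetaTwo, exp_two_I_mul_I_mul, exp_neg_I_mul_I_mul, ← Complex.ofReal_neg,
    ← Complex.ofReal_pow, qPochInf_ofReal hp0.le hp1, thetaQ_ofReal hp0.le hp1,
    realThetaTwo_eq_product hr0 hr1]
  push_cast
  ring

theorem thetaOne_I_mul (hr0 : 0 < r) (hr1 : r < 1) (s : ℝ) :
    thetaOne (Complex.I * s) r =
      Complex.I * ((r ^ (1 / 4 : ℝ) * realThetaOne r s : ℝ) : ℂ) := by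
  have hp0 : 0 < r ^ 2 := by positivity
  have hp1 : r ^ 2 < 1 := by nlinarith
  rw [thetaOne, exp_two_I_mul_I_mul, exp_neg_I_mul_I_mul,
    ← Complex.ofReal_pow, qPochInf_ofReal hp0.le hp1, thetaQ_ofReal hp0.le hp1,
    realThetaOne_eq_product hr0 hr1]
  push_cast
  ring

theorem thetaFourConst_eq (hr0 : 0 < r) (hr1 : r < 1) :
    thetaFourConst r = realThetaFour r 0 := by
  have h := thetaFour_I_mul hr0 hr1 0
  rw [Complex.ofReal_zero, mul_zero] at h
  rw [thetaFourConst, h, Complex.ofReal_re]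

theorem thetaThreeConst_eq (hr0 : 0 < r) (hr1 : r < 1) :
    thetaThreeConst r = realThetaThree r 0 := by
  have h := thetaThree_I_mul hr0 hr1 0
  rw [Complex.ofReal_zero, mul_zero] at h
  rw [thetaThreeConst, h, Complex.ofReal_re]

theorem thetaTwoConst_eq (hr0 : 0 < r) (hr1 : r < 1) :
    thetaTwoConst r = r ^ (1 / 4 : ℝ) * realThetaTwo r 0 := by
  have h := thetaTwo_I_mul hr0 hr1 0
  rw [Complex.ofReal_zero, mul_zero] at h
  rw [thetaTwoConst, h, Complex.ofReal_re]

end ThetaFunctions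

/-! ### The map `Φ` and its inverse -/

section PhiFunction

variable {q : ℝ}

theorem sq_rpow_quarter (hq0 : 0 < q) : (q ^ 2) ^ (1 / 4 : ℝ) = q ^ (1 / 2 : ℝ) := by
  rw [← Real.rpow_natCast, ← Real.rpow_mul hq0.le]
  norm_num

theorem rpow_half_sq (hq0 : 0 < q) : (q ^ (1 / 2 : ℝ)) ^ 2 = q := by
  rw [← Real.rpow_natCast, ← Real.rpow_mul hq0.le]
  norm_num

/-- The factor `i (q²)^{1/4} = i q^{1/2}` of `ϑ₁` cancels the prefactor of `Φ`. At `s = 0` both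
sides are `0` by the convention for division; `PhiExt` replaces that value by `∞`. -/
theorem Phi_eq_realPhi (hq0 : 0 < q) (hq1 : q < 1) (s : ℝ) :
    Phi q s = ((realPhi (q ^ 2) s : ℝ) : ℂ) := by
  have hr0 : 0 < q ^ 2 := by positivity
  have hr1 : q ^ 2 < 1 := by nlinarith
  rw [Phi, thetaFour_I_mul hr0 hr1, thetaOne_I_mul hr0 hr1, sq_rpow_quarter hq0, realPhi]
  have h : ((q ^ (1 / 2 : ℝ) : ℝ) : ℂ) ≠ 0 := by
    exact_mod_cast (Real.rpow_pos_of_pos hq0 _).ne'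
  rw [Complex.ofReal_mul, ← mul_assoc Complex.I, mul_div_assoc', mul_div_mul_left _ _
    (mul_ne_zero Complex.I_ne_zero h), Complex.ofReal_div]

theorem neg_log_sq (q : ℝ) : -Real.log (q ^ 2) = -2 * Real.log q := by
  rw [Real.log_pow]
  push_cast
  ring

theorem strictAntiOn_Phi (hq0 : 0 < q) (hq1 : q < 1) :
    StrictAntiOn (fun s : ℝ => (Phi q s).re) (Ioo 0 (-2 * Real.log q)) := by
  have h := strictAntiOn_realPhi (r := q ^ 2) (by positivity) (by nlinarith)
  rw [neg_log_sq] at h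
  simpa only [Phi_eq_realPhi hq0 hq1, Complex.ofReal_re] using h

theorem PhiExt_zero (q : ℝ) : PhiExt q 0 = OnePoint.infty := if_pos rfl

theorem PhiExt_of_ne_zero (hq0 : 0 < q) (hq1 : q < 1) {s : ℝ} (hs : s ≠ 0) :
    PhiExt q s = OnePoint.some (realPhi (q ^ 2) s) := by
  rw [PhiExt, if_neg hs, Phi_eq_realPhi hq0 hq1, Complex.ofReal_re]

theorem surjOn_PhiExt (hq0 : 0 < q) (hq1 : q < 1) :
    SurjOn (PhiExt q) (Ico 0 (-2 * Real.log q)) univ := by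
  have hL : 0 < -2 * Real.log q := by have := Real.log_neg hq0 hq1; linarith
  intro t _
  induction t using OnePoint.rec with
  | infty => exact ⟨0, ⟨le_rfl, hL⟩, PhiExt_zero q⟩
  | coe t =>
    obtain ⟨s, hs, rfl⟩ := exists_realPhi_eq (r := q ^ 2) (by positivity) (by nlinarith) t
    rw [neg_log_sq] at hs
    exact ⟨s, ⟨hs.1.le, hs.2⟩, PhiExt_of_ne_zero hq0 hq1 hs.1.ne'⟩

/-- Since `ϑ₂² = q · realThetaTwo²` at nome `q²`, the factors `q` in the two coefficients become `1`
and `q²`. -/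
theorem ellipticIntegrand_eq (hq0 : 0 < q) (hq1 : q < 1) :
    ellipticIntegrand q = fun x =>
      ((realThetaThree (q ^ 2) 0 ^ 2 / realThetaTwo (q ^ 2) 0 ^ 2 + x ^ 2) *
        (q ^ 2 * realThetaTwo (q ^ 2) 0 ^ 2 / realThetaThree (q ^ 2) 0 ^ 2 + x ^ 2)) ^
          (-1 / 2 : ℝ) := by
  have hr0 : 0 < q ^ 2 := by positivity
  have hr1 : q ^ 2 < 1 := by nlinarith
  have c2 := realThetaTwo_pos hr0 hr1 0
  funext x
  rw [ellipticIntegrand, thetaThreeConst_eq hr0 hr1, thetaTwoConst_eq hr0 hr1,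
    sq_rpow_quarter hq0, mul_pow, rpow_half_sq hq0]
  congr 3
  · field_simp
  · ring

theorem integrable_ellipticIntegrand (hq0 : 0 < q) (hq1 : q < 1) :
    MeasureTheory.Integrable (ellipticIntegrand q) := by
  have hr0 : 0 < q ^ 2 := by positivity
  have hr1 : q ^ 2 < 1 := by nlinarith
  have c2 := realThetaTwo_pos hr0 hr1 0
  have c3 := realThetaThree_pos hr0 hr1 0
  rw [ellipticIntegrand_eq hq0 hq1]
  exact integrable_product_rpow (by positivity) (by positivity)

theorem leftInvOn_PhiInv (hq0 : 0 < q) (hq1 : q < 1) :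
    LeftInvOn (PhiInv q) (PhiExt q) (Ico 0 (-2 * Real.log q)) := by
  have hr0 : 0 < q ^ 2 := by positivity
  have hr1 : q ^ 2 < 1 := by nlinarith
  have c2 := realThetaTwo_pos hr0 hr1 0
  have c3 := realThetaThree_pos hr0 hr1 0
  have hqh : 0 < q ^ (1 / 2 : ℝ) := Real.rpow_pos_of_pos hq0 _
  intro s hs
  rcases eq_or_ne s 0 with rfl | h0
  · rw [PhiExt_zero]; rfl
  · have hs' : s ∈ Ioo 0 (-Real.log (q ^ 2)) := by
      rw [neg_log_sq]; exact ⟨lt_of_le_of_ne hs.1 h0.symm, hs.2⟩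
    have h := elliptic_integral_realPhi hr0 hr1 hs'
    rw [PhiExt_of_ne_zero hq0 hq1 h0]
    change q ^ (1 / 2 : ℝ) / (thetaTwoConst (q ^ 2) * thetaThreeConst (q ^ 2)) *
      ∫ x in Ioi (realPhi (q ^ 2) s), ellipticIntegrand q x = s
    rw [ellipticIntegrand_eq hq0 hq1, thetaThreeConst_eq hr0 hr1, thetaTwoConst_eq hr0 hr1,
      sq_rpow_quarter hq0]
    refine Eq.trans ?_ h
    congr 1
    field_simp

/-- Injectivity comes from the elliptic integral being a left inverse. -/
theorem bijOn_PhiExt (hq0 : 0 < q) (hq1 : q < 1) :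
    BijOn (PhiExt q) (Ico 0 (-2 * Real.log q)) univ :=
  ⟨mapsTo_univ _ _, (leftInvOn_PhiInv hq0 hq1).injOn, surjOn_PhiExt hq0 hq1⟩

theorem invOn_PhiInv (hq0 : 0 < q) (hq1 : q < 1) :
    InvOn (PhiInv q) (PhiExt q) (Ico 0 (-2 * Real.log q)) univ :=
  ⟨leftInvOn_PhiInv hq0 hq1,
    (leftInvOn_PhiInv hq0 hq1).rightInvOn_image.mono (surjOn_PhiExt hq0 hq1)⟩

theorem Phi_re_eq_jacobiCs (hq0 : 0 < q) (hq1 : q < 1) {s : ℝ}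
    (hs : s ∈ Ioo 0 (-2 * Real.log q)) :
    (Phi q s).re = q ^ (1 / 2 : ℝ) * (thetaThreeConst (q ^ 2) / thetaTwoConst (q ^ 2)) *
      jacobiCs (s * thetaThreeConst (q ^ 2) ^ 2)
        (thetaFourConst (q ^ 2) ^ 2 / thetaThreeConst (q ^ 2) ^ 2) := by
  have hr0 : 0 < q ^ 2 := by positivity
  have hr1 : q ^ 2 < 1 := by nlinarith
  have c2 := realThetaTwo_pos hr0 hr1 0
  have c3 := realThetaThree_pos hr0 hr1 0
  have hqh : 0 < q ^ (1 / 2 : ℝ) := Real.rpow_pos_of_pos hq0 _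
  rw [← neg_log_sq] at hs
  rw [Phi_eq_realPhi hq0 hq1, Complex.ofReal_re, thetaThreeConst_eq hr0 hr1,
    thetaTwoConst_eq hr0 hr1, thetaFourConst_eq hr0 hr1, jacobiCs_realPhi hr0 hr1 hs,
    sq_rpow_quarter hq0]
  field_simp

end PhiFunction

/-! ### Boundary values at `+∞` and Green's formula -/

section BoundaryValues

variable {q : ℝ}

/-- The two boundary values at `+∞` of a sequence in the maximal domain. -/
def HasBoundaryValues (q : ℝ) (ψ : ℤ → ℂ) (a b : ℂ) : Prop :=
  Tendsto (fun n : ℤ => (-q : ℂ) ^ (-n) * ψ (2 * n)) atTop (𝓝 a) ∧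
    Tendsto (fun n : ℤ => (-q : ℂ) ^ (-n) * ψ (2 * n + 1)) atTop (𝓝 b)

theorem norm_neg_ofReal_zpow (hq0 : 0 < q) (n : ℤ) : ‖(-q : ℂ) ^ n‖ = q ^ n := by
  rw [norm_zpow, norm_neg, Complex.norm_real, Real.norm_of_nonneg hq0.le]

theorem norm_ofReal_zpow (hq0 : 0 < q) (n : ℤ) : ‖(q : ℂ) ^ n‖ = q ^ n := by
  rw [norm_zpow, Complex.norm_real, Real.norm_of_nonneg hq0.le]

/-- The rescaled equation is a constant-coefficient two-step recursion with a source damped by `q ^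
(n + 1)`; its homogeneous solutions behave like `(-q) ^ n` along each parity class. -/
theorem jacobiExpr_add_one (hq0 : 0 < q) (ψ : ℤ → ℂ) (n : ℤ) :
    ψ (n + 2) + q * ψ n = (q : ℂ) ^ (n + 1) * jacobiExpr q ψ (n + 1) := by
  have hq : (q : ℂ) ≠ 0 := by exact_mod_cast hq0.ne'
  rw [jacobiExpr, show -(n + 1) + 1 = -n by ring, show n + 1 - 1 = n by ring,
    show n + 1 + 1 = n + 2 by ring, mul_add, ← mul_assoc, ← mul_assoc, ← zpow_add₀ hq,
    ← zpow_add₀ hq, show n + 1 + -n = 1 by ring, show n + 1 + -(n + 1) = 0 by ring]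
  simp
  ring

/-- Consecutive terms differ by at most `q ^ (n + i) C`, so the sequence is Cauchy by geometric
comparison. -/
theorem exists_tendsto_of_jacobiExpr_bounded (hq0 : 0 < q) (hq1 : q < 1) {ψ : ℤ → ℂ} {C : ℝ}
    (hC : ∀ n, ‖jacobiExpr q ψ n‖ ≤ C) (i : ℤ) :
    ∃ a, Tendsto (fun n : ℤ => (-q : ℂ) ^ (-n) * ψ (2 * n + i)) atTop (𝓝 a) := by
  have hq' : (q : ℂ) ≠ 0 := by exact_mod_cast hq0.ne'
  have hq : (-q : ℂ) ≠ 0 := neg_ne_zero.mpr (by exact_mod_cast hq0.ne')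
  simp only [tendsto_int_atTop_iff]
  refine cauchySeq_tendsto_of_complete (cauchySeq_of_le_geometric q (q ^ i * C) hq1 fun n => ?_)
  rw [dist_eq_norm']
  have h := jacobiExpr_add_one hq0 ψ (2 * n + i)
  have e : (-q : ℂ) ^ (-((n + 1 : ℕ) : ℤ)) * ψ (2 * ((n + 1 : ℕ) : ℤ) + i) -
      (-q : ℂ) ^ (-(n : ℤ)) * ψ (2 * n + i) =
      (-q : ℂ) ^ (-(n : ℤ) - 1) * ((q : ℂ) ^ (2 * n + i + 1) * jacobiExpr q ψ (2 * n + i + 1)) := by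
    rw [← h, show (2 * ((n + 1 : ℕ) : ℤ) + i) = 2 * n + i + 2 by push_cast; ring,
      show (-((n + 1 : ℕ) : ℤ)) = -n - 1 by push_cast; ring, zpow_sub_one₀ hq]
    field_simp
    ring
  rw [e, norm_mul, norm_mul, norm_neg_ofReal_zpow hq0, norm_ofReal_zpow hq0, ← mul_assoc,
    ← zpow_add₀ hq0.ne', show (-(n : ℤ) - 1 + (2 * n + i + 1)) = i + n by ring,
    zpow_add₀ hq0.ne', zpow_natCast, mul_right_comm]
  exact mul_le_mul_of_nonneg_right (mul_le_mul_of_nonneg_left (hC _) (zpow_pos hq0 _).le)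
    (pow_nonneg hq0.le _)

theorem exists_hasBoundaryValues_of_bounded (hq0 : 0 < q) (hq1 : q < 1) {ψ : ℤ → ℂ} {C : ℝ}
    (hC : ∀ n, ‖jacobiExpr q ψ n‖ ≤ C) : ∃ a b, HasBoundaryValues q ψ a b := by
  obtain ⟨a, ha⟩ := exists_tendsto_of_jacobiExpr_bounded hq0 hq1 hC 0
  obtain ⟨b, hb⟩ := exists_tendsto_of_jacobiExpr_bounded hq0 hq1 hC 1
  simp only [add_zero] at ha
  exact ⟨a, b, ha, hb⟩

theorem exists_hasBoundaryValues (hq0 : 0 < q) (hq1 : q < 1) {ψ : EllTwo}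
    (hψ : ψ ∈ maxDomain q) : ∃ a b, HasBoundaryValues q ψ a b :=
  exists_hasBoundaryValues_of_bounded hq0 hq1 (C := ‖(⟨jacobiExpr q ψ, hψ⟩ : EllTwo)‖)
    fun n => lp.norm_apply_le_norm two_ne_zero (⟨jacobiExpr q ψ, hψ⟩ : EllTwo) n

/-- Boundary conditions carry powers of `q`, boundary values powers of `-q`; for limits equal to
zero the sign is immaterial. -/
theorem tendsto_zero_iff_of_norm_eq {f g : ℤ → ℂ} (h : ∀ n, ‖f n‖ = ‖g n‖) :
    Tendsto f atTop (𝓝 0) ↔ Tendsto g atTop (𝓝 0) := by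
  rw [tendsto_zero_iff_norm_tendsto_zero, tendsto_zero_iff_norm_tendsto_zero (f := g)]
  simp only [h]

theorem norm_zpow_mul_eq (hq0 : 0 < q) (n : ℤ) (z : ℂ) :
    ‖(q : ℂ) ^ n * z‖ = ‖(-q : ℂ) ^ n * z‖ := by
  rw [norm_mul, norm_mul, norm_neg_ofReal_zpow hq0, norm_ofReal_zpow hq0]

theorem boundaryCond_infty_iff (hq0 : 0 < q) {ψ : ℤ → ℂ} {a b : ℂ}
    (h : HasBoundaryValues q ψ a b) : BoundaryCond q ψ OnePoint.infty ↔ a = 0 := by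
  have e : BoundaryCond q ψ OnePoint.infty ↔
      Tendsto (fun n : ℤ => (-q : ℂ) ^ (-n) * ψ (2 * n)) atTop (𝓝 0) :=
    tendsto_zero_iff_of_norm_eq fun n => norm_zpow_mul_eq hq0 _ _
  rw [e]
  exact ⟨fun h0 => tendsto_nhds_unique h.1 h0, fun ha => ha ▸ h.1⟩

/-- Up to signs the two limits in the condition are `b + t a` and `-(b + t a)`, the second after
shifting `n` by one; they vanish together. -/
theorem boundaryCond_coe_iff (hq0 : 0 < q) {ψ : ℤ → ℂ} {a b : ℂ}
    (h : HasBoundaryValues q ψ a b) (t : ℝ) :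
    BoundaryCond q ψ (OnePoint.some t) ↔ b + t * a = 0 := by
  have hq : (-q : ℂ) ≠ 0 := neg_ne_zero.mpr (by exact_mod_cast hq0.ne')
  have h1 : Tendsto (fun n : ℤ => (-q : ℂ) ^ (-n) * (ψ (2 * n + 1) + t * ψ (2 * n))) atTop
      (𝓝 (b + t * a)) :=
    (h.2.add (h.1.const_mul (t : ℂ))).congr fun n => by ring
  have h2 : Tendsto (fun n : ℤ => (-q : ℂ) ^ (-n) * (q * ψ (2 * n - 1) - t * ψ (2 * n))) atTop
      (𝓝 (-(b + t * a))) := by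
    have h3 := h.2.comp (tendsto_atTop_add_const_right atTop (-1 : ℤ) tendsto_id)
    rw [neg_add']
    refine (h3.neg.sub (h.1.const_mul (t : ℂ))).congr fun n => ?_
    simp only [Function.comp_apply, id_eq]
    rw [show 2 * (n + -1) + 1 = 2 * n - 1 by ring, show -(n + -1) = -n + 1 by ring,
      zpow_add_one₀ hq]
    ring
  have e : BoundaryCond q ψ (OnePoint.some t) ↔
      Tendsto (fun n : ℤ => (-q : ℂ) ^ (-n) * (ψ (2 * n + 1) + t * ψ (2 * n))) atTop (𝓝 0) ∧
      Tendsto (fun n : ℤ => (-q : ℂ) ^ (-n) * (q * ψ (2 * n - 1) - t * ψ (2 * n))) atTop (𝓝 0) :=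
    and_congr (tendsto_zero_iff_of_norm_eq fun n => norm_zpow_mul_eq hq0 _ _)
      (tendsto_zero_iff_of_norm_eq fun n => norm_zpow_mul_eq hq0 _ _)
  rw [e]
  refine ⟨fun h0 => tendsto_nhds_unique h1 h0.1, fun h0 => ?_⟩
  rw [h0] at h1 h2
  rw [neg_zero] at h2
  exact ⟨h1, h2⟩

theorem sum_Ioc_neg_telescope (W : ℤ → ℂ) (n : ℕ) :
    ∑ k ∈ Finset.Ioc (-(n : ℤ)) n, (W k - W (k - 1)) = W n - W (-n) := by
  induction n with
  | zero => simp
  | succ n ih =>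
    have h : Finset.Ioc (-((n + 1 : ℕ) : ℤ)) ((n + 1 : ℕ) : ℤ) =
        insert (-(n : ℤ)) (insert ((n : ℤ) + 1) (Finset.Ioc (-(n : ℤ)) n)) := by
      ext k
      simp only [Finset.mem_Ioc, Finset.mem_insert]
      push_cast
      omega
    rw [h, Finset.sum_insert (by simp; omega), Finset.sum_insert (by simp), ih]
    push_cast
    rw [show (n : ℤ) + 1 - 1 = n by ring, show -(n : ℤ) - 1 = -1 + -n by ring,
      show -((n : ℤ) + 1) = -1 + -n by ring]
    ring

/-- Green's formula for the Jacobi matrix: only the boundary values at `+∞` contribute. -/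
theorem inner_sub_inner_eq (hq0 : 0 < q) (hq1 : q < 1) {ψ χ φ η : EllTwo}
    (hφ : ∀ n, φ n = jacobiExpr q ψ n) (hη : ∀ n, η n = jacobiExpr q χ n) {a b c d : ℂ}
    (hψ : HasBoundaryValues q ψ a b) (hχ : HasBoundaryValues q χ c d) :
    inner ℂ φ χ - inner ℂ ψ η = star b * c - star a * d := by
  have hq : (-q : ℂ) ≠ 0 := neg_ne_zero.mpr (by exact_mod_cast hq0.ne')
  -- The discrete Wronskian whose increments are the summands of the difference of inner products.
  set W : ℤ → ℂ := fun n => (q : ℂ) ^ (-n) * (star (ψ (n + 1)) * χ n - star (ψ n) * χ (n + 1))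
    with hW
  have hpt : ∀ n, W n - W (n - 1) = inner ℂ (φ n) (χ n) - inner ℂ (ψ n) (η n) := fun n => by
    simp only [hW, RCLike.inner_apply, hφ, hη, jacobiExpr, map_add, map_mul, map_zpow₀,
      Complex.conj_ofReal]
    rw [show n - 1 + 1 = n by ring, show -(n - 1) = -n + 1 by ring]
    simp only [starRingEnd_apply]
    ring
  have hsum : HasSum (fun n : ℤ => W n - W (n - 1)) (inner ℂ φ χ - inner ℂ ψ η) := by
    simp only [hpt]
    exact HasSum.sub (lp.hasSum_inner φ χ) (lp.hasSum_inner ψ η)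
  -- Even cut-offs suffice, and there the weight splits as `q ^ (-2n) = (-q) ^ (-n) * (-q) ^ (-n)`,
  -- one factor for each sequence.
  have hseq : Tendsto (fun n : ℕ => W ((2 * n : ℕ) : ℤ) - W (-((2 * n : ℕ) : ℤ))) atTop
      (𝓝 (inner ℂ φ χ - inner ℂ ψ η)) := by
    have hF : Tendsto (fun n : ℕ => Finset.Ioc (-((2 * n : ℕ) : ℤ)) ((2 * n : ℕ) : ℤ)) atTop atTop :=
      Finset.tendsto_Ioc_neg.comp (tendsto_id.const_mul_atTop' (by norm_num))
    exact (hsum.comp hF).congr fun n => sum_Ioc_neg_telescope W (2 * n)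
  have hplus : Tendsto (fun n : ℕ => W ((2 * n : ℕ) : ℤ)) atTop (𝓝 (star b * c - star a * d)) := by
    have hstar : ∀ {f : ℤ → ℂ} {x : ℂ}, Tendsto f atTop (𝓝 x) →
        Tendsto (fun n => star (f n)) atTop (𝓝 (star x)) := fun h =>
      (continuous_star.tendsto _).comp h
    have h := ((hstar hψ.2).mul hχ.1).sub ((hstar hψ.1).mul hχ.2)
    rw [tendsto_int_atTop_iff] at h
    refine h.congr fun n => ?_
    simp only [hW, star_mul', star_zpow₀, star_neg]
    rw [show star (q : ℂ) = q from Complex.conj_ofReal q]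
    have e : (q : ℂ) ^ (-((2 * n : ℕ) : ℤ)) = (-q : ℂ) ^ (-(n : ℤ)) * (-q : ℂ) ^ (-(n : ℤ)) := by
      rw [← mul_zpow, neg_mul_neg, show (-((2 * n : ℕ) : ℤ)) = 2 * (-n) by push_cast; ring,
        zpow_mul, ← sq]
      rfl
    rw [e]
    push_cast
    ring
  -- At `-∞` the weight is `q ^ (2n)` and the sequences are bounded.
  have hminus : Tendsto (fun n : ℕ => W (-((2 * n : ℕ) : ℤ))) atTop (𝓝 0) := by
    have hgeo : Tendsto (fun n : ℕ => q ^ (2 * n) * (2 * (‖ψ‖ * ‖χ‖))) atTop (𝓝 0) := by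
      have := ((tendsto_pow_atTop_nhds_zero_of_lt_one hq0.le hq1).comp
        (tendsto_id.const_mul_atTop' (r := 2) (by norm_num))).mul_const (2 * (‖ψ‖ * ‖χ‖))
      rwa [zero_mul] at this
    refine squeeze_zero_norm (fun n => ?_) hgeo
    simp only [hW]
    rw [norm_mul, neg_neg, norm_ofReal_zpow hq0, zpow_natCast]
    refine mul_le_mul_of_nonneg_left ((norm_sub_le _ _).trans ?_) (pow_nonneg hq0.le _)
    rw [norm_mul, norm_mul, norm_star, norm_star, two_mul (‖ψ‖ * ‖χ‖)]
    have b1 := fun i : ℤ => lp.norm_apply_le_norm two_ne_zero ψ i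
    have b2 := fun i : ℤ => lp.norm_apply_le_norm two_ne_zero χ i
    exact add_le_add (mul_le_mul (b1 _) (b2 _) (norm_nonneg _) (norm_nonneg _))
      (mul_le_mul (b1 _) (b2 _) (norm_nonneg _) (norm_nonneg _))
  have h := hplus.sub hminus
  rw [sub_zero] at h
  exact tendsto_nhds_unique hseq h

theorem memℓp_two_of_bound (hq0 : 0 < q) (hq1 : q < 1) {ψ : ℤ → ℂ} {K : ℝ}
    (h0 : ∀ n : ℤ, ‖ψ (2 * n)‖ ≤ K * q ^ n.natAbs)
    (h1 : ∀ n : ℤ, ‖ψ (2 * n + 1)‖ ≤ K * q ^ n.natAbs) : Memℓp ψ 2 := by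
  refine memℓp_gen ?_
  -- The factor `q⁻¹` absorbs the offset in `|n| ≤ 2|m| + 1` when `n` is `2m` or `2m + 1`.
  have hsum : Summable fun n : ℤ => K ^ 2 * q⁻¹ * q ^ n.natAbs := by
    refine Summable.mul_left _ (Summable.of_nat_of_neg ?_ ?_)
    · simpa using summable_geometric_of_lt_one hq0.le hq1
    · simpa using summable_geometric_of_lt_one hq0.le hq1
  refine Summable.of_nonneg_of_le (fun n => by positivity) (fun n => ?_) hsum
  rw [ENNReal.toReal_ofNat, Real.rpow_ofNat]
  have key : ∀ m : ℤ, n.natAbs ≤ 2 * m.natAbs + 1 → ‖ψ n‖ ≤ K * q ^ m.natAbs →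
      ‖ψ n‖ ^ 2 ≤ K ^ 2 * q⁻¹ * q ^ n.natAbs := by
    intro m hm hb
    calc ‖ψ n‖ ^ 2 ≤ (K * q ^ m.natAbs) ^ 2 := pow_le_pow_left₀ (norm_nonneg _) hb 2
      _ = K ^ 2 * q⁻¹ * q ^ (2 * m.natAbs + 1) := by
        rw [pow_succ q (2 * m.natAbs), pow_mul']
        field_simp
      _ ≤ K ^ 2 * q⁻¹ * q ^ n.natAbs :=
        mul_le_mul_of_nonneg_left (pow_le_pow_of_le_one hq0.le hq1.le hm) (by positivity)
  rcases Int.even_or_odd' n with ⟨m, rfl | rfl⟩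
  · exact key m (by omega) (h0 m)
  · exact key m (by omega) (h1 m)

/-- Arbitrary boundary values are attained in the maximal domain. -/
theorem exists_mem_maxDomain_hasBoundaryValues (hq0 : 0 < q) (hq1 : q < 1) (a b : ℂ) :
    ∃ ψ ∈ maxDomain q, HasBoundaryValues q ψ a b := by
  have hq : (q : ℂ) ≠ 0 := by exact_mod_cast hq0.ne'
  have hq' : (-q : ℂ) ≠ 0 := neg_ne_zero.mpr hq
  -- A null solution of the Jacobi expression cut off below `0`, so that the expression survives
  -- only at the indices `0` and `-1`.
  set f : ℤ → ℂ := fun n => if n < 0 then 0 else (if n % 2 = 0 then a else b) * (-q : ℂ) ^ (n / 2)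
    with hf
  have hf0 : ∀ n : ℤ, f (2 * n) = if n < 0 then 0 else a * (-q : ℂ) ^ n := by
    intro n
    simp only [hf]
    rw [if_pos (show 2 * n % 2 = 0 by omega), show 2 * n / 2 = n by omega]
    exact if_congr (by omega) rfl rfl
  have hf1 : ∀ n : ℤ, f (2 * n + 1) = if n < 0 then 0 else b * (-q : ℂ) ^ n := by
    intro n
    simp only [hf]
    rw [if_neg (show ¬ (2 * n + 1) % 2 = 0 by omega), show (2 * n + 1) / 2 = n by omega]
    exact if_congr (by omega) rfl rfl
  have hbound : ∀ (n : ℤ) (c : ℂ), ‖c‖ ≤ ‖a‖ + ‖b‖ →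
      ‖if n < 0 then 0 else c * (-q : ℂ) ^ n‖ ≤ (‖a‖ + ‖b‖) * q ^ n.natAbs := by
    intro n c hc
    split_ifs with h
    · rw [norm_zero]; positivity
    · obtain ⟨m, rfl⟩ := Int.eq_ofNat_of_zero_le (not_lt.mp h)
      rw [norm_mul, norm_neg_ofReal_zpow hq0, zpow_natCast, Int.natAbs_natCast]
      exact mul_le_mul_of_nonneg_right hc (by positivity)
  have ha : ‖a‖ ≤ ‖a‖ + ‖b‖ := le_add_of_nonneg_right (norm_nonneg _)
  have hb : ‖b‖ ≤ ‖a‖ + ‖b‖ := le_add_of_nonneg_left (norm_nonneg _)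
  have hmem : Memℓp f 2 := memℓp_two_of_bound hq0 hq1 (K := ‖a‖ + ‖b‖)
    (fun n => by rw [hf0]; exact hbound n a ha) (fun n => by rw [hf1]; exact hbound n b hb)
  have hj0 : ∀ n : ℤ, jacobiExpr q f (2 * n) = if n = 0 then b else 0 := by
    intro n
    rw [jacobiExpr, show 2 * n - 1 = 2 * (n - 1) + 1 by ring, hf1, hf1]
    rcases lt_trichotomy n 0 with h | rfl | h
    · rw [if_pos (by omega), if_pos h, if_neg (by omega)]; simp
    · simp
    · rw [if_neg (by omega), if_neg (by omega), if_neg (by omega), zpow_sub_one₀ hq',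
        zpow_add_one₀ hq]
      field_simp
      ring
  have hj1 : ∀ n : ℤ, jacobiExpr q f (2 * n + 1) = if n = -1 then q * a else 0 := by
    intro n
    rw [jacobiExpr, show 2 * n + 1 - 1 = 2 * n by ring, show 2 * n + 1 + 1 = 2 * (n + 1) by ring,
      hf0, hf0]
    rcases lt_trichotomy n (-1) with h | rfl | h
    · rw [if_pos (by omega), if_pos (by omega), if_neg (by omega)]; simp
    · simp
    · rw [if_neg (by omega), if_neg (by omega), if_neg (by omega), zpow_add_one₀ hq',
        zpow_add_one₀ hq, show -(2 * n + 1) = -(2 * n) - 1 by ring, zpow_sub_one₀ hq]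
      field_simp
      ring
  have hjmem : Memℓp (jacobiExpr q f) 2 := by
    refine memℓp_two_of_bound hq0 hq1 (K := (‖a‖ + ‖b‖) * q⁻¹) (fun n => ?_) fun n => ?_
    · rw [hj0]
      split_ifs with h
      · subst h
        simp only [Int.natAbs_zero, pow_zero, mul_one]
        exact hb.trans (le_mul_of_one_le_right (by positivity) (one_le_inv₀ hq0 |>.mpr hq1.le))
      · rw [norm_zero]; positivity
    · rw [hj1]
      split_ifs with h
      · subst h
        rw [show (-1 : ℤ).natAbs = 1 from rfl, pow_one, inv_mul_cancel_right₀ hq0.ne', norm_mul,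
          Complex.norm_real, Real.norm_of_nonneg hq0.le]
        exact (mul_le_of_le_one_left (norm_nonneg _) hq1.le).trans ha
      · rw [norm_zero]; positivity
  refine ⟨⟨f, hmem⟩, hjmem, ?_, ?_⟩
  · refine tendsto_const_nhds.congr' ?_
    filter_upwards [eventually_ge_atTop (0 : ℤ)] with n hn
    rw [hf0, if_neg (by omega), zpow_neg, mul_left_comm, inv_mul_cancel₀ (zpow_ne_zero _ hq'),
      mul_one]
  · refine tendsto_const_nhds.congr' ?_
    filter_upwards [eventually_ge_atTop (0 : ℤ)] with n hn
    rw [hf1, if_neg (by omega), zpow_neg, mul_left_comm, inv_mul_cancel₀ (zpow_ne_zero _ hq'),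
      mul_one]

end BoundaryValues

/-! ### Classification of the self-adjoint extensions -/

section SelfAdjointExtensions

variable {q : ℝ}

theorem dense_span_basisVec : Dense (Submodule.span ℂ (range basisVec) : Set EllTwo) := by
  rw [Submodule.dense_iff_topologicalClosure_eq_top, Submodule.topologicalClosure_eq_top_iff,
    Submodule.eq_bot_iff]
  intro x hx
  refine lp.ext (funext fun n => ?_)
  have h := (Submodule.mem_orthogonal _ _).mp hx (basisVec n)
    (Submodule.subset_span (mem_range_self n))
  rw [basisVec, lp.inner_single_left] at h
  simpa using h

theorem dense_of_Amin_le {T : EllTwo →ₗ.[ℂ] EllTwo} (h : Amin q ≤ T) :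
    Dense (T.domain : Set EllTwo) :=
  dense_span_basisVec.mono ((Amin_domain q).symm.le.trans h.1)

/-- A formal adjoint of an extension of `A` acts as the Jacobi matrix. -/
theorem le_Amax_of_isFormalAdjoint {T S : EllTwo →ₗ.[ℂ] EllTwo} (h : Amin q ≤ T)
    (hS : S.IsFormalAdjoint T) : S ≤ Amax q := by
  have key : ∀ (y : S.domain) (n : ℤ), S y n = jacobiExpr q (y : EllTwo) n := by
    intro y n
    have hn : basisVec n ∈ (Amin q).domain := by
      rw [Amin_domain]; exact Submodule.subset_span (mem_range_self n)
    have h1 := hS y ⟨basisVec n, h.1 hn⟩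
    rw [← h.2 (x := ⟨basisVec n, hn⟩) rfl, Amin_basisVec, inner_add_right, inner_smul_right,
      inner_smul_right] at h1
    simp only [basisVec, lp.inner_single_right, RCLike.inner_apply, one_mul] at h1
    have h2 := congrArg (starRingEnd ℂ) h1
    simp only [map_add, map_mul, map_zpow₀, Complex.conj_ofReal, Complex.conj_conj] at h2
    exact h2
  have hmem : ∀ y : S.domain, (y : EllTwo) ∈ maxDomain q := by
    intro y
    have : jacobiExpr q (y : EllTwo) = S y := funext fun n => (key y n).symm
    change Memℓp (jacobiExpr q (y : EllTwo)) 2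
    rw [this]
    exact lp.memℓp _
  refine ⟨fun y hy => hmem ⟨y, hy⟩, ?_⟩
  rintro ⟨x, hx⟩ ⟨y, hy⟩ rfl
  exact lp.ext (funext fun n => key ⟨x, hx⟩ n)

theorem mem_At_domain {t : OnePoint ℝ} {ψ : EllTwo} :
    ψ ∈ (At q t).domain ↔ BoundaryCond q ψ t ∧ ψ ∈ maxDomain q := Iff.rfl

theorem At_apply {t : OnePoint ℝ} (ψ : (At q t).domain) (n : ℤ) :
    At q t ψ n = jacobiExpr q (ψ : EllTwo) n := rfl

theorem hasBoundaryValues_basisVec (k : ℤ) : HasBoundaryValues q (basisVec k) 0 0 := by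
  constructor
  · refine tendsto_const_nhds.congr' ?_
    filter_upwards [eventually_gt_atTop |k|] with n hn
    have := le_abs_self k
    have h : 2 * n ≠ k := by have := abs_nonneg k; omega
    simp [basisVec, h]
  · refine tendsto_const_nhds.congr' ?_
    filter_upwards [eventually_gt_atTop |k|] with n hn
    have := le_abs_self k
    have h : 2 * n + 1 ≠ k := by have := abs_nonneg k; omega
    simp [basisVec, h]

theorem Amin_le_At (hq0 : 0 < q) (t : OnePoint ℝ) : Amin q ≤ At q t := by
  refine ⟨?_, ?_⟩
  · rw [Amin_domain, Submodule.span_le]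
    rintro _ ⟨k, rfl⟩
    refine mem_At_domain.mpr ⟨?_, basisVec_mem_maxDomain q k⟩
    induction t using OnePoint.rec with
    | infty => exact (boundaryCond_infty_iff hq0 (hasBoundaryValues_basisVec k)).mpr rfl
    | coe t =>
      exact (boundaryCond_coe_iff hq0 (hasBoundaryValues_basisVec k) t).mpr (by simp)
  · rintro ⟨x, hx⟩ ⟨y, hy⟩ rfl
    rfl

/-- Two pairs of boundary values that satisfy the same boundary condition annihilate the boundary
form. -/
theorem boundary_form_eq_zero (hq0 : 0 < q) {t : OnePoint ℝ} {ψ χ : ℤ → ℂ} {a b c d : ℂ}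
    (hψ : HasBoundaryValues q ψ a b) (hχ : HasBoundaryValues q χ c d)
    (h₁ : BoundaryCond q ψ t) (h₂ : BoundaryCond q χ t) : star b * c - star a * d = 0 := by
  induction t using OnePoint.rec with
  | infty =>
    rw [(boundaryCond_infty_iff hq0 hψ).mp h₁, (boundaryCond_infty_iff hq0 hχ).mp h₂]
    simp
  | coe t =>
    have e1 := (boundaryCond_coe_iff hq0 hψ t).mp h₁
    have e2 := (boundaryCond_coe_iff hq0 hχ t).mp h₂
    have e3 := congrArg star e1
    rw [star_add, star_mul', star_zero, show star (t : ℂ) = t from Complex.conj_ofReal t] at e3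
    linear_combination c * e3 - star a * e2

theorem At_isFormalAdjoint (hq0 : 0 < q) (hq1 : q < 1) (t : OnePoint ℝ) :
    (At q t).IsFormalAdjoint (At q t) := by
  intro x y
  obtain ⟨a, b, hab⟩ := exists_hasBoundaryValues hq0 hq1 x.2.2
  obtain ⟨c, d, hcd⟩ := exists_hasBoundaryValues hq0 hq1 y.2.2
  have h := inner_sub_inner_eq hq0 hq1 (φ := At q t x) (η := At q t y) (fun n => At_apply x n)
    (fun n => At_apply y n) hab hcd
  rw [boundary_form_eq_zero hq0 hab hcd x.2.1 y.2.1] at h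
  exact sub_eq_zero.mp h

/-- One vector of the domain suffices as a test: its boundary pair, `(0, 1)` or `(1, -t)`, spans the
line, and the line is its own annihilator for the boundary form. -/
theorem exists_mem_At_domain (hq0 : 0 < q) (hq1 : q < 1) (t : OnePoint ℝ) :
    ∃ ψ ∈ (At q t).domain, ∃ a b : ℂ, HasBoundaryValues q ψ a b ∧
      ∀ (χ : ℤ → ℂ) (c d : ℂ), HasBoundaryValues q χ c d → star a * d - star b * c = 0 →
        BoundaryCond q χ t := by
  induction t using OnePoint.rec with
  | infty =>
    obtain ⟨ψ, hψ, h⟩ := exists_mem_maxDomain_hasBoundaryValues hq0 hq1 0 1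
    refine ⟨ψ, ⟨(boundaryCond_infty_iff hq0 h).mpr rfl, hψ⟩, 0, 1, h, fun χ c d hχ he => ?_⟩
    refine (boundaryCond_infty_iff hq0 hχ).mpr ?_
    simpa using he
  | coe t =>
    obtain ⟨ψ, hψ, h⟩ := exists_mem_maxDomain_hasBoundaryValues hq0 hq1 1 (-t)
    refine ⟨ψ, ⟨(boundaryCond_coe_iff hq0 h t).mpr (by ring), hψ⟩, 1, -t, h,
      fun χ c d hχ he => ?_⟩
    refine (boundaryCond_coe_iff hq0 hχ t).mpr ?_
    rw [star_one, star_neg, show star (t : ℂ) = t from Complex.conj_ofReal t] at he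
    linear_combination he

/-- The adjoint also acts as the Jacobi matrix, and Green's formula against the test vector forces
the boundary condition on its domain. -/
theorem isSelfAdjoint_At (hq0 : 0 < q) (hq1 : q < 1) (t : OnePoint ℝ) :
    IsSelfAdjoint (At q t) := by
  have hdense := dense_of_Amin_le (Amin_le_At hq0 t)
  rw [LinearPMap.isSelfAdjoint_def]
  refine le_antisymm ?_ (LinearPMap.IsFormalAdjoint.le_adjoint hdense
    (At_isFormalAdjoint hq0 hq1 t))
  have hadj := LinearPMap.adjoint_isFormalAdjoint hdense
  have hle := le_Amax_of_isFormalAdjoint (Amin_le_At hq0 t) hadj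
  have hval : ∀ (y : (At q t).adjoint.domain) (n : ℤ),
      (At q t).adjoint y n = jacobiExpr q (y : EllTwo) n := fun y n => by
    rw [hle.2 (x := y) (y := ⟨y, hle.1 y.2⟩) rfl]; rfl
  refine ⟨fun y hy => ⟨?_, hle.1 hy⟩, ?_⟩
  · obtain ⟨ψ, hψ, a, b, hab, hχ⟩ := exists_mem_At_domain hq0 hq1 t
    obtain ⟨c, d, hcd⟩ := exists_hasBoundaryValues hq0 hq1 (hle.1 hy)
    refine hχ y c d hcd ?_
    have h1 := inner_sub_inner_eq hq0 hq1 (φ := At q t ⟨ψ, hψ⟩) (η := (At q t).adjoint ⟨y, hy⟩)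
      (fun n => At_apply _ n) (fun n => hval _ n) hab hcd
    have h2 := hadj.symm ⟨ψ, hψ⟩ ⟨y, hy⟩
    rw [h2, sub_self] at h1
    linear_combination h1
  · rintro ⟨x, hx⟩ ⟨y, hy⟩ rfl
    exact lp.ext (funext fun n => hval ⟨x, hx⟩ n)

/-- Symmetry makes the boundary form vanish on the domain. If some vector has `a ≠ 0`, pairing it
with itself shows that `b / a` is real, and pairing it with the others puts them on the same line,
`t = -b / a`. -/
theorem exists_le_At_of_isFormalAdjoint (hq0 : 0 < q) (hq1 : q < 1)
    {T : EllTwo →ₗ.[ℂ] EllTwo} (hle : T ≤ Amax q) (hT : T.IsFormalAdjoint T) :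
    ∃ t : OnePoint ℝ, T ≤ At q t := by
  have hval : ∀ (y : T.domain) (n : ℤ), T y n = jacobiExpr q (y : EllTwo) n := fun y n => by
    rw [hle.2 (x := y) (y := ⟨y, hle.1 y.2⟩) rfl]; rfl
  have hform : ∀ (x y : T.domain) (a b c d : ℂ), HasBoundaryValues q (x : EllTwo) a b →
      HasBoundaryValues q (y : EllTwo) c d → star b * c = star a * d := by
    intro x y a b c d hab hcd
    have h1 := inner_sub_inner_eq hq0 hq1 (hval x) (hval y) hab hcd
    rw [hT x y, sub_self] at h1
    exact (sub_eq_zero.mp h1.symm)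
  have hfinish : ∀ t : OnePoint ℝ, (∀ y : T.domain, BoundaryCond q (y : EllTwo) t) →
      T ≤ At q t := by
    intro t ht
    refine ⟨fun y hy => ⟨ht ⟨y, hy⟩, hle.1 hy⟩, ?_⟩
    rintro ⟨x, hx⟩ ⟨y, hy⟩ rfl
    exact lp.ext (funext fun n => hval ⟨x, hx⟩ n)
  by_cases hall : ∀ y : T.domain, BoundaryCond q (y : EllTwo) OnePoint.infty
  · exact ⟨OnePoint.infty, hfinish _ hall⟩
  · push Not at hall
    obtain ⟨x, hx⟩ := hall
    obtain ⟨a, b, hab⟩ := exists_hasBoundaryValues hq0 hq1 (hle.1 x.2)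
    have ha : a ≠ 0 := fun h => hx ((boundaryCond_infty_iff hq0 hab).mpr h)
    have hself := hform x x a b a b hab hab
    have hsa : star a ≠ 0 := star_ne_zero.mpr ha
    have hreal : star (b / a) = b / a := by
      rw [star_div₀, div_eq_div_iff hsa ha, hself, mul_comm]
    obtain ⟨t, ht⟩ : ∃ t : ℝ, ((t : ℝ) : ℂ) = -(b / a) := by
      obtain ⟨u, hu⟩ := Complex.conj_eq_iff_real.mp hreal
      exact ⟨-u, by rw [hu]; push_cast; rfl⟩
    refine ⟨OnePoint.some t, hfinish _ fun y => ?_⟩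
    obtain ⟨c, d, hcd⟩ := exists_hasBoundaryValues hq0 hq1 (hle.1 y.2)
    refine (boundaryCond_coe_iff hq0 hcd t).mpr ?_
    have h := hform x y a b c d hab hcd
    rw [ht]
    refine mul_left_cancel₀ hsa ?_
    rw [← hreal, star_div₀]
    field_simp
    linear_combination -h

/-- The operators `A_t` are precisely the self-adjoint extensions of `A`. -/
theorem selfAdjoint_extension_iff (hq0 : 0 < q) (hq1 : q < 1) (T : EllTwo →ₗ.[ℂ] EllTwo) :
    (Amin q ≤ T ∧ IsSelfAdjoint T) ↔ ∃ t : OnePoint ℝ, T = At q t := by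
  constructor
  · rintro ⟨hA, hT⟩
    have hdense := dense_of_Amin_le hA
    have hadj : T.IsFormalAdjoint T := by
      have := LinearPMap.adjoint_isFormalAdjoint hdense
      rwa [LinearPMap.isSelfAdjoint_def.mp hT] at this
    obtain ⟨t, ht⟩ := exists_le_At_of_isFormalAdjoint hq0 hq1
      (le_Amax_of_isFormalAdjoint hA hadj) hadj
    refine ⟨t, le_antisymm ht ?_⟩
    -- A self-adjoint operator has no proper symmetric extension.
    have hform : T.IsFormalAdjoint (At q t) := fun x y => by
      rw [ht.2 (x := x) (y := ⟨x, ht.1 x.2⟩) rfl]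
      exact At_isFormalAdjoint hq0 hq1 t _ y
    have := LinearPMap.IsFormalAdjoint.le_adjoint hdense hform
    rwa [LinearPMap.isSelfAdjoint_def.mp hT] at this
  · rintro ⟨t, rfl⟩
    exact ⟨Amin_le_At hq0 t, isSelfAdjoint_At hq0 hq1 t⟩

end SelfAdjointExtensions

/-! ### Partial theta sums -/

/-- The sequence of partial theta sums which make up the eigenvectors. -/
noncomputable def partialTheta (r y : ℝ) (n : ℤ) : ℝ :=
  ∑' j : ℤ, r ^ (j ^ 2) * y ^ j * invPoch r (n - j)

section PartialTheta

variable {r : ℝ}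

theorem exists_norm_invPoch_le (hr0 : 0 < r) (hr1 : r < 1) :
    ∃ K, 0 ≤ K ∧ ∀ n, ‖invPoch r n‖ ≤ K := by
  obtain ⟨K, hK⟩ := exists_invPoch_le hr0 hr1
  refine ⟨K, (invPoch_nonneg hr0 hr1 0).trans (hK 0), fun n => ?_⟩
  rw [Real.norm_of_nonneg (invPoch_nonneg hr0 hr1 n)]
  exact hK n

theorem summable_partialTheta (hr0 : 0 < r) (hr1 : r < 1) {y : ℝ} (hy : y ≠ 0) (n : ℤ) :
    Summable fun j : ℤ => r ^ (j ^ 2) * y ^ j * invPoch r (n - j) := by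
  obtain ⟨K, -, hK⟩ := exists_norm_invPoch_le hr0 hr1
  refine Summable.of_norm_bounded ((summable_thetaSeries hr0 hr1 hy).norm.mul_right K) fun j => ?_
  rw [norm_mul]
  exact mul_le_mul_of_nonneg_left (hK _) (norm_nonneg _)

theorem tendsto_partialTheta (hr0 : 0 < r) (hr1 : r < 1) {y : ℝ} (hy : y ≠ 0) :
    Tendsto (partialTheta r y) atTop (𝓝 ((qPochReal r r)⁻¹ * thetaSeries r y)) := by
  obtain ⟨K, -, hK⟩ := exists_norm_invPoch_le hr0 hr1
  have h := tendsto_tsum_of_dominated_convergence (𝓕 := (atTop : Filter ℤ))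
    (f := fun (n : ℤ) (j : ℤ) => r ^ (j ^ 2) * y ^ j * invPoch r (n - j))
    (g := fun j : ℤ => r ^ (j ^ 2) * y ^ j * (qPochReal r r)⁻¹)
    (bound := fun j : ℤ => ‖r ^ (j ^ 2) * y ^ j‖ * K)
    ((summable_thetaSeries hr0 hr1 hy).norm.mul_right K)
    (fun j => ((tendsto_invPoch hr0 hr1).comp (by
      simpa only [sub_eq_add_neg, id_eq] using
        tendsto_atTop_add_const_right atTop (-j) tendsto_id)).const_mul _)
    (Eventually.of_forall fun n j => by
      rw [norm_mul]
      exact mul_le_mul_of_nonneg_left (hK _) (norm_nonneg _))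
  rw [tsum_mul_right, ← thetaSeries, mul_comm] at h
  exact h

/-- The recursion for `invPoch` turns the difference of terms into a power `r ^ (n - j)`, absorbed
after the shift `j ↦ j + 1`. This and the companion relation below are the eigenvalue equation at
odd and at even indices. -/
theorem partialTheta_sub_add_one (hr0 : 0 < r) (hr1 : r < 1) {y : ℝ} (hy : y ≠ 0) (n : ℤ) :
    partialTheta r y n - partialTheta r y (n + 1) =
      -(y * r ^ (n + 1)) * partialTheta r (r * y) n := by
  rw [partialTheta, partialTheta, ← (summable_partialTheta hr0 hr1 hy n).tsum_sub
    (summable_partialTheta hr0 hr1 hy (n + 1)), partialTheta, ← tsum_mul_left,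
    ← (Equiv.addRight (1 : ℤ)).tsum_eq]
  refine tsum_congr fun j => ?_
  simp only [Equiv.coe_addRight]
  have h := invPoch_sub_one hr0 hr1 (n - j)
  rw [show n - (j + 1) = n - j - 1 by ring, h, show n + 1 - (j + 1) = n - j by ring,
    show (j + 1) ^ 2 = j ^ 2 + j + j + 1 by ring, zpow_add₀ hr0.ne', zpow_add₀ hr0.ne',
    zpow_add₀ hr0.ne', zpow_one, zpow_add_one₀ hy, mul_zpow, zpow_sub₀ hr0.ne',
    zpow_add_one₀ hr0.ne']
  field_simp
  ring

theorem partialTheta_sub_sub_one (hr0 : 0 < r) (hr1 : r < 1) {y : ℝ} (hy : y ≠ 0) (n : ℤ) :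
    partialTheta r (r * y) n - partialTheta r (r * y) (n - 1) = r ^ n * partialTheta r y n := by
  have hry : r * y ≠ 0 := mul_ne_zero hr0.ne' hy
  rw [partialTheta, partialTheta, ← (summable_partialTheta hr0 hr1 hry n).tsum_sub
    (summable_partialTheta hr0 hr1 hry (n - 1)), partialTheta, ← tsum_mul_left]
  refine tsum_congr fun j => ?_
  have h := invPoch_sub_one hr0 hr1 (n - j)
  rw [show n - 1 - j = n - j - 1 by ring, h, mul_zpow, zpow_sub₀ hr0.ne']
  field_simp
  ring

theorem exists_norm_partialTheta_le (hr0 : 0 < r) (hr1 : r < 1) {y : ℝ} (hy : y ≠ 0) :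
    ∃ K, ∀ n : ℤ, ‖partialTheta r y n‖ ≤ K := by
  obtain ⟨K, -, hK⟩ := exists_norm_invPoch_le hr0 hr1
  refine ⟨∑' j : ℤ, ‖r ^ (j ^ 2) * y ^ j‖ * K, fun n => ?_⟩
  refine tsum_of_norm_bounded ((summable_thetaSeries hr0 hr1 hy).norm.mul_right K).hasSum
    fun j => ?_
  rw [norm_mul]
  exact mul_le_mul_of_nonneg_left (hK _) (norm_nonneg _)

/-- This gives decay at `-∞`: only indices `j ≤ n` contribute, where `r ^ n ≤ r ^ j`, and `r ^ j` is
absorbed into a theta series with argument `r y`. -/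
theorem exists_zpow_mul_norm_partialTheta_le (hr0 : 0 < r) (hr1 : r < 1) {y : ℝ} (hy : y ≠ 0) :
    ∃ K, ∀ n : ℤ, r ^ n * ‖partialTheta r y n‖ ≤ K := by
  obtain ⟨K, hK0, hK⟩ := exists_norm_invPoch_le hr0 hr1
  have hry : r * y ≠ 0 := mul_ne_zero hr0.ne' hy
  refine ⟨∑' j : ℤ, ‖r ^ (j ^ 2) * (r * y) ^ j‖ * K, fun n => ?_⟩
  rw [← Real.norm_of_nonneg (zpow_pos hr0 n).le, ← norm_mul, partialTheta, ← tsum_mul_left]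
  refine tsum_of_norm_bounded ((summable_thetaSeries hr0 hr1 hry).norm.mul_right K).hasSum
    fun j => ?_
  rcases lt_or_ge (n - j) 0 with h | h
  · rw [invPoch_of_neg h, mul_zero, mul_zero, norm_zero]
    positivity
  · rw [← mul_assoc, norm_mul]
    refine mul_le_mul ?_ (hK _) (norm_nonneg _) (norm_nonneg _)
    have h1 : r ^ n ≤ r ^ j := zpow_le_zpow_right_of_le_one₀ hr0 hr1.le (by omega)
    rw [mul_zpow, mul_left_comm (r ^ (j ^ 2)) (r ^ j), norm_mul (r ^ n), norm_mul (r ^ j),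
      Real.norm_of_nonneg (zpow_pos hr0 n).le, Real.norm_of_nonneg (zpow_pos hr0 j).le]
    exact mul_le_mul_of_nonneg_right h1 (norm_nonneg _)

end PartialTheta

/-! ### Eigenvectors and reduction to the boundary condition -/

/-- The solution of `𝒜 ψ = x ψ` that is square summable at `-∞`. -/
noncomputable def eigenSeq (q x : ℝ) (n : ℤ) : ℂ :=
  if n % 2 = 0 then (-q : ℂ) ^ (n / 2) * (partialTheta (q ^ 2) (-x ^ 2 / q ^ 2) (n / 2) : ℝ)
  else (-q : ℂ) ^ (n / 2) * (x * partialTheta (q ^ 2) (-x ^ 2) (n / 2) : ℝ)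

section Eigenvectors

variable {q : ℝ}

theorem eigenSeq_even (q x : ℝ) (n : ℤ) : eigenSeq q x (2 * n) =
    (-q : ℂ) ^ n * (partialTheta (q ^ 2) (-x ^ 2 / q ^ 2) n : ℝ) := by
  rw [eigenSeq, if_pos (by omega), show 2 * n / 2 = n by omega]

theorem eigenSeq_odd (q x : ℝ) (n : ℤ) : eigenSeq q x (2 * n + 1) =
    (-q : ℂ) ^ n * (x * partialTheta (q ^ 2) (-x ^ 2) n : ℝ) := by
  rw [eigenSeq, if_neg (by omega), show (2 * n + 1) / 2 = n by omega]

/-- With `y = -x² / q²` and `r = q²` one has `r y = -x²`, so the two parity classes are linked by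
the two relations for partial theta sums. -/
theorem jacobiExpr_eigenSeq (hq0 : 0 < q) (hq1 : q < 1) {x : ℝ} (hx : x ≠ 0) (n : ℤ) :
    jacobiExpr q (eigenSeq q x) n = x * eigenSeq q x n := by
  have hr0 : 0 < q ^ 2 := by positivity
  have hr1 : q ^ 2 < 1 := by nlinarith
  have hq : (q : ℂ) ≠ 0 := by exact_mod_cast hq0.ne'
  have hq' : (-q : ℂ) ≠ 0 := neg_ne_zero.mpr hq
  have hy : -x ^ 2 / q ^ 2 ≠ 0 := div_ne_zero (neg_ne_zero.mpr (pow_ne_zero 2 hx)) hr0.ne'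
  have hry : q ^ 2 * (-x ^ 2 / q ^ 2) = -x ^ 2 := by field_simp
  rcases Int.even_or_odd' n with ⟨m, rfl | rfl⟩
  · have h := partialTheta_sub_sub_one hr0 hr1 hy m
    rw [hry] at h
    have hC := congrArg (fun z : ℝ => (z : ℂ)) h
    push_cast at hC
    have e : ((q : ℂ) ^ 2) ^ m = (q : ℂ) ^ (2 * m) := by rw [zpow_mul]; rfl
    rw [e] at hC
    have hz : (q : ℂ) ^ (-(2 * m)) * (q : ℂ) ^ (2 * m) = 1 := by
      rw [← zpow_add₀ hq]; simp
    rw [jacobiExpr, show 2 * m - 1 = 2 * (m - 1) + 1 by ring, eigenSeq_odd, eigenSeq_odd,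
      eigenSeq_even, zpow_sub_one₀ hq', zpow_add_one₀ hq]
    push_cast
    generalize partialTheta (q ^ 2) (-x ^ 2 / q ^ 2) m = P at hC ⊢
    field_simp
    linear_combination ((q : ℂ) ^ (-(2 * m)) * x) * hC + (x * P : ℂ) * hz
  · have h := partialTheta_sub_add_one hr0 hr1 hy m
    rw [hry] at h
    have hC := congrArg (fun z : ℝ => (z : ℂ)) h
    push_cast at hC
    have e : ((q : ℂ) ^ 2) ^ (m + 1) = (q : ℂ) ^ (2 * m) * (q : ℂ) ^ 2 := by
      rw [zpow_add_one₀ (pow_ne_zero 2 hq), zpow_mul]; rfl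
    rw [e] at hC
    have hz : (q : ℂ) ^ (-(2 * m)) * (q : ℂ) ^ (2 * m) = 1 := by
      rw [← zpow_add₀ hq]; simp
    rw [jacobiExpr, show 2 * m + 1 - 1 = 2 * m by ring, show 2 * m + 1 + 1 = 2 * (m + 1) by ring,
      eigenSeq_even, eigenSeq_even, eigenSeq_odd, zpow_add_one₀ hq',
      show -(2 * m + 1) + 1 = -(2 * m) by ring, show -(2 * m + 1) = -(2 * m) - 1 by ring,
      zpow_sub_one₀ hq]
    push_cast
    field_simp at hC ⊢
    linear_combination ((q : ℂ) ^ (-(2 * m))) * hC +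
      (x ^ 2 * partialTheta (q ^ 2) (-x ^ 2) m : ℂ) * hz

/-- For `n ≥ 0` boundedness is enough; for `n < 0`, `q ^ n = (q²) ^ n q ^ |n|` and the decay at `-∞`
takes care of the first factor. -/
theorem exists_zpow_mul_partialTheta_le (hq0 : 0 < q) (hq1 : q < 1) {y : ℝ} (hy : y ≠ 0) :
    ∃ K, ∀ n : ℤ, q ^ n * ‖partialTheta (q ^ 2) y n‖ ≤ K * q ^ n.natAbs := by
  have hr0 : 0 < q ^ 2 := by positivity
  have hr1 : q ^ 2 < 1 := by nlinarith
  obtain ⟨K₁, h₁⟩ := exists_norm_partialTheta_le hr0 hr1 hy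
  obtain ⟨K₂, h₂⟩ := exists_zpow_mul_norm_partialTheta_le hr0 hr1 hy
  refine ⟨max K₁ K₂, fun n => ?_⟩
  rcases Int.natAbs_eq n with h | h
  · rw [h, Int.natAbs_natCast, zpow_natCast, mul_comm]
    exact mul_le_mul_of_nonneg_right ((h₁ _).trans (le_max_left _ _)) (by positivity)
  · have h3 := h₂ n
    have e : q ^ n = (q ^ 2) ^ n * q ^ n.natAbs := by
      rw [← zpow_natCast q n.natAbs, ← zpow_natCast q 2, ← zpow_mul, ← zpow_add₀ hq0.ne']
      congr 1
      omega
    rw [e, mul_right_comm]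
    exact mul_le_mul_of_nonneg_right (h3.trans (le_max_right _ _)) (by positivity)

theorem memℓp_eigenSeq (hq0 : 0 < q) (hq1 : q < 1) {x : ℝ} (hx : x ≠ 0) :
    Memℓp (eigenSeq q x) 2 := by
  have hx2 : -x ^ 2 ≠ 0 := neg_ne_zero.mpr (pow_ne_zero 2 hx)
  obtain ⟨K₁, h₁⟩ := exists_zpow_mul_partialTheta_le hq0 hq1
    (div_ne_zero hx2 (pow_ne_zero 2 hq0.ne'))
  obtain ⟨K₂, h₂⟩ := exists_zpow_mul_partialTheta_le hq0 hq1 hx2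
  refine memℓp_two_of_bound hq0 hq1 (K := max K₁ (|x| * K₂)) (fun n => ?_) fun n => ?_
  · rw [eigenSeq_even, norm_mul, norm_neg_ofReal_zpow hq0, Complex.norm_real]
    exact (h₁ n).trans (mul_le_mul_of_nonneg_right (le_max_left _ _) (by positivity))
  · rw [eigenSeq_odd, norm_mul, norm_neg_ofReal_zpow hq0, Complex.norm_real, norm_mul,
      mul_left_comm]
    refine (mul_le_mul_of_nonneg_left (h₂ n) (norm_nonneg x)).trans ?_
    rw [← mul_assoc]
    exact mul_le_mul_of_nonneg_right (le_max_right _ _) (by positivity)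

theorem hasBoundaryValues_eigenSeq (hq0 : 0 < q) (hq1 : q < 1) {x : ℝ} (hx : x ≠ 0) :
    HasBoundaryValues q (eigenSeq q x)
      (((qPochReal (q ^ 2) (q ^ 2))⁻¹ * thetaSeries (q ^ 2) (-x ^ 2 / q ^ 2) : ℝ) : ℂ)
      ((x * ((qPochReal (q ^ 2) (q ^ 2))⁻¹ * thetaSeries (q ^ 2) (-x ^ 2)) : ℝ) : ℂ) := by
  have hr0 : 0 < q ^ 2 := by positivity
  have hr1 : q ^ 2 < 1 := by nlinarith
  have hq' : (-q : ℂ) ≠ 0 := neg_ne_zero.mpr (by exact_mod_cast hq0.ne')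
  have hx2 : -x ^ 2 ≠ 0 := neg_ne_zero.mpr (pow_ne_zero 2 hx)
  have hz : ∀ n : ℤ, (-q : ℂ) ^ (-n) * (-q : ℂ) ^ n = 1 := fun n => by
    rw [← zpow_add₀ hq']; simp
  constructor
  · refine ((Complex.continuous_ofReal.tendsto _).comp
      (tendsto_partialTheta hr0 hr1 (div_ne_zero hx2 hr0.ne'))).congr fun n => ?_
    rw [eigenSeq_even, ← mul_assoc, hz, one_mul, Function.comp_apply]
  · refine ((Complex.continuous_ofReal.tendsto _).comp
      ((tendsto_partialTheta hr0 hr1 hx2).const_mul x)).congr fun n => ?_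
    rw [eigenSeq_odd, ← mul_assoc, hz, one_mul, Function.comp_apply]

theorem eq_zero_of_jacobiExpr_eq (hq0 : 0 < q) {ψ : ℤ → ℂ} {x : ℂ}
    (h : ∀ n, jacobiExpr q ψ n = x * ψ n) {k : ℤ} (h0 : ψ k = 0) (h1 : ψ (k + 1) = 0) (n : ℤ) :
    ψ n = 0 := by
  have hq : (q : ℂ) ≠ 0 := by exact_mod_cast hq0.ne'
  have key : ∀ n : ℤ, ψ n = 0 ∧ ψ (n + 1) = 0 := by
    intro n
    refine Int.inductionOn' n k ⟨h0, h1⟩ ?_ ?_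
    · rintro m - ⟨e0, e1⟩
      have := jacobiExpr_add_one hq0 ψ m
      rw [h, e0, e1, mul_zero, mul_zero, mul_zero, add_zero] at this
      exact ⟨e1, by rw [show m + 1 + 1 = m + 2 by ring, this]⟩
    · rintro m - ⟨e0, e1⟩
      have := jacobiExpr_add_one hq0 ψ (m - 1)
      rw [h, show m - 1 + 2 = m + 1 by ring, sub_add_cancel, e0, e1, mul_zero, mul_zero,
        zero_add] at this
      exact ⟨(mul_eq_zero.mp this).resolve_left hq, by rw [sub_add_cancel]; exact e0⟩
  exact (key n).1

/-- Two square summable solutions of the eigenvalue equation are linearly dependent. -/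
theorem wronskian_eq_zero (hq0 : 0 < q) (hq1 : q < 1) {ψ χ : EllTwo} {x : ℂ}
    (hψ : ∀ n, jacobiExpr q ψ n = x * ψ n) (hχ : ∀ n, jacobiExpr q χ n = x * χ n) (n : ℤ) :
    χ (n + 1) * ψ n - χ n * ψ (n + 1) = 0 := by
  have hq : (q : ℂ) ≠ 0 := by exact_mod_cast hq0.ne'
  set W : ℤ → ℂ := fun n => (q : ℂ) ^ (-n) * (χ (n + 1) * ψ n - χ n * ψ (n + 1)) with hW
  have hstep : ∀ n, W (n - 1) = W n := by
    intro n
    have e1 := hψ n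
    have e2 := hχ n
    rw [jacobiExpr] at e1 e2
    simp only [hW]
    rw [show -(n - 1) = -n + 1 by ring, show n - 1 + 1 = n by ring]
    linear_combination χ n * e1 - ψ n * e2
  have hconst : ∀ (n : ℤ) (m : ℕ), W (n - m) = W n := by
    intro n m
    induction m with
    | zero => simp
    | succ m ih => rw [← ih, ← hstep (n - m)]; congr 1; push_cast; ring
  -- The weighted Wronskian is constant, while at `-∞` its weight tends to zero and the sequences
  -- stay bounded.
  have hlim : Tendsto (fun m : ℕ => W (n - m)) atTop (𝓝 0) := by
    have hgeo : Tendsto (fun m : ℕ => q ^ m * (q ^ (-n) * (2 * (‖ψ‖ * ‖χ‖)))) atTop (𝓝 0) := by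
      have := (tendsto_pow_atTop_nhds_zero_of_lt_one hq0.le hq1).mul_const
        (q ^ (-n) * (2 * (‖ψ‖ * ‖χ‖)))
      rwa [zero_mul] at this
    refine squeeze_zero_norm (fun m => ?_) hgeo
    simp only [hW]
    rw [norm_mul, norm_ofReal_zpow hq0, show -(n - (m : ℤ)) = m + -n by ring,
      zpow_add₀ hq0.ne', zpow_natCast, mul_assoc]
    refine mul_le_mul_of_nonneg_left (mul_le_mul_of_nonneg_left ((norm_sub_le _ _).trans ?_)
      (zpow_pos hq0 _).le) (pow_nonneg hq0.le _)
    rw [norm_mul, norm_mul, two_mul (‖ψ‖ * ‖χ‖), mul_comm ‖ψ‖]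
    have b1 := fun i : ℤ => lp.norm_apply_le_norm two_ne_zero ψ i
    have b2 := fun i : ℤ => lp.norm_apply_le_norm two_ne_zero χ i
    exact add_le_add (mul_le_mul (b2 _) (b1 _) (norm_nonneg _) (norm_nonneg _))
      (mul_le_mul (b2 _) (b1 _) (norm_nonneg _) (norm_nonneg _))
  have hWn : W n = 0 := by
    refine tendsto_nhds_unique ?_ hlim
    simp only [hconst]
    exact tendsto_const_nhds
  exact (mul_eq_zero.mp hWn).resolve_left (zpow_ne_zero _ hq)

/-- Subtracting the multiple that matches at an index `k` with `ψ k ≠ 0`, the Wronskian gives a zero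
at `k + 1` too, and the recursion propagates it. -/
theorem exists_eq_smul_of_eigen (hq0 : 0 < q) (hq1 : q < 1) {ψ χ : EllTwo} {x : ℂ}
    (hψ : ∀ n, jacobiExpr q ψ n = x * ψ n) (hχ : ∀ n, jacobiExpr q χ n = x * χ n)
    (h0 : ψ ≠ 0) : ∃ c : ℂ, χ = c • ψ := by
  obtain ⟨k, hk⟩ : ∃ k, ψ k ≠ 0 := by
    by_contra! h
    exact h0 (lp.ext (funext h))
  refine ⟨χ k / ψ k, ?_⟩
  rw [← sub_eq_zero]
  refine lp.ext (funext fun n => ?_)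
  have hlin : ∀ n, jacobiExpr q (χ - (χ k / ψ k) • ψ : EllTwo) n =
      x * (χ - (χ k / ψ k) • ψ : EllTwo) n := by
    intro n
    have e1 := hψ n
    have e2 := hχ n
    simp only [jacobiExpr, lp.coeFn_sub, lp.coeFn_smul, Pi.sub_apply, Pi.smul_apply,
      smul_eq_mul] at e1 e2 ⊢
    linear_combination e2 - (χ k / ψ k) * e1
  have hw := wronskian_eq_zero hq0 hq1 hψ hχ k
  refine eq_zero_of_jacobiExpr_eq hq0 hlin (k := k) ?_ ?_ n
  · simp only [lp.coeFn_sub, lp.coeFn_smul, Pi.sub_apply, Pi.smul_apply, smul_eq_mul]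
    field_simp
    simp
  · simp only [lp.coeFn_sub, lp.coeFn_smul, Pi.sub_apply, Pi.smul_apply, smul_eq_mul]
    field_simp
    linear_combination hw

/-- The value `0` is treated apart, since `eigenSeq` needs `x ≠ 0`: going back `2m` steps gains
`(-q) ^ m` on a bounded sequence. -/
theorem eq_zero_of_jacobiExpr_eq_zero (hq0 : 0 < q) (hq1 : q < 1) {ψ : EllTwo}
    (h : ∀ n, jacobiExpr q ψ n = 0) : ψ = 0 := by
  have hstep : ∀ n, ψ (n + 2) = -q * ψ n := fun n => by
    have := jacobiExpr_add_one hq0 ψ n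
    rw [h, mul_zero] at this
    linear_combination this
  have hiter : ∀ (n : ℤ) (m : ℕ), ψ n = (-q : ℂ) ^ m * ψ (n - 2 * m) := by
    intro n m
    induction m with
    | zero => simp
    | succ m ih =>
      have := hstep (n - 2 * ((m + 1 : ℕ) : ℤ))
      rw [show n - 2 * ((m + 1 : ℕ) : ℤ) + 2 = n - 2 * m by push_cast; ring] at this
      rw [ih, this, pow_succ]
      ring
  refine lp.ext (funext fun n => ?_)
  have hgeo : Tendsto (fun m : ℕ => q ^ m * ‖ψ‖) atTop (𝓝 0) := by
    have := (tendsto_pow_atTop_nhds_zero_of_lt_one hq0.le hq1).mul_const ‖ψ‖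
    rwa [zero_mul] at this
  have hle : ‖ψ n‖ ≤ 0 := by
    refine ge_of_tendsto' hgeo fun m => ?_
    rw [hiter n m, norm_mul, norm_pow, norm_neg, Complex.norm_real, Real.norm_of_nonneg hq0.le]
    exact mul_le_mul_of_nonneg_left (lp.norm_apply_le_norm two_ne_zero ψ _) (by positivity)
  exact norm_le_zero_iff.mp hle

/-- A common zero of `ϑ₁` and `ϑ₄` at `s = -log |x|` would annihilate their Wronskian, which is
positive. -/
theorem eigenSeq_boundaryValues_ne_zero (hq0 : 0 < q) (hq1 : q < 1) {x : ℝ} (hx : x ≠ 0)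
    (h1 : thetaSeries (q ^ 2) (-x ^ 2 / q ^ 2) = 0) : thetaSeries (q ^ 2) (-x ^ 2) ≠ 0 := by
  have hr0 : 0 < q ^ 2 := by positivity
  have hr1 : q ^ 2 < 1 := by nlinarith
  intro h2
  have hs : Real.exp (-2 * -Real.log |x|) = x ^ 2 := by
    rw [show -2 * -Real.log |x| = Real.log |x| + Real.log |x| by ring, Real.exp_add,
      Real.exp_log (abs_pos.mpr hx), abs_mul_abs_self, sq]
  have hw := realTheta_wronskian hr0 hr1 (-Real.log |x|)
  have e1 : realThetaOne (q ^ 2) (-Real.log |x|) = 0 := by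
    rw [realThetaOne, hs, h1, mul_zero]
  have e4 : realThetaFour (q ^ 2) (-Real.log |x|) = 0 := by
    rw [realThetaFour, hs, h2]
  rw [e1, e4, mul_zero, zero_mul, sub_zero] at hw
  have := mul_pos (pow_pos (realThetaFour_zero_pos hr0 hr1) 2) (mul_pos
    (realThetaTwo_pos hr0 hr1 (-Real.log |x|)) (realThetaThree_pos hr0 hr1 (-Real.log |x|)))
  exact this.ne hw

theorem isReal_of_mem_pointSpectrum (hq0 : 0 < q) (hq1 : q < 1) {t : OnePoint ℝ} {x : ℂ}
    (hx : x ∈ pointSpectrum (At q t)) : ∃ y : ℝ, y ≠ 0 ∧ x = y := by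
  obtain ⟨ψ, hψ0, hψ⟩ := hx
  have h := At_isFormalAdjoint hq0 hq1 t ψ ψ
  rw [hψ, inner_smul_left, inner_smul_right] at h
  obtain ⟨y, rfl⟩ := Complex.conj_eq_iff_real.mp
    (mul_right_cancel₀ (inner_self_ne_zero.mpr hψ0) h)
  refine ⟨y, ?_, rfl⟩
  rintro rfl
  refine hψ0 (eq_zero_of_jacobiExpr_eq_zero hq0 hq1 fun n => ?_)
  rw [← At_apply, hψ]
  simp

/-- Square summable solutions form a line spanned by `eigenSeq`, so only its boundary condition is
in question. It is nonzero because its boundary values are not both zero. -/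
theorem mem_pointSpectrum_iff_boundaryCond (hq0 : 0 < q) (hq1 : q < 1) (t : OnePoint ℝ) {x : ℝ}
    (hx : x ≠ 0) : (x : ℂ) ∈ pointSpectrum (At q t) ↔ BoundaryCond q (eigenSeq q x) t := by
  have hr0 : 0 < q ^ 2 := by positivity
  have hr1 : q ^ 2 < 1 := by nlinarith
  have hbv := hasBoundaryValues_eigenSeq hq0 hq1 hx
  set ψ : EllTwo := ⟨eigenSeq q x, memℓp_eigenSeq hq0 hq1 hx⟩ with hψdef
  have hψ : ∀ n, jacobiExpr q ψ n = x * ψ n := jacobiExpr_eigenSeq hq0 hq1 hx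
  have hmem : ψ ∈ maxDomain q := by
    have e : jacobiExpr q ψ = ⇑((x : ℂ) • ψ) := funext fun n => by
      rw [hψ, lp.coeFn_smul, Pi.smul_apply, smul_eq_mul]
    change Memℓp (jacobiExpr q ψ) 2
    rw [e]
    exact lp.memℓp _
  have hψ0 : ψ ≠ 0 := by
    intro h
    have hz : HasBoundaryValues q (eigenSeq q x) 0 0 := by
      have e : eigenSeq q x = ⇑(0 : EllTwo) := by rw [← h]
      rw [e]
      constructor <;> simp
    have hE := (inv_pos.mpr (qPochReal_pos hr0.le hr1 hr1)).ne'
    have e1 := tendsto_nhds_unique hbv.1 hz.1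
    have e2 := tendsto_nhds_unique hbv.2 hz.2
    rw [Complex.ofReal_eq_zero] at e1 e2
    exact eigenSeq_boundaryValues_ne_zero hq0 hq1 hx ((mul_eq_zero.mp e1).resolve_left hE)
      ((mul_eq_zero.mp ((mul_eq_zero.mp e2).resolve_left hx)).resolve_left hE)
  constructor
  · rintro ⟨χ, hχ0, hχ⟩
    have hχ' : ∀ n, jacobiExpr q (χ : EllTwo) n = x * (χ : EllTwo) n := fun n => by
      rw [← At_apply, hχ, lp.coeFn_smul, Pi.smul_apply, smul_eq_mul]
    obtain ⟨c, hc⟩ := exists_eq_smul_of_eigen hq0 hq1 hχ' hψ hχ0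
    have := BoundaryCond.smul c χ.2.1
    have e : eigenSeq q x = c • ⇑(χ : EllTwo) := by
      rw [← lp.coeFn_smul, ← hc]
    rw [e]
    exact this
  · intro hbc
    refine ⟨⟨ψ, hbc, hmem⟩, hψ0, lp.ext (funext fun n => ?_)⟩
    rw [At_apply, lp.coeFn_smul, Pi.smul_apply, smul_eq_mul]
    exact hψ n

end Eigenvectors

/-! ### The point spectrum -/

/-- The eigenvalue condition for `A_t` at the point `-e^{-s}`. -/
def EigenCond (q : ℝ) (s : ℝ) : OnePoint ℝ → Prop
  | OnePoint.some t => realThetaFour (q ^ 2) s = t * realThetaOne (q ^ 2) s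
  | OnePoint.infty => realThetaOne (q ^ 2) s = 0

section PointSpectrum

variable {q : ℝ}

theorem thetaSeries_neg_exp_sq (q s : ℝ) (x : ℝ) (hx : x ^ 2 = Real.exp (-s) ^ 2) :
    thetaSeries (q ^ 2) (-x ^ 2) = realThetaFour (q ^ 2) s ∧
      thetaSeries (q ^ 2) (-x ^ 2 / q ^ 2) = Real.exp (-s) * realThetaOne (q ^ 2) s := by
  have h : x ^ 2 = Real.exp (-2 * s) := by
    rw [hx, sq, ← Real.exp_add]; congr 1; ring
  constructor
  · rw [h, realThetaFour]
  · rw [h, realThetaOne, ← mul_assoc, ← Real.exp_add]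
    simp

theorem mem_pointSpectrum_neg_exp (hq0 : 0 < q) (hq1 : q < 1) (t : OnePoint ℝ) (s : ℝ) :
    ((-Real.exp (-s) : ℝ) : ℂ) ∈ pointSpectrum (At q t) ↔ EigenCond q s t := by
  have hr1 : q ^ 2 < 1 := by nlinarith
  have hx : -Real.exp (-s) ≠ 0 := neg_ne_zero.mpr (Real.exp_pos _).ne'
  have hE := (inv_pos.mpr (qPochReal_pos (sq_nonneg q) hr1 hr1)).ne'
  have hs := (Real.exp_pos (-s)).ne'
  obtain ⟨e4, e1⟩ := thetaSeries_neg_exp_sq q s (-Real.exp (-s)) (neg_sq _)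
  have hbv := hasBoundaryValues_eigenSeq hq0 hq1 hx
  rw [e1, e4] at hbv
  rw [mem_pointSpectrum_iff_boundaryCond hq0 hq1 t hx]
  induction t using OnePoint.rec with
  | infty =>
    refine (boundaryCond_infty_iff hq0 hbv).trans ?_
    rw [Complex.ofReal_eq_zero]
    simp only [EigenCond, mul_eq_zero, hE, hs, false_or]
  | coe t =>
    refine (boundaryCond_coe_iff hq0 hbv t).trans ?_
    rw [← Complex.ofReal_mul, ← Complex.ofReal_add, Complex.ofReal_eq_zero]
    have e : -Real.exp (-s) * ((qPochReal (q ^ 2) (q ^ 2))⁻¹ * realThetaFour (q ^ 2) s) +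
        t * ((qPochReal (q ^ 2) (q ^ 2))⁻¹ * (Real.exp (-s) * realThetaOne (q ^ 2) s)) =
        (-(Real.exp (-s) * (qPochReal (q ^ 2) (q ^ 2))⁻¹)) *
          (realThetaFour (q ^ 2) s - t * realThetaOne (q ^ 2) s) := by ring
    rw [e, mul_eq_zero, or_iff_right (neg_ne_zero.mpr (mul_ne_zero hs hE)), sub_eq_zero]
    rfl

/-- Compared with `-e^{-s}`, the sign of `x` changes and `s` becomes `-s`; evenness of `ϑ₄` and
oddness of `ϑ₁` compensate, so the condition is the same. This is why the spectrum has two families.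
-/
theorem mem_pointSpectrum_exp (hq0 : 0 < q) (hq1 : q < 1) (t : OnePoint ℝ) (s : ℝ) :
    ((Real.exp s : ℝ) : ℂ) ∈ pointSpectrum (At q t) ↔ EigenCond q s t := by
  have hr0 : 0 < q ^ 2 := by positivity
  have hr1 : q ^ 2 < 1 := by nlinarith
  have hx : Real.exp s ≠ 0 := (Real.exp_pos _).ne'
  have hE := (inv_pos.mpr (qPochReal_pos (sq_nonneg q) hr1 hr1)).ne'
  obtain ⟨e4, e1⟩ := thetaSeries_neg_exp_sq q (-s) (Real.exp s) (by rw [neg_neg])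
  rw [neg_neg, realThetaOne_neg hr0] at e1
  rw [realThetaFour_neg] at e4
  have hbv := hasBoundaryValues_eigenSeq hq0 hq1 hx
  rw [e1, e4] at hbv
  rw [mem_pointSpectrum_iff_boundaryCond hq0 hq1 t hx]
  induction t using OnePoint.rec with
  | infty =>
    refine (boundaryCond_infty_iff hq0 hbv).trans ?_
    rw [Complex.ofReal_eq_zero]
    simp only [EigenCond, mul_eq_zero, hE, hx, neg_eq_zero, false_or]
  | coe t =>
    refine (boundaryCond_coe_iff hq0 hbv t).trans ?_
    rw [← Complex.ofReal_mul, ← Complex.ofReal_add, Complex.ofReal_eq_zero]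
    have e : Real.exp s * ((qPochReal (q ^ 2) (q ^ 2))⁻¹ * realThetaFour (q ^ 2) s) +
        t * ((qPochReal (q ^ 2) (q ^ 2))⁻¹ * (Real.exp s * -realThetaOne (q ^ 2) s)) =
        (Real.exp s * (qPochReal (q ^ 2) (q ^ 2))⁻¹) *
          (realThetaFour (q ^ 2) s - t * realThetaOne (q ^ 2) s) := by ring
    rw [e, mul_eq_zero, or_iff_right (mul_ne_zero hx hE), sub_eq_zero]
    rfl

/-- The condition is homogeneous in `(ϑ₁, ϑ₄)`, and both acquire the same nonzero multiplier. -/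
theorem eigenCond_add_period (hq0 : 0 < q) (s : ℝ) (t : OnePoint ℝ) :
    EigenCond q (s + -2 * Real.log q) t ↔ EigenCond q s t := by
  have hr0 : 0 < q ^ 2 := by positivity
  have h : -(q ^ 2 * Real.exp (-2 * s))⁻¹ ≠ 0 :=
    neg_ne_zero.mpr (inv_ne_zero (mul_ne_zero hr0.ne' (Real.exp_pos _).ne'))
  rw [← neg_log_sq, ← sub_eq_add_neg]
  induction t using OnePoint.rec with
  | infty =>
    simp only [EigenCond]
    rw [realThetaOne_add_period hr0, mul_eq_zero, or_iff_right h]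
  | coe t =>
    simp only [EigenCond]
    rw [realThetaOne_add_period hr0, realThetaFour_add_period hr0, mul_left_comm t]
    exact mul_right_inj' h

theorem eigenCond_add_zsmul (hq0 : 0 < q) (s : ℝ) (t : OnePoint ℝ) (m : ℤ) :
    EigenCond q (s + m * (-2 * Real.log q)) t ↔ EigenCond q s t := by
  induction m using Int.induction_on with
  | zero => simp
  | succ m ih =>
    rw [← ih, ← eigenCond_add_period hq0 (s + (m : ℤ) * (-2 * Real.log q))]
    push_cast
    rw [show s + (m + 1) * (-2 * Real.log q) = s + m * (-2 * Real.log q) + -2 * Real.log q by ring]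
  | pred m ih =>
    rw [← ih, ← eigenCond_add_period hq0]
    push_cast
    rw [show s + (-m - 1) * (-2 * Real.log q) + -2 * Real.log q =
      s + -m * (-2 * Real.log q) by ring]

theorem eigenCond_iff_of_mem_Ico (hq0 : 0 < q) (hq1 : q < 1) {s : ℝ}
    (hs : s ∈ Ico 0 (-2 * Real.log q)) (t : OnePoint ℝ) : EigenCond q s t ↔ PhiExt q s = t := by
  have hr0 : 0 < q ^ 2 := by positivity
  have hr1 : q ^ 2 < 1 := by nlinarith
  rcases eq_or_ne s 0 with rfl | h0
  · rw [PhiExt_zero]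
    induction t using OnePoint.rec with
    | infty => simp [EigenCond, realThetaOne_zero hr0]
    | coe t =>
      have h4 := (realThetaFour_zero_pos hr0 hr1).ne'
      simp only [EigenCond, realThetaOne_zero hr0, mul_zero, h4, false_iff]
      exact OnePoint.infty_ne_coe t
  · have h1 : realThetaOne (q ^ 2) s ≠ 0 :=
      (realThetaOne_pos hr0 hr1 (lt_of_le_of_ne hs.1 h0.symm) (by
        rw [neg_log_sq]; exact hs.2)).ne'
    rw [PhiExt_of_ne_zero hq0 hq1 h0]
    induction t using OnePoint.rec with
    | infty =>
      simp only [EigenCond, h1, false_iff]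
      exact OnePoint.coe_ne_infty _
    | coe t =>
      simp only [EigenCond]
      rw [OnePoint.some_eq_iff, realPhi, div_eq_iff h1]

/-- Periodicity moves `s` into the fundamental interval, where `Φ` is injective. -/
theorem eigenCond_iff (hq0 : 0 < q) (hq1 : q < 1) (s : ℝ) (t : OnePoint ℝ) :
    EigenCond q s t ↔ ∃ m : ℤ, s = PhiInv q t + m * (-2 * Real.log q) := by
  have hL : 0 < -2 * Real.log q := by have := Real.log_neg hq0 hq1; linarith
  obtain ⟨σ, hσ, rfl⟩ := surjOn_PhiExt hq0 hq1 (mem_univ t)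
  rw [leftInvOn_PhiInv hq0 hq1 hσ]
  constructor
  · intro h
    obtain ⟨m, hm, -⟩ := existsUnique_sub_zsmul_mem_Ico hL s 0
    rw [zero_add, zsmul_eq_mul] at hm
    refine ⟨m, ?_⟩
    have hs : s = s - m * (-2 * Real.log q) + m * (-2 * Real.log q) := by ring
    rw [hs, eigenCond_add_zsmul hq0, eigenCond_iff_of_mem_Ico hq0 hq1 hm] at h
    rw [← (bijOn_PhiExt hq0 hq1).injOn hm hσ h]
    ring
  · rintro ⟨m, rfl⟩
    rw [eigenCond_add_zsmul hq0, eigenCond_iff_of_mem_Ico hq0 hq1 hσ]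

theorem exp_neg_mul_period (hq0 : 0 < q) (m : ℤ) :
    Real.exp (-(m * (-2 * Real.log q))) = q ^ (2 * m) := by
  rw [show -(m * (-2 * Real.log q)) = ((2 * m : ℤ) : ℝ) * Real.log q by push_cast; ring,
    mul_comm, ← Real.rpow_def_of_pos hq0, Real.rpow_intCast]

/-- The point spectrum of the self-adjoint extensions. -/
theorem pointSpectrum_At (hq0 : 0 < q) (hq1 : q < 1) (t : OnePoint ℝ) :
    pointSpectrum (At q t) =
      {x : ℂ | ∃ m : ℤ, x = ((-(Real.exp (-PhiInv q t) * q ^ (2 * m)) : ℝ) : ℂ)} ∪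
      {x : ℂ | ∃ n : ℤ, x = ((Real.exp (PhiInv q t) * q ^ (2 * n) : ℝ) : ℂ)} := by
  have hneg : ∀ m : ℤ, Real.exp (-(PhiInv q t + m * (-2 * Real.log q))) =
      Real.exp (-PhiInv q t) * q ^ (2 * m) := fun m => by
    rw [neg_add, Real.exp_add, exp_neg_mul_period hq0]
  -- A positive multiple of the period enlarges `e^s`, hence the exponent `-n`.
  have hpos : ∀ n : ℤ, Real.exp (PhiInv q t + n * (-2 * Real.log q)) =
      Real.exp (PhiInv q t) * q ^ (2 * -n) := fun n => by
    rw [Real.exp_add, ← exp_neg_mul_period hq0]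
    congr 2
    push_cast
    ring
  ext x
  constructor
  · intro hx
    obtain ⟨y, hy, rfl⟩ := isReal_of_mem_pointSpectrum hq0 hq1 hx
    -- A negative eigenvalue is `-e^{-s}` with `s = -log (-y)`, a positive one is `e^s` with `s =
    -- log y`.
    rcases lt_or_gt_of_ne hy with h | h
    · left
      have e : y = -Real.exp (-(-Real.log (-y))) := by
        rw [neg_neg, Real.exp_log (neg_pos.mpr h), neg_neg]
      rw [e, mem_pointSpectrum_neg_exp hq0 hq1, eigenCond_iff hq0 hq1] at hx
      obtain ⟨m, hm⟩ := hx
      exact ⟨m, by rw [e, hm, hneg]⟩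
    · right
      have e : y = Real.exp (Real.log y) := (Real.exp_log h).symm
      rw [e, mem_pointSpectrum_exp hq0 hq1, eigenCond_iff hq0 hq1] at hx
      obtain ⟨n, hn⟩ := hx
      exact ⟨-n, by rw [e, hn, hpos]⟩
  · rintro (⟨m, rfl⟩ | ⟨n, rfl⟩)
    · rw [← hneg, mem_pointSpectrum_neg_exp hq0 hq1, eigenCond_iff hq0 hq1]
      exact ⟨m, rfl⟩
    · rw [← neg_neg n, ← hpos, mem_pointSpectrum_exp hq0 hq1, eigenCond_iff hq0 hq1]
      exact ⟨-n, rfl⟩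

end PointSpectrum

theorem mainTheorem1 (q : ℝ) (hq0 : 0 < q) (hq1 : q < 1) :
    -- the operators `A_t`, `t ∈ ℝ ∪ {∞}`, are precisely the self-adjoint extensions of `A`
    (∀ T : EllTwo →ₗ.[ℂ] EllTwo,
      (Amin q ≤ T ∧ IsSelfAdjoint T) ↔ ∃ t : OnePoint ℝ, T = At q t) ∧
    -- `Φ` is real-valued and strictly decreasing on `(0, -2 ln q)`,
    -- and maps `[0, -2 ln q)` bijectively onto `ℝ ∪ {∞}`
    (∀ s ∈ Set.Ioo 0 (-2 * Real.log q), (Phi q s).im = 0) ∧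
    StrictAntiOn (fun s : ℝ => (Phi q s).re) (Set.Ioo 0 (-2 * Real.log q)) ∧
    Set.BijOn (PhiExt q) (Set.Ico 0 (-2 * Real.log q)) Set.univ ∧
    -- `Φ` is a scaled Jacobian elliptic function `cs`
    (∀ s ∈ Set.Ioo 0 (-2 * Real.log q),
      (Phi q s).re =
        q ^ (1 / 2 : ℝ) * (thetaThreeConst (q ^ 2) / thetaTwoConst (q ^ 2)) *
          jacobiCs (s * thetaThreeConst (q ^ 2) ^ 2)
            (thetaFourConst (q ^ 2) ^ 2 / thetaThreeConst (q ^ 2) ^ 2)) ∧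
    -- the inverse of `Φ` is given by the (convergent) elliptic integral
    MeasureTheory.Integrable (ellipticIntegrand q) ∧
    Set.InvOn (PhiInv q) (PhiExt q) (Set.Ico 0 (-2 * Real.log q)) Set.univ ∧
    -- the point spectrum of `A_t`
    (∀ t : OnePoint ℝ,
      pointSpectrum (At q t) =
        {x : ℂ | ∃ m : ℤ, x = ((-(Real.exp (-PhiInv q t) * q ^ (2 * m)) : ℝ) : ℂ)} ∪
        {x : ℂ | ∃ n : ℤ, x = ((Real.exp (PhiInv q t) * q ^ (2 * n) : ℝ) : ℂ)}) := by
  exact ⟨selfAdjoint_extension_iff hq0 hq1,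
    fun s _ => by rw [Phi_eq_realPhi hq0 hq1, Complex.ofReal_im],
    strictAntiOn_Phi hq0 hq1, bijOn_PhiExt hq0 hq1,
    fun s hs => Phi_re_eq_jacobiCs hq0 hq1 hs,
    integrable_ellipticIntegrand hq0 hq1, invOn_PhiInv hq0 hq1,
    pointSpectrum_At hq0 hq1⟩
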